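/- Let $\mathbb N^d$ carry the product partial order, and regard subsets of $\mathbb N^d$ as full subposets. A poset is connected if it is nonempty and any two of its elements are joined by a finite sequence of elements whose consecutive members are comparable; a component is a maximal connected subposet. An interval $Q\subseteq\mathbb N^d$ is a connected subset such that $p\le q\le r$ with $p,r\in Q$ implies $q\in Q$. For a subset $S\subseteq\mathbb N^d$ write $M_S$ for its set of minimal elements. For $q\in Q$ let $Q_{<q}=\{p\in Q: p<q\}$, and let $I_Q=\{q\in Q: Q_{<q}\text{ is not connected}\}$ (so $M_Q\subseteq I_Q$, as the empty poset is not connected). An initial scaffold of $Q$ is a (not necessarily full) subposet $P$ of $Q$ whose set of elements is $I_Q$ and such that for each $p\in P$ and each component $A$ of $Q_{<p}$ there is exactly one relation $m<p$ in $P$ with $m\in A$. The upset presentation of an interval $Q\subseteq\mathbb N^d$ is the pair of sets $(M_Q,M_{Q'})$, where $Q'=\{x\in\mathbb N^d: x\ge q\text{ for some }q\in Q\}\setminus Q$, and $\|Q\|=|M_Q|+|M_{Q'}|$. Running times count elementary steps on a unit-cost pointer machine, programmed by first-order recursive functions: its data are natural numbers and ordered pairs of pointers to data, and its elementary steps are reading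 a variable, loading a constant, creating a pair, following one of the two pointers of a pair, binding a variable, testing whether a datum is a number, comparing two numbers, adding $1$ to a number, and calling a function. Points are given as lists of coordinates and sets as lists, in an arbitrary order, without repetitions. Computing a subposet means to output the list of its elements and the list of its non-identity relations, without repetitions. **Theorem.** For every fixed $d\ge 2$ there is a program which, given the upset presentation of any interval $Q\subseteq\mathbb N^d$, computes an initial scaffold of $Q$, in time bounded by a function of $n=\|Q\|$ that is (i) $O(n\log n)$ if $d\in\{2,3\}$, (ii) $O(n^4)$ if $d>3$. The same bounds hold, by a program depending only on $d$, if $Q$ is finite and is instead specified by its set of minimal elements and its set of maximal elements, given separately, with $n$ the total number of these. The implied constants depend only on $d$. -/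

import Mathlib

open Filter Asymptotics

namespace InitScaffold

/-! ### Posets, intervals and initial scaffolds

Subsets of a poset `α` are regarded as full subposets of `α`. -/

/-- A subset `S` of a poset, viewed as a full subposet, is connected if it is nonempty and any two
of its elements are joined by a path in `S`, i.e. by a finite sequence of elements of `S` whose
consecutive members are comparable. -/
def PosetConnected {α : Type*} [PartialOrder α] (S : Set α) : Prop :=
  S.Nonempty ∧ ∀ a ∈ S, ∀ b ∈ S,
    Relation.ReflTransGen (fun x y => x ∈ S ∧ y ∈ S ∧ (x ≤ y ∨ y ≤ x)) a b

/-- `A` is a component of `S`: a maximal connected subposet of `S`. -/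
def IsComponent {α : Type*} [PartialOrder α] (S A : Set α) : Prop :=
  Maximal (fun B : Set α => B ⊆ S ∧ PosetConnected B) A

/-- An interval: a (nonempty) connected subset that is convex. -/
def IsInterval {α : Type*} [PartialOrder α] (Q : Set α) : Prop :=
  PosetConnected Q ∧ Q.OrdConnected

/-- The open downset of `q` in `Q`. -/
def openDownset {α : Type*} [PartialOrder α] (Q : Set α) (q : α) : Set α :=
  {p | p ∈ Q ∧ p < q}

/-- The set of minima (minimal elements) of `Q`. -/
def minima {α : Type*} [PartialOrder α] (Q : Set α) : Set α :=
  {m | Minimal (fun x => x ∈ Q) m}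

/-- The set of maxima (maximal elements) of `Q`. -/
def maxima {α : Type*} [PartialOrder α] (Q : Set α) : Set α :=
  {m | Maximal (fun x => x ∈ Q) m}

/-- The points of `Q` whose open downset in `Q` is disconnected.  The empty set is disconnected, so
this includes all the minima of `Q`. -/
def initialHull {α : Type*} [PartialOrder α] (Q : Set α) : Set α :=
  {q | q ∈ Q ∧ ¬ PosetConnected (openDownset Q q)}

/-- A (not necessarily full) subposet of the full subposet `Q` of `α`: a set of elements of `Q`
together with a partial order on it that is contained in the order of `Q` (so that antisymmetry
is automatic). -/
structure Subposet {α : Type*} [PartialOrder α] (Q : Set α) where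
  carrier : Set α
  carrier_subset : carrier ⊆ Q
  rel : α → α → Prop
  mem_of_rel : ∀ {x y}, rel x y → x ∈ carrier ∧ y ∈ carrier
  le_of_rel : ∀ {x y}, rel x y → x ≤ y
  rel_refl : ∀ {x}, x ∈ carrier → rel x x
  rel_trans : ∀ {x y z}, rel x y → rel y z → rel x z

/-- `P` is an initial scaffold of `Q`: its elements are the points of `Q` with disconnected open
downset, and for every element `p` of `P` and every component `A` of the open downset of `p` in
`Q`, exactly one relation `m < p` with `m ∈ A` belongs to `P`. -/
structure IsInitialScaffold {α : Type*} [PartialOrder α] {Q : Set α} (P : Subposet Q) : Prop where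
  carrier_eq : P.carrier = initialHull Q
  existsUnique_rel : ∀ p ∈ P.carrier, ∀ A : Set α, IsComponent (openDownset Q p) A →
    ∃! m, m ∈ A ∧ P.rel m p

/-- For `Q ⊆ ℕ^d` with the product order, the set `Q'` of the points that lie above a point of `Q`
but not in `Q`.  The upset presentation of `Q` is `(minima Q, minima (deathSet Q))`. -/
def deathSet {d : ℕ} (Q : Set (Fin d → ℕ)) : Set (Fin d → ℕ) :=
  (upperClosure Q : Set (Fin d → ℕ)) \ Q

/-- `l` lists the elements of the set `S`, each of them once, in an arbitrary order. -/
def Enumerates {β : Type*} (l : List β) (S : Set β) : Prop :=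
  l.Nodup ∧ ∀ x, x ∈ l ↔ x ∈ S

/-! ### The model of computation

A unit-cost pointer machine, given as a first-order recursive (Lisp-like) language.  The data are
natural numbers and ordered pairs.  A pair is a memory cell that holds pointers to its two
components, so that creating a pair, following a pointer and copying a pointer are all elementary
operations.  Natural numbers can only be copied, compared and incremented, and a program may
contain fixed numbers. -/

/-- Data: a natural number, or a pair of data. -/
inductive Val : Type
  | atom (n : ℕ)
  | cons (a b : Val)

/-- Expressions.  Variables are de Bruijn indices into the current environment, and `call f e`
calls the `f`-th function of the program on the value of `e`. -/
inductive Exp : Type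
  | var (i : ℕ)
  | const (n : ℕ)
  | succ (e : Exp)
  | cons (e₁ e₂ : Exp)
  | fst (e : Exp)
  | snd (e : Exp)
  | letIn (e body : Exp)
  | ifAtom (e thn els : Exp)
  | ifLe (e₁ e₂ thn els : Exp)
  | call (f : ℕ) (e : Exp)

/-- A program is a finite list of function bodies.  Each function has one argument, which is
variable `0` of its body, and functions may call each other recursively. -/
abbrev Program : Type := List Exp

/-- `Eval P ρ e v t`: in the environment `ρ`, the expression `e` of the program `P` evaluates
(eagerly) to `v` in exactly `t` elementary steps.  Every variable access, constant, increment,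
creation of a pair, projection, binding, test, comparison and function call costs one step.  There
is no rule for meaningless operations such as projecting or incrementing the wrong kind of value:
such an evaluation has no result. -/
inductive Eval (P : Program) : List Val → Exp → Val → ℕ → Prop
  | var {ρ i v} : ρ[i]? = some v → Eval P ρ (.var i) v 1
  | const {ρ n} : Eval P ρ (.const n) (.atom n) 1
  | succ {ρ e n t} : Eval P ρ e (.atom n) t → Eval P ρ (.succ e) (.atom (n + 1)) (t + 1)
  | cons {ρ e₁ e₂ a b s t} : Eval P ρ e₁ a s → Eval P ρ e₂ b t →
      Eval P ρ (.cons e₁ e₂) (.cons a b) (s + t + 1)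
  | fst {ρ e a b t} : Eval P ρ e (.cons a b) t → Eval P ρ (.fst e) a (t + 1)
  | snd {ρ e a b t} : Eval P ρ e (.cons a b) t → Eval P ρ (.snd e) b (t + 1)
  | letIn {ρ e body v w s t} : Eval P ρ e v s → Eval P (v :: ρ) body w t →
      Eval P ρ (.letIn e body) w (s + t + 1)
  | ifAtom_atom {ρ e thn els n v s t} : Eval P ρ e (.atom n) s → Eval P ρ thn v t →
      Eval P ρ (.ifAtom e thn els) v (s + t + 1)
  | ifAtom_cons {ρ e thn els a b v s t} : Eval P ρ e (.cons a b) s → Eval P ρ els v t →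
      Eval P ρ (.ifAtom e thn els) v (s + t + 1)
  | ifLe_le {ρ e₁ e₂ thn els m n v r s t} : Eval P ρ e₁ (.atom m) r → Eval P ρ e₂ (.atom n) s →
      m ≤ n → Eval P ρ thn v t → Eval P ρ (.ifLe e₁ e₂ thn els) v (r + s + t + 1)
  | ifLe_gt {ρ e₁ e₂ thn els m n v r s t} : Eval P ρ e₁ (.atom m) r → Eval P ρ e₂ (.atom n) s →
      n < m → Eval P ρ els v t → Eval P ρ (.ifLe e₁ e₂ thn els) v (r + s + t + 1)
  | call {ρ f e body v w s t} : P[f]? = some body → Eval P ρ e v s → Eval P [v] body w t →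
      Eval P ρ (.call f e) w (s + t + 1)

/-- The program `P`, i.e. its function number `0`, halts on the input `inp` with output `out`
after exactly `t` elementary steps. -/
def Program.Runs (P : Program) (inp out : Val) (t : ℕ) : Prop :=
  Eval P [inp] (.call 0 (.var 0)) out t

/-! ### Input and output -/

/-- Linked lists: `0` is the empty list, and a pair holds the head and the tail. -/
def encList : List Val → Val
  | [] => .atom 0
  | a :: l => .cons a (encList l)

/-- A point of `ℕ^d` is given as the list of its coordinates. -/
def encPoint {d : ℕ} (x : Fin d → ℕ) : Val :=
  encList ((List.ofFn x).map Val.atom)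

/-- A list of points of `ℕ^d`. -/
def encPoints {d : ℕ} (l : List (Fin d → ℕ)) : Val :=
  encList (l.map encPoint)

/-- A list of pairs of points of `ℕ^d`. -/
def encRelations {d : ℕ} (l : List ((Fin d → ℕ) × (Fin d → ℕ))) : Val :=
  encList (l.map fun r => Val.cons (encPoint r.1) (encPoint r.2))

/-- `out` represents the subposet `P`: it is a pair of a list of the elements of `P` and a list of
the non-identity relations of `P`, both without repetitions. -/
def Represents {d : ℕ} {Q : Set (Fin d → ℕ)} (out : Val) (P : Subposet Q) : Prop :=
  ∃ (elts : List (Fin d → ℕ)) (rels : List ((Fin d → ℕ) × (Fin d → ℕ))),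
    Enumerates elts P.carrier ∧
    Enumerates rels {r | P.rel r.1 r.2 ∧ r.1 ≠ r.2} ∧
    out = .cons (encPoints elts) (encRelations rels)

/-- Initial scaffolds of intervals in `ℕ^d` can be computed from upset presentations in time
`O(g n)`, where `n` is the size of the presentation: one program, given any listings of the two
sets of the upset presentation of any interval, computes an initial scaffold in at most `T n`
elementary steps, where `T = O(g)`. -/
def ScaffoldFromUpsetPresentation (d : ℕ) (g : ℕ → ℝ) : Prop :=
  ∃ (prog : Program) (T : ℕ → ℕ), (fun n => (T n : ℝ)) =O[atTop] g ∧
    ∀ Q : Set (Fin d → ℕ), IsInterval Q →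
      ∀ births deaths : List (Fin d → ℕ),
        Enumerates births (minima Q) → Enumerates deaths (minima (deathSet Q)) →
        ∃ (out : Val) (t : ℕ), prog.Runs (.cons (encPoints births) (encPoints deaths)) out t ∧
          t ≤ T (births.length + deaths.length) ∧
          ∃ P : Subposet Q, IsInitialScaffold P ∧ Represents out P

/-- The same for finite intervals specified by their extrema, where `n` is the total number of
minima and maxima. -/
def ScaffoldFromExtrema (d : ℕ) (g : ℕ → ℝ) : Prop :=
  ∃ (prog : Program) (T : ℕ → ℕ), (fun n => (T n : ℝ)) =O[atTop] g ∧
    ∀ Q : Set (Fin d → ℕ), IsInterval Q → Q.Finite →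
      ∀ mins maxs : List (Fin d → ℕ),
        Enumerates mins (minima Q) → Enumerates maxs (maxima Q) →
        ∃ (out : Val) (t : ℕ), prog.Runs (.cons (encPoints mins) (encPoints maxs)) out t ∧
          t ≤ T (mins.length + maxs.length) ∧
          ∃ P : Subposet Q, IsInitialScaffold P ∧ Represents out P

end InitScaffold

open InitScaffold

namespace InitScaffold

/-! ### A functional form of the evaluation relation -/

/-! Let `q ∈ Q` be no minimum. Every component of the open downset of `q` contains a minimum of `Q`.
If `m` and `n` are minima below `q` with `m ⊔ n ≠ q`, then `m ⊔ n` lies in `Q` by convexity and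
strictly below `q`, so it links `m` and `n` (`linked_of_not_le_sup`). Hence minima of different
components have join `q`. Put differently: call the coordinates in which some minimum of a component
is smaller than `q` the support of that component; supports of different components are disjoint. A
scaffold amounts to the points of the initial hull together with one minimum per component
(`exists_isInitialScaffold`).

For `d > 3`, all joins of pairs of minima are examined, quadratically many. For each of them the
minima below it are sorted into components in quadratic time, where a component is remembered only
by a representative and by the meet of its minima: a coordinate in which the meet is below `q` is
witnessed by a minimum of the component (`represent_classes`). Comparing with the deaths or maxima
and with the points already found stays within the same bound (`joinProgram_runs`).

For `d ≤ 3`, two disjoint nonempty supports cannot both have two elements. So some component has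
support in a single coordinate `i`, and one can find a minimum `a` that is alone in being smaller
than `q` in coordinate `i` and equals `q` elsewhere (`exists_isSpike`). Then `q` arises from `a` by
raising coordinate `i` to the least `b i` over the other minima `b` with `b ≤ a` off `i`
(`isSpike_iff`), so there are at most `d` candidates per minimum. The representatives are also read
off: with one such `a`, all other minima below `q` form one component; with several, every minimum
below `q` is of this kind (`represent_complete`).

Finding these least values is a dominance query in two coordinates. It is answered for all minima at
once by a merge sort that carries along the least value seen in the left half (`Swept.merge`), in
time `O(n log n)`. Sorting the candidates brings equal points together (`groups_spec`), and
membership in `Q` is decided by a second sweep of the same kind over the deaths, or over the maxima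
with reversed order (`spikes_perm`).

Costs are obtained by turning the evaluation relation into a partial function that `simp` can
execute; nearly all loops are instances of one fold (`computes_fold`). -/

theorem Eval.unique {P : Program} {ρ : List Val} {e : Exp} {v w : Val} {s t : ℕ}
    (h : Eval P ρ e v s) (h' : Eval P ρ e w t) : v = w ∧ s = t := by
  induction h generalizing w t with
  | var h => cases h'; simp_all
  | const => cases h'; simp
  | succ _ ih => cases h' with | succ h => have := ih h; simp_all
  | cons _ _ ih₁ ih₂ =>
    cases h' with | cons h₁ h₂ => have := ih₁ h₁; have := ih₂ h₂; simp_all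
  | fst _ ih => cases h' with | fst h => have := ih h; simp_all
  | snd _ ih => cases h' with | snd h => have := ih h; simp_all
  | letIn _ _ ih₁ ih₂ =>
    cases h' with
    | letIn h₁ h₂ =>
      obtain ⟨rfl, rfl⟩ := ih₁ h₁
      obtain ⟨rfl, rfl⟩ := ih₂ h₂
      simp
  | ifAtom_atom _ _ ih₁ ih₂ =>
    cases h' with
    | ifAtom_atom h₁ h₂ => have := ih₁ h₁; have := ih₂ h₂; simp_all
    | ifAtom_cons h₁ h₂ => have := ih₁ h₁; simp_all
  | ifAtom_cons _ _ ih₁ ih₂ =>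
    cases h' with
    | ifAtom_atom h₁ h₂ => have := ih₁ h₁; simp_all
    | ifAtom_cons h₁ h₂ => have := ih₁ h₁; have := ih₂ h₂; simp_all
  | ifLe_le _ _ hle _ ih₁ ih₂ ih₃ =>
    cases h' with
    | ifLe_le h₁ h₂ _ h₃ => have := ih₁ h₁; have := ih₂ h₂; have := ih₃ h₃; simp_all
    | ifLe_gt h₁ h₂ hlt h₃ =>
      have := ih₁ h₁; have := ih₂ h₂; simp_all; omega
  | ifLe_gt _ _ hlt _ ih₁ ih₂ ih₃ =>
    cases h' with
    | ifLe_gt h₁ h₂ _ h₃ => have := ih₁ h₁; have := ih₂ h₂; have := ih₃ h₃; simp_all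
    | ifLe_le h₁ h₂ hlt h₃ =>
      have := ih₁ h₁; have := ih₂ h₂; simp_all; omega
  | call hf _ _ ih₁ ih₂ =>
    cases h' with
    | call hf' h₁ h₂ =>
      obtain ⟨rfl, rfl⟩ := ih₁ h₁
      rw [hf] at hf'
      cases hf'
      obtain ⟨rfl, rfl⟩ := ih₂ h₂
      simp

open Classical in
/-- The value of an expression and the number of steps of its evaluation, if there are any. -/
noncomputable def sem (P : Program) (ρ : List Val) (e : Exp) : Option (Val × ℕ) :=
  if h : ∃ r : Val × ℕ, Eval P ρ e r.1 r.2 then some h.choose else none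

/-- Determinism makes the chosen result the only one, so the relation may be replaced by a function
whose rewriting rules execute programs symbolically. -/
theorem sem_eq_some {P : Program} {ρ : List Val} {e : Exp} {r : Val × ℕ} :
    sem P ρ e = some r ↔ Eval P ρ e r.1 r.2 := by
  unfold sem
  split_ifs with h
  · have hc := h.choose_spec
    constructor
    · intro hr
      simp only [Option.some.injEq] at hr
      rwa [← hr]
    · intro hr
      obtain ⟨h₁, h₂⟩ := Eval.unique hc hr
      simp only [Option.some.injEq]
      exact Prod.ext h₁ h₂
  · simp only [false_iff]
    exact fun hr => h ⟨r, hr⟩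

theorem Eval.sem_eq {P : Program} {ρ : List Val} {e : Exp} {v : Val} {t : ℕ}
    (h : Eval P ρ e v t) : sem P ρ e = some (v, t) :=
  sem_eq_some.2 h

/-- The result of a call of the `f`-th function, not counting the call itself. -/
noncomputable def app (P : Program) (f : ℕ) (v : Val) : Option (Val × ℕ) :=
  P[f]?.bind fun b => sem P [v] b

theorem app_of_getElem? {P : Program} {f : ℕ} {b : Exp} (h : P[f]? = some b) (v : Val) :
    app P f v = sem P [v] b := by
  simp [app, h]

/-- The first component of a pair. -/
@[simp] def Val.fst? : Val → Option Val
  | .atom _ => none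
  | .cons a _ => some a

/-- The second component of a pair. -/
@[simp] def Val.snd? : Val → Option Val
  | .atom _ => none
  | .cons _ b => some b

/-- The number that a datum is. -/
@[simp] def Val.nat? : Val → Option ℕ
  | .atom n => some n
  | .cons _ _ => none

/-- Whether a datum is a number. -/
@[simp] def Val.isAtom : Val → Bool
  | .atom _ => true
  | .cons _ _ => false

/-- Sequential composition of evaluations. -/
def chain (o : Option (Val × ℕ)) (f : Val → ℕ → Option (Val × ℕ)) : Option (Val × ℕ) :=
  o.bind fun r => f r.1 r.2

@[simp] theorem chain_some {v : Val} {t : ℕ} {f : Val → ℕ → Option (Val × ℕ)} :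
    chain (some (v, t)) f = f v t := rfl

/-- The second evaluation is not simplified before the first one is completed. -/
@[congr] theorem chain_congr {o o' : Option (Val × ℕ)} {f : Val → ℕ → Option (Val × ℕ)}
    (h : o = o') : chain o f = chain o' f := by
  rw [h]

theorem chain_eq_some {o : Option (Val × ℕ)} {f : Val → ℕ → Option (Val × ℕ)} {r : Val × ℕ} :
    chain o f = some r ↔ ∃ v t, o = some (v, t) ∧ f v t = some r := by
  simp [chain, Option.bind_eq_some_iff]

/-! ### Evaluation rules as rewriting rules -/

section sem
variable {P : Program} {ρ : List Val} {e e₁ e₂ e₃ e₄ : Exp}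

@[simp] theorem sem_var {i : ℕ} : sem P ρ (.var i) = ρ[i]?.map fun v => (v, 1) := by
  ext ⟨v, t⟩
  rw [sem_eq_some]
  constructor
  · rintro ⟨⟩
    simp_all
  · intro h
    simp only [Option.map_eq_some_iff, Prod.mk.injEq] at h
    obtain ⟨w, hw, rfl, rfl⟩ := h
    exact .var hw

@[simp] theorem sem_const {n : ℕ} : sem P ρ (.const n) = some (.atom n, 1) :=
  sem_eq_some.2 .const

@[simp] theorem sem_cons : sem P ρ (.cons e₁ e₂) =
    chain (sem P ρ e₁) fun v t => chain (sem P ρ e₂) fun w u => some (.cons v w, t + u + 1) := by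
  ext ⟨v, t⟩
  rw [sem_eq_some]
  constructor
  · rintro ⟨⟩
    rename_i h₁ h₂
    rw [Eval.sem_eq h₁, Eval.sem_eq h₂]
    simp
  · intro h
    simp only [chain_eq_some, sem_eq_some] at h
    obtain ⟨a, s, ha, b, u, hb, h⟩ := h
    cases h
    exact .cons ha hb

@[simp] theorem sem_fst : sem P ρ (.fst e) =
    chain (sem P ρ e) fun v t => v.fst?.map fun a => (a, t + 1) := by
  ext ⟨v, t⟩
  rw [sem_eq_some]
  constructor
  · rintro ⟨⟩
    rename_i h
    rw [Eval.sem_eq h]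
    simp
  · intro h
    simp only [chain_eq_some, Option.map_eq_some_iff, sem_eq_some] at h
    obtain ⟨a, s, ha, n, hn, h⟩ := h
    cases a <;> simp at hn h
    obtain ⟨rfl, rfl⟩ := h
    subst hn
    exact .fst ha

@[simp] theorem sem_snd : sem P ρ (.snd e) =
    chain (sem P ρ e) fun v t => v.snd?.map fun a => (a, t + 1) := by
  ext ⟨v, t⟩
  rw [sem_eq_some]
  constructor
  · rintro ⟨⟩
    rename_i h
    rw [Eval.sem_eq h]
    simp
  · intro h
    simp only [chain_eq_some, Option.map_eq_some_iff, sem_eq_some] at h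
    obtain ⟨a, s, ha, n, hn, h⟩ := h
    cases a <;> simp at hn h
    obtain ⟨rfl, rfl⟩ := h
    subst hn
    exact .snd ha

@[simp] theorem sem_letIn : sem P ρ (.letIn e₁ e₂) =
    chain (sem P ρ e₁) fun v t =>
      chain (sem P (v :: ρ) e₂) fun w u => some (w, t + u + 1) := by
  ext ⟨v, t⟩
  rw [sem_eq_some]
  constructor
  · rintro ⟨⟩
    rename_i h₁ h₂
    rw [Eval.sem_eq h₁]
    simp [Eval.sem_eq h₂]
  · intro h
    simp only [chain_eq_some, sem_eq_some] at h
    obtain ⟨a, s, ha, b, u, hb, h⟩ := h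
    cases h
    exact .letIn ha hb

@[simp] theorem sem_ifAtom : sem P ρ (.ifAtom e₁ e₂ e₃) =
    chain (sem P ρ e₁) fun v t =>
      if v.isAtom then chain (sem P ρ e₂) fun w u => some (w, t + u + 1)
      else chain (sem P ρ e₃) fun w u => some (w, t + u + 1) := by
  ext ⟨v, t⟩
  rw [sem_eq_some]
  constructor
  · rintro ⟨⟩ <;>
    · rename_i h₁ h₂
      rw [Eval.sem_eq h₁, Eval.sem_eq h₂]
      simp
  · intro h
    simp only [chain_eq_some, sem_eq_some] at h
    obtain ⟨a, s, ha, h⟩ := h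
    cases a <;> simp [chain_eq_some, sem_eq_some] at h <;> obtain ⟨w, hw, rfl⟩ := h
    · exact .ifAtom_atom ha hw
    · exact .ifAtom_cons ha hw

@[simp] theorem sem_ifLe : sem P ρ (.ifLe e₁ e₂ e₃ e₄) =
    chain (sem P ρ e₁) fun v t => chain (sem P ρ e₂) fun w u =>
      v.nat?.bind fun m => w.nat?.bind fun n =>
        if m ≤ n then chain (sem P ρ e₃) fun x s => some (x, t + u + s + 1)
        else chain (sem P ρ e₄) fun x s => some (x, t + u + s + 1) := by
  ext ⟨v, t⟩
  rw [sem_eq_some]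
  constructor
  · rintro ⟨⟩ <;>
    · rename_i hmn h₁ h₂ h₃
      rw [Eval.sem_eq h₁, Eval.sem_eq h₂, Eval.sem_eq h₃]
      simp [hmn]
  · intro h
    simp only [chain_eq_some, Option.bind_eq_some_iff, sem_eq_some] at h
    obtain ⟨a, s, ha, b, u, hb, m, hm, n, hn, h⟩ := h
    cases a <;> simp at hm
    cases b <;> simp at hn
    subst hm hn
    split_ifs at h with hmn <;> simp [chain_eq_some, sem_eq_some] at h <;>
      obtain ⟨w, hw, rfl⟩ := h
    · exact .ifLe_le ha hb hmn hw
    · exact .ifLe_gt ha hb (by omega) hw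

@[simp] theorem sem_call {f : ℕ} : sem P ρ (.call f e) =
    chain (sem P ρ e) fun v t => chain (app P f v) fun w u => some (w, t + u + 1) := by
  ext ⟨v, t⟩
  rw [sem_eq_some]
  constructor
  · rintro ⟨⟩
    rename_i b _ _ hb h₁ h₂
    rw [Eval.sem_eq h₁]
    simp [app, hb, Eval.sem_eq h₂]
  · intro h
    simp only [app, chain_eq_some, Option.bind_eq_some_iff, sem_eq_some] at h
    obtain ⟨a, s, ha, b, u, ⟨c, hc, hb⟩, h⟩ := h
    cases h
    exact .call hc ha hb

end sem

/-- Calling the `f`-th function on `v` yields `w` within `B` steps. -/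
def Computes (P : Program) (f : ℕ) (v w : Val) (B : ℕ) : Prop :=
  ∃ t ≤ B, app P f v = some (w, t)

/-- Evaluating `e` in the environment `ρ` yields `w` within `B` steps. -/
def Yields (P : Program) (ρ : List Val) (e : Exp) (w : Val) (B : ℕ) : Prop :=
  ∃ t ≤ B, sem P ρ e = some (w, t)

theorem Computes.mono {P : Program} {f : ℕ} {v w : Val} {B C : ℕ} (h : Computes P f v w B)
    (hBC : B ≤ C) : Computes P f v w C :=
  let ⟨t, ht, h⟩ := h; ⟨t, ht.trans hBC, h⟩

theorem Yields.mono {P : Program} {ρ : List Val} {e : Exp} {w : Val} {B C : ℕ}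
    (h : Yields P ρ e w B) (hBC : B ≤ C) : Yields P ρ e w C :=
  let ⟨t, ht, h⟩ := h; ⟨t, ht.trans hBC, h⟩

theorem Computes.runs {P : Program} {v w : Val} {B : ℕ} (h : Computes P 0 v w B) :
    ∃ t ≤ B + 2, P.Runs v w t := by
  obtain ⟨t, ht, h⟩ := h
  refine ⟨1 + t + 1, by omega, ?_⟩
  have : sem P [v] (.call 0 (.var 0)) = some (w, 1 + t + 1) := by simp [h]
  exact sem_eq_some.1 this

/-! ### Folds over lists -/

/-- The body of the function number `f` that maps a pair of a list `l` and a parameter to a right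
fold of `l`.  In `base`, variable `0` is the argument; in `step`, variable `0` is the result for
the tail of the list, and variable `1` is the argument. -/
def foldExp (f : ℕ) (base step : Exp) : Exp :=
  .ifAtom (.fst (.var 0)) base
    (.letIn (.call f (.cons (.snd (.fst (.var 0))) (.snd (.var 0)))) step)

/-- The step is required only at suffixes of `l`, so it may use facts about the accumulated result,
such as its length. The summand 20 generously pays for the test, the recursive call and the binding
in `foldExp`. -/
theorem computes_fold_sum {P : Program} {f : ℕ} {base step : Exp}
    (hf : P[f]? = some (foldExp f base step)) {X Y : Type*} (ex : X → Val) (ey : Y → Val)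
    (p : Val) (g : X → Y → Y) (b : Y) {B : ℕ} {C : X → ℕ}
    (hb : Yields P [.cons (.atom 0) p] base (ey b) B) (l : List X)
    (hs : ∀ x l', (x :: l') <:+ l → Yields P
      [ey (l'.foldr g b), .cons (.cons (ex x) (encList (l'.map ex))) p] step
      (ey (g x (l'.foldr g b))) (C x)) :
    Computes P f (.cons (encList (l.map ex)) p) (ey (l.foldr g b))
      ((l.map fun x => C x + 20).sum + B + 5) := by
  induction l with
  | nil =>
    obtain ⟨t, ht, hb⟩ := hb
    rw [Computes, app_of_getElem? hf]
    simp [foldExp, encList, hb]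
    omega
  | cons x l ih =>
    obtain ⟨t, ht, h₁⟩ := ih fun y l' h => hs y l' (h.trans (List.suffix_cons _ _))
    obtain ⟨u, hu, h₂⟩ := hs x l List.suffix_rfl
    rw [Computes, app_of_getElem? hf]
    simp only [encList, List.map_cons, List.foldr_cons, List.sum_cons] at h₂ ⊢
    generalize (l.map fun x => C x + 20).sum = S at ht ⊢
    simp [foldExp, h₁, h₂]
    omega

theorem computes_fold {P : Program} {f : ℕ} {base step : Exp}
    (hf : P[f]? = some (foldExp f base step)) {X Y : Type*} (ex : X → Val) (ey : Y → Val)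
    (p : Val) (g : X → Y → Y) (b : Y) {B C : ℕ}
    (hb : Yields P [.cons (.atom 0) p] base (ey b) B) (l : List X)
    (hs : ∀ x l', (x :: l') <:+ l → Yields P
      [ey (l'.foldr g b), .cons (.cons (ex x) (encList (l'.map ex))) p] step
      (ey (g x (l'.foldr g b))) C) :
    Computes P f (.cons (encList (l.map ex)) p) (ey (l.foldr g b))
      (l.length * (C + 20) + B + 5) := by
  have := computes_fold_sum hf ex ey p g b hb l hs
  simpa using this

/-! ### Components of open downsets -/

section Linked
variable {α : Type*} [PartialOrder α] {S : Set α} {a b c x : α}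

/-- Two elements are linked in `S` if they are joined by a path in `S`. -/
def Linked (S : Set α) : α → α → Prop :=
  Relation.ReflTransGen fun x y => x ∈ S ∧ y ∈ S ∧ (x ≤ y ∨ y ≤ x)

theorem Linked.refl : Linked S a a := Relation.ReflTransGen.refl

theorem Linked.symm (h : Linked S a b) : Linked S b a := by
  have : Std.Symm fun x y => x ∈ S ∧ y ∈ S ∧ (x ≤ y ∨ y ≤ x) :=
    ⟨fun _ _ h => ⟨h.2.1, h.1, h.2.2.symm⟩⟩
  exact (Relation.ReflTransGen.stdSymm).symm _ _ h

theorem Linked.trans (h : Linked S a b) (h' : Linked S b c) : Linked S a c :=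
  Relation.ReflTransGen.trans h h'

theorem Linked.mono {T : Set α} (hST : S ⊆ T) (h : Linked S a b) : Linked T a b :=
  Relation.ReflTransGen.mono (fun _ _ h => ⟨hST h.1, hST h.2.1, h.2.2⟩) _ _ h

theorem Linked.of_le (ha : a ∈ S) (hb : b ∈ S) (h : a ≤ b) : Linked S a b :=
  .single ⟨ha, hb, .inl h⟩

/-- Every point visited by the path is itself linked to `a`, so the path never leaves the linkage
class. This makes linkage classes connected. -/
theorem Linked.within (h : Linked S a x) :
    Linked {y | y ∈ S ∧ Linked S a y} a x := by
  induction h with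
  | refl => exact .refl
  | tail hab hbc ih =>
    exact ih.tail ⟨⟨hbc.1, hab⟩, ⟨hbc.2.1, hab.tail hbc⟩, hbc.2.2⟩

/-- A linkage class is connected by `Linked.within`, and a connected subset of `S` that meets it is
contained in it. -/
theorem isComponent_iff {A : Set α} :
    IsComponent S A ↔ ∃ a ∈ S, A = {y | y ∈ S ∧ Linked S a y} := by
  have key : ∀ a ∈ S, PosetConnected {y | y ∈ S ∧ Linked S a y} := fun a ha =>
    ⟨⟨a, ha, .refl⟩, fun x hx y hy =>
      ((Linked.within hx.2).symm.trans (Linked.within hy.2) :)⟩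
  constructor
  · intro h
    obtain ⟨hAS, ⟨a, ha⟩, hA⟩ := h.prop
    refine ⟨a, hAS ha, h.eq_of_le ⟨fun y hy => hy.1, key a (hAS ha)⟩ fun y hy => ?_⟩
    exact ⟨hAS hy, Linked.mono hAS (hA a ha y hy)⟩
  · rintro ⟨a, ha, rfl⟩
    refine ⟨⟨fun y hy => hy.1, key a ha⟩, fun B hB hle y hy => ?_⟩
    exact ⟨hB.1 hy, Linked.mono hB.1 (hB.2.2 a (hle ⟨ha, .refl⟩) y hy)⟩

/-- `reps` consists of one minimum of `Q` from every component of the open downset of `q`. -/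
structure Represent (Q : Set α) (q : α) (reps : List α) : Prop where
  mem : ∀ r ∈ reps, r ∈ minima Q ∧ r < q
  cover : ∀ m ∈ minima Q, m < q → ∃ r ∈ reps, Linked (openDownset Q q) m r
  not_linked : reps.Pairwise fun r s => ¬ Linked (openDownset Q q) r s

theorem Represent.eq_of_linked {Q : Set α} {q : α} {reps : List α} (h : Represent Q q reps)
    (ha : a ∈ reps) (hb : b ∈ reps) (hab : Linked (openDownset Q q) a b) : a = b := by
  by_contra hne
  have : Std.Symm fun r s => ¬ Linked (openDownset Q q) r s := ⟨fun _ _ h h' => h h'.symm⟩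
  exact h.not_linked.forall ha hb hne hab

theorem Represent.nodup {Q : Set α} {q : α} {reps : List α} (h : Represent Q q reps) :
    reps.Nodup :=
  h.not_linked.imp fun {r s} h (he : r = s) => h (he ▸ Linked.refl)

theorem minima_subset_initialHull {Q : Set α} : minima Q ⊆ initialHull Q := by
  refine fun q hq => ⟨hq.prop, fun h => ?_⟩
  obtain ⟨p, hp, hpq⟩ := h.1
  exact hpq.not_ge (hq.le_of_le hp hpq.le)

theorem Represent.mem_initialHull {Q : Set α} {q : α} {reps : List α} (h : Represent Q q reps)
    (hq : q ∈ Q) (h2 : 2 ≤ reps.length) : q ∈ initialHull Q := by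
  refine ⟨hq, fun hc => ?_⟩
  obtain ⟨a, b, l, rfl⟩ : ∃ a b l, reps = a :: b :: l := by
    match reps, h2 with
    | a :: b :: l, _ => exact ⟨a, b, l, rfl⟩
  have ha := h.mem a (by simp)
  have hb := h.mem b (by simp)
  have hn := h.not_linked
  simp only [List.pairwise_cons, List.mem_cons, forall_eq_or_imp] at hn
  exact hn.1.1 (hc.2 a ⟨ha.1.prop, ha.2⟩ b ⟨hb.1.prop, hb.2⟩)

/-- Each point of the open downset lies above a minimum in it, so if all these minima were linked,
the whole open downset would be connected. -/
theorem exists_not_linked {Q : Set α} (hmin : ∀ x ∈ Q, ∃ m ∈ minima Q, m ≤ x) {q : α}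
    (hq : q ∈ initialHull Q) (hqm : q ∉ minima Q) :
    ∃ m ∈ minima Q, ∃ n ∈ minima Q, m < q ∧ n < q ∧ ¬ Linked (openDownset Q q) m n := by
  obtain ⟨m, hm, hmq⟩ := hmin q hq.1
  have hmq' : m < q := lt_of_le_of_ne hmq fun h => hqm (h ▸ hm)
  by_contra! h
  refine hq.2 ⟨⟨m, hm.prop, hmq'⟩, fun x hx y hy => ?_⟩
  obtain ⟨x', hx', hxx⟩ := hmin x hx.1
  obtain ⟨y', hy', hyy⟩ := hmin y hy.1
  have hx₀ : x' ∈ openDownset Q q := ⟨hx'.prop, hxx.trans_lt hx.2⟩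
  have hy₀ : y' ∈ openDownset Q q := ⟨hy'.prop, hyy.trans_lt hy.2⟩
  exact (Linked.of_le hx₀ hx hxx).symm.trans
    ((h x' hx' y' hy' hx₀.2 hy₀.2).trans (Linked.of_le hy₀ hy hyy))

/-- The initial hull and one representative for every component determine an initial scaffold. -/
theorem exists_isInitialScaffold {Q : Set α} (hmin : ∀ x ∈ Q, ∃ m ∈ minima Q, m ≤ x)
    {ms : List α} (hms : Enumerates ms (minima Q)) {G : List (α × List α)}
    (hnd : (G.map Prod.fst).Nodup)
    (hG : ∀ g ∈ G, g.1 ∈ Q ∧ 2 ≤ g.2.length ∧ Represent Q g.1 g.2)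
    (hall : ∀ q ∈ initialHull Q, q ∉ minima Q → q ∈ G.map Prod.fst) :
    ∃ P : Subposet Q, IsInitialScaffold P ∧ Enumerates (G.map Prod.fst ++ ms) P.carrier ∧
      Enumerates (G.flatMap fun g => g.2.map fun r => (r, g.1))
        {r | P.rel r.1 r.2 ∧ r.1 ≠ r.2} := by
  have hull : ∀ g ∈ G, g.1 ∈ initialHull Q ∧ g.1 ∉ minima Q := fun g hg => by
    obtain ⟨h₁, h₂, h₃⟩ := hG g hg
    refine ⟨h₃.mem_initialHull h₁ h₂, fun hm => ?_⟩
    obtain ⟨r, hr⟩ := List.exists_mem_of_length_pos (by omega : 0 < g.2.length)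
    have := h₃.mem r hr
    exact this.2.not_ge (hm.le_of_le this.1.prop this.2.le)
  refine ⟨⟨initialHull Q, fun q hq => hq.1,
    fun x y => (x = y ∧ x ∈ initialHull Q) ∨ ∃ g ∈ G, y = g.1 ∧ x ∈ g.2, ?_, ?_, ?_, ?_⟩,
    ⟨rfl, ?_⟩, ⟨?_, ?_⟩, ⟨?_, ?_⟩⟩
  · rintro x y (⟨rfl, h⟩ | ⟨g, hg, rfl, hx⟩)
    · exact ⟨h, h⟩
    · exact ⟨minima_subset_initialHull ((hG g hg).2.2.mem x hx).1, (hull g hg).1⟩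
  · rintro x y (⟨rfl, h⟩ | ⟨g, hg, rfl, hx⟩)
    · exact le_rfl
    · exact ((hG g hg).2.2.mem x hx).2.le
  · exact fun h => .inl ⟨rfl, h⟩
  -- Apart from identities, relations go from a minimum to a point that is not a minimum, so two of
  -- them never compose.
  · rintro x y z (⟨rfl, h⟩ | ⟨g, hg, rfl, hx⟩) (⟨rfl, h'⟩ | ⟨g', hg', rfl, hx'⟩)
    · exact .inl ⟨rfl, h⟩
    · exact .inr ⟨g', hg', rfl, hx'⟩
    · exact .inr ⟨g, hg, rfl, hx⟩
    · exact absurd ((hG g' hg').2.2.mem _ hx').1 (hull g hg).2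
  -- A component contains a minimum below `p`, so `p` is not minimal and occurs in `G`. Uniqueness
  -- holds because distinct representatives are not linked.
  · intro p hp A hA
    obtain ⟨a, ha, rfl⟩ := isComponent_iff.1 hA
    obtain ⟨m, hm, hma⟩ := hmin a ha.1
    have hmp : m < p := hma.trans_lt ha.2
    have hpm : p ∉ minima Q := fun h => hmp.not_ge (h.le_of_le hm.prop hmp.le)
    obtain ⟨g, hg, rfl⟩ := List.mem_map.1 (hall p hp hpm)
    have hR := (hG g hg).2.2
    obtain ⟨r, hr, hmr⟩ := hR.cover m hm hmp
    have har : Linked (openDownset Q g.1) a r :=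
      (Linked.of_le (S := openDownset Q g.1) ⟨hm.prop, hmp⟩ ha hma).symm.trans hmr
    refine ⟨r, ⟨⟨⟨(hR.mem r hr).1.prop, (hR.mem r hr).2⟩, har⟩, .inr ⟨g, hg, rfl, hr⟩⟩, ?_⟩
    rintro s ⟨⟨hs, has⟩, ⟨rfl, -⟩ | ⟨g', hg', he, hs'⟩⟩
    · exact absurd hs.2 (lt_irrefl _)
    · obtain rfl := List.inj_on_of_nodup_map hnd hg hg' he
      exact hR.eq_of_linked hs' hr (has.symm.trans har)
  · refine List.nodup_append.2 ⟨hnd, hms.1, ?_⟩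
    rintro x hx y hy rfl
    obtain ⟨g, hg, rfl⟩ := List.mem_map.1 hx
    exact (hull g hg).2 ((hms.2 _).1 hy)
  · intro x
    simp only [List.mem_append, hms.2]
    constructor
    · rintro (hx | hx)
      · obtain ⟨g, hg, rfl⟩ := List.mem_map.1 hx
        exact (hull g hg).1
      · exact minima_subset_initialHull hx
    · intro hx
      by_cases hm : x ∈ minima Q
      · exact .inr hm
      · exact .inl (hall x hx hm)
  · refine List.nodup_flatMap.2 ⟨fun g hg => ?_, ?_⟩
    · exact (hG g hg).2.2.nodup.map fun a b h => (Prod.ext_iff.1 h).1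
    · refine (List.pairwise_map.1 hnd).imp fun hne => ?_
      intro x hx hx'
      obtain ⟨r, -, rfl⟩ := List.mem_map.1 hx
      obtain ⟨r', -, h⟩ := List.mem_map.1 hx'
      exact hne (Prod.ext_iff.1 h).2.symm
  · rintro ⟨x, y⟩
    simp only [List.mem_flatMap, List.mem_map, Prod.mk.injEq, Set.mem_ofPred_eq]
    constructor
    · rintro ⟨g, hg, r, hr, rfl, rfl⟩
      exact ⟨.inr ⟨g, hg, rfl, hr⟩, ((hG g hg).2.2.mem _ hr).2.ne⟩
    · rintro ⟨⟨h, -⟩ | ⟨g, hg, rfl, hx⟩, hne⟩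
      · exact absurd h hne
      · exact ⟨g, hg, x, hx, rfl, rfl⟩

end Linked

/-! ### Joins of minima and certificates for components -/

section Lattice
variable {α : Type*} [SemilatticeSup α] {Q : Set α} {q : α}

/-- The join is below `q` and in `Q` by convexity; when it differs from `q`, it is a common upper
bound inside the open downset. -/
theorem linked_of_not_le_sup (hQ : Q.OrdConnected) (hq : q ∈ Q) {m n : α} (hm : m ∈ Q) (hn : n ∈ Q)
    (hmq : m < q) (hnq : n < q) (h : ¬ q ≤ m ⊔ n) : Linked (openDownset Q q) m n := by
  have hle : m ⊔ n ≤ q := sup_le hmq.le hnq.le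
  have hs : m ⊔ n ∈ openDownset Q q :=
    ⟨hQ.out hm hq ⟨le_sup_left, hle⟩, lt_of_le_not_ge hle h⟩
  have hm' : m ∈ openDownset Q q := ⟨hm, hmq⟩
  have hn' : n ∈ openDownset Q q := ⟨hn, hnq⟩
  exact (Linked.of_le hm' hs le_sup_left).trans (Linked.of_le hn' hs le_sup_right).symm

/-- Lower bounds `c` of the components, any two of which have no upper bound below `q`, certify
that a list consists of one minimum from every component. -/
theorem Represent.of_lowerBounds (hmin : ∀ x ∈ Q, ∃ m ∈ minima Q, m ≤ x) {cs : List (α × α)}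
    (hmem : ∀ e ∈ cs, e.1 ∈ minima Q ∧ e.1 < q ∧ e.2 ≤ e.1)
    (hcs : cs.Pairwise fun e f => q ≤ e.2 ⊔ f.2)
    (hcov : ∀ m ∈ minima Q, m < q → ∃ e ∈ cs, e.2 ≤ m ∧ Linked (openDownset Q q) m e.1) :
    Represent Q q (cs.map Prod.fst) := by
  have : Std.Symm fun e f : α × α => q ≤ e.2 ⊔ f.2 :=
    ⟨fun e f (h : q ≤ e.2 ⊔ f.2) => show q ≤ f.2 ⊔ e.2 by rwa [sup_comm]⟩
  -- A path from `e.1` stays above `e.2`. A downward step from `y` to `z` finds a minimum below `z`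
  -- and above some `f.2`; if `f ≠ e`, then `y` is above both bounds and hence above `q`, which is
  -- absurd.
  have key : ∀ e ∈ cs, ∀ x, Linked (openDownset Q q) e.1 x → e.2 ≤ x := by
    intro e he x hx
    induction hx with
    | refl => exact (hmem e he).2.2
    | @tail y z hy hyz ih =>
      obtain ⟨hyq, hz, h | h⟩ := hyz
      · exact ih.trans h
      · obtain ⟨m, hm, hmz⟩ := hmin z hz.1
        obtain ⟨f, hf, hfm, -⟩ := hcov m hm (hmz.trans_lt hz.2)
        by_cases hef : e = f
        · exact hef ▸ hfm.trans hmz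
        · have hqe : q ≤ e.2 ⊔ f.2 := hcs.forall he hf hef
          exact absurd (hqe.trans (sup_le ih (hfm.trans (hmz.trans h)))) hyq.2.not_ge
  refine ⟨?_, ?_, ?_⟩
  · intro r hr
    obtain ⟨e, he, rfl⟩ := List.mem_map.1 hr
    exact ⟨(hmem e he).1, (hmem e he).2.1⟩
  · intro m hm hmq
    obtain ⟨e, he, -, h⟩ := hcov m hm hmq
    exact ⟨e.1, List.mem_map_of_mem he, h⟩
  · refine List.pairwise_map.2 (hcs.imp_of_mem fun {e f} he hf h hl => ?_)
    exact (hmem f hf).2.1.not_ge (h.trans (sup_le (key e he _ hl) (hmem f hf).2.2))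

end Lattice

/-! ### Membership tests for intervals -/

section Membership
variable {α : Type*} [PartialOrder α] {Q : Set α}

theorem exists_minima_le [WellFoundedLT α] (Q : Set α) {x : α} (hx : x ∈ Q) :
    ∃ m ∈ minima Q, m ≤ x := by
  obtain ⟨m, hmx, hm⟩ := exists_minimal_le_of_wellFoundedLT (fun x => x ∈ Q) x hx
  exact ⟨m, hm, hmx⟩

/-- The list `D` decides membership in `Q` of the points above a point of `Q`: those points belong
to `Q` that do not lie above any point of `D` (if `up`) or that lie below some point of `D`
(otherwise). -/
def Delimits (up : Bool) (D : List α) (Q : Set α) : Prop :=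
  ∀ p ∈ Q, ∀ x, p ≤ x → (x ∈ Q ↔ if up then ∀ y ∈ D, ¬ y ≤ x else ∃ y ∈ D, x ≤ y)

theorem delimits_maxima (hQ : Q.OrdConnected) (hfin : Q.Finite) {D : List α}
    (hD : Enumerates D (maxima Q)) : Delimits false D Q := by
  intro p hp x hx
  simp only [Bool.false_eq_true, if_false]
  constructor
  · intro h
    obtain ⟨y, hxy, hy⟩ := hfin.exists_le_maximal h
    exact ⟨y, (hD.2 y).2 hy, hxy⟩
  · rintro ⟨y, hy, hxy⟩
    exact hQ.out hp ((hD.2 y).1 hy).prop ⟨hx, hxy⟩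

/-- A point above `Q` but outside it belongs to the death set and so lies above a minimum of that
set; conversely, convexity keeps points of `Q` from lying above a death. -/
theorem delimits_deaths {d : ℕ} {Q : Set (Fin d → ℕ)} (hQ : Q.OrdConnected)
    {D : List (Fin d → ℕ)} (hD : Enumerates D (minima (deathSet Q))) : Delimits true D Q := by
  intro p hp x hx
  simp only [if_true]
  constructor
  · intro h y hy hyx
    obtain ⟨⟨z, hz, hzy⟩, hyQ⟩ := ((hD.2 y).1 hy).prop
    exact hyQ (hQ.out hz h ⟨hzy, hyx⟩)
  · intro h
    by_contra hxQ
    obtain ⟨y, hy, hyx⟩ := exists_minima_le (deathSet Q) (x := x) ⟨⟨p, hp, hx⟩, hxQ⟩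
    exact h y ((hD.2 y).2 hy) hyx

end Membership

/-! ### Operations on points -/

theorem encPoint_succ {d : ℕ} (x : Fin (d + 1) → ℕ) :
    encPoint x = .cons (.atom (x 0)) (encPoint fun i => x i.succ) := by
  simp [encPoint, encList, List.ofFn_succ]

theorem encPoint_zero (x : Fin 0 → ℕ) : encPoint x = .atom 0 := by
  simp [encPoint, encList]

open Classical in
/-- A truth value; `0` stands for truth. -/
noncomputable def encProp (p : Prop) : Val := .atom (if p then 0 else 1)

/-- The body of the function number `f` that compares two points. -/
def leExp (f : ℕ) : Exp :=
  .ifAtom (.fst (.var 0)) (.const 0)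
    (.ifLe (.fst (.fst (.var 0))) (.fst (.snd (.var 0)))
      (.call f (.cons (.snd (.fst (.var 0))) (.snd (.snd (.var 0))))) (.const 1))

/-- The body of the function number `f` that computes the join of two points. -/
def joinExp (f : ℕ) : Exp :=
  .ifAtom (.fst (.var 0)) (.const 0)
    (.cons (.ifLe (.fst (.fst (.var 0))) (.fst (.snd (.var 0)))
        (.fst (.snd (.var 0))) (.fst (.fst (.var 0))))
      (.call f (.cons (.snd (.fst (.var 0))) (.snd (.snd (.var 0))))))

/-- The body of the function number `f` that computes the meet of two points. -/
def meetExp (f : ℕ) : Exp :=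
  .ifAtom (.fst (.var 0)) (.const 0)
    (.cons (.ifLe (.fst (.fst (.var 0))) (.fst (.snd (.var 0)))
        (.fst (.fst (.var 0))) (.fst (.snd (.var 0))))
      (.call f (.cons (.snd (.fst (.var 0))) (.snd (.snd (.var 0))))))

section
variable {P : Program} {f d : ℕ}

theorem computes_le (hf : P[f]? = some (leExp f)) (x y : Fin d → ℕ) :
    Computes P f (.cons (encPoint x) (encPoint y)) (encProp (x ≤ y)) (40 * (d + 1)) := by
  induction d with
  | zero =>
    rw [Computes, app_of_getElem? hf]
    simp [leExp, encPoint_zero, encProp, Subsingleton.elim x y]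
  | succ d ih =>
    obtain ⟨t, ht, h⟩ := ih (fun i => x i.succ) fun i => y i.succ
    rw [Computes, app_of_getElem? hf]
    have hxy : x ≤ y ↔ x 0 ≤ y 0 ∧ (fun i : Fin d => x i.succ) ≤ fun i => y i.succ := by
      simp only [Pi.le_def, Fin.forall_fin_succ]
    by_cases h0 : x 0 ≤ y 0
    · have he : encProp (x ≤ y) = encProp ((fun i : Fin d => x i.succ) ≤ fun i => y i.succ) :=
        congrArg encProp (propext (by simp only [hxy, h0, true_and]))
      rw [he]
      simp [leExp, encPoint_succ, h0, h]
      omega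
    · simp [leExp, encPoint_succ, h0, hxy, encProp]
      omega

theorem computes_join (hf : P[f]? = some (joinExp f)) (x y : Fin d → ℕ) :
    Computes P f (.cons (encPoint x) (encPoint y)) (encPoint (x ⊔ y)) (40 * (d + 1)) := by
  induction d with
  | zero =>
    rw [Computes, app_of_getElem? hf]
    simp [joinExp, encPoint_zero]
  | succ d ih =>
    obtain ⟨t, ht, h⟩ := ih (fun i => x i.succ) fun i => y i.succ
    replace h : _ = some (encPoint fun i => x i.succ ⊔ y i.succ, t) := h
    rw [Computes, app_of_getElem? hf]
    by_cases h0 : x 0 ≤ y 0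
    · simp [joinExp, encPoint_succ, h0, h]
      omega
    · simp [joinExp, encPoint_succ, h0, h, le_of_not_ge h0]
      omega

theorem computes_meet (hf : P[f]? = some (meetExp f)) (x y : Fin d → ℕ) :
    Computes P f (.cons (encPoint x) (encPoint y)) (encPoint (x ⊓ y)) (40 * (d + 1)) := by
  induction d with
  | zero =>
    rw [Computes, app_of_getElem? hf]
    simp [meetExp, encPoint_zero]
  | succ d ih =>
    obtain ⟨t, ht, h⟩ := ih (fun i => x i.succ) fun i => y i.succ
    replace h : _ = some (encPoint fun i => x i.succ ⊓ y i.succ, t) := h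
    rw [Computes, app_of_getElem? hf]
    by_cases h0 : x 0 ≤ y 0
    · simp [meetExp, encPoint_succ, h0, h]
      omega
    · simp [meetExp, encPoint_succ, h0, h, le_of_not_ge h0]
      omega

/-! ### The output -/

/-- A point with a list of points. -/
def encGroup (g : (Fin d → ℕ) × List (Fin d → ℕ)) : Val :=
  .cons (encPoint g.1) (encPoints g.2)

/-- The three functions, starting at number `f`, that list the elements and the relations of the
scaffold. -/
def outputExps (f : ℕ) : List Exp :=
  [foldExp f (.snd (.var 0)) (.cons (.fst (.fst (.fst (.var 1)))) (.var 0)),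
    foldExp (f + 1) (.snd (.snd (.var 0)))
      (.cons (.cons (.fst (.fst (.var 1))) (.fst (.snd (.var 1)))) (.var 0)),
    foldExp (f + 2) (.const 0) (.call (f + 1) (.cons (.snd (.fst (.fst (.var 1))))
      (.cons (.fst (.fst (.fst (.var 1)))) (.var 0))))]

theorem computes_elements (hf : P[f]? = (outputExps f)[0]?)
    (G : List ((Fin d → ℕ) × List (Fin d → ℕ))) (ms : List (Fin d → ℕ)) :
    Computes P f (.cons (encList (G.map encGroup)) (encPoints ms))
      (encPoints (G.map Prod.fst ++ ms)) (40 * (G.length + 1)) := by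
  have := computes_fold hf (encGroup (d := d)) encPoints (encPoints ms)
    (fun g l => g.1 :: l) ms (B := 10) (C := 20) (by simp [Yields]) G
    (fun x l' _ => by simp [Yields, encGroup, encPoints, encList])
  have he : G.foldr (fun g l => g.1 :: l) ms = G.map Prod.fst ++ ms := by
    clear this
    induction G <;> simp_all
  rw [he] at this
  exact this.mono (by omega)

theorem computes_pairs (hf : P[f + 1]? = (outputExps f)[1]?)
    (g : (Fin d → ℕ) × List (Fin d → ℕ)) (rs : List ((Fin d → ℕ) × (Fin d → ℕ))) :
    Computes P (f + 1) (.cons (encPoints g.2) (.cons (encPoint g.1) (encRelations rs)))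
      (encRelations ((g.2.map fun r => (r, g.1)) ++ rs)) (40 * (g.2.length + 1)) := by
  have := computes_fold hf (encPoint (d := d)) encRelations
    (.cons (encPoint g.1) (encRelations rs))
    (fun r l => (r, g.1) :: l) rs (B := 10) (C := 20) (by simp [Yields]) g.2
    (fun x l' _ => by simp [Yields, encRelations, encList])
  have he : ∀ l : List (Fin d → ℕ),
      l.foldr (fun r l => (r, g.1) :: l) rs = (l.map fun r => (r, g.1)) ++ rs := by
    intro l
    induction l <;> simp_all
  rw [he] at this
  exact this.mono (by omega)

theorem computes_relations (hf : P[f + 1]? = (outputExps f)[1]?)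
    (hf' : P[f + 2]? = (outputExps f)[2]?) (G : List ((Fin d → ℕ) × List (Fin d → ℕ)))
    {k : ℕ} (hk : ∀ g ∈ G, g.2.length ≤ k) :
    Computes P (f + 2) (.cons (encList (G.map encGroup)) (.atom 0))
      (encRelations (G.flatMap fun g => g.2.map fun r => (r, g.1)))
      (100 * (G.length + 1) * (k + 1)) := by
  have := computes_fold hf' (encGroup (d := d)) encRelations (.atom 0)
    (fun g l => (g.2.map fun r => (r, g.1)) ++ l) [] (B := 10) (C := 40 * (k + 1) + 40)
    (by simp [Yields, encRelations, encList]) G (fun x l' hx => by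
      generalize l'.foldr (fun g l => (g.2.map fun r => (r, g.1)) ++ l) [] = rs
      obtain ⟨t, ht, h⟩ := computes_pairs hf x rs
      have := hk x (hx.subset (by simp))
      simp [Yields, encGroup, h]
      omega)
  have he : G.foldr (fun g l => (g.2.map fun r => (r, g.1)) ++ l) [] =
      G.flatMap fun g => g.2.map fun r => (r, g.1) := by
    clear this hk
    induction G <;> simp_all
  rw [he] at this
  refine this.mono ?_
  nlinarith

end

/-! ### Joins of pairs of minima -/

section JoinAlgorithm
variable {d : ℕ}

open Classical in
/-- Merge `m` with the classes of `cs` that have a common upper bound with it other than `q`. A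
class is given by a representative and its meet.  The result consists of the meet of the new class
and of the other classes. -/
noncomputable def absorb (q m : Fin d → ℕ) (cs : List ((Fin d → ℕ) × (Fin d → ℕ))) :
    (Fin d → ℕ) × List ((Fin d → ℕ) × (Fin d → ℕ)) :=
  cs.foldr (fun e s => if q ≤ m ⊔ e.2 then (s.1, e :: s.2) else (s.1 ⊓ e.2, s.2)) (m, [])

open Classical in
/-- The components of the open downset of `q`, each given by a minimum and by the meet of its
minima. -/
noncomputable def classes (q : Fin d → ℕ) (M : List (Fin d → ℕ)) :
    List ((Fin d → ℕ) × (Fin d → ℕ)) :=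
  M.foldr (fun m cs => if m ≤ q then if q ≤ m then cs else
    (m, (absorb q m cs).1) :: (absorb q m cs).2 else cs) []

variable {q m : Fin d → ℕ} {cs : List ((Fin d → ℕ) × (Fin d → ℕ))}

theorem absorb_fst_le : (absorb q m cs).1 ≤ m := by
  induction cs with
  | nil => exact le_rfl
  | cons e cs ih =>
    simp only [absorb, List.foldr_cons] at ih ⊢
    split_ifs
    · exact ih
    · exact inf_le_left.trans ih

theorem absorb_snd_sublist : (absorb q m cs).2.Sublist cs := by
  induction cs with
  | nil => exact .slnil
  | cons e cs ih =>
    simp only [absorb, List.foldr_cons] at ih ⊢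
    split_ifs
    · exact ih.cons_cons e
    · exact ih.cons e

theorem mem_absorb_snd {e : (Fin d → ℕ) × (Fin d → ℕ)} (he : e ∈ cs) :
    (e ∈ (absorb q m cs).2 ∧ q ≤ m ⊔ e.2) ∨ (absorb q m cs).1 ≤ e.2 ∧ ¬ q ≤ m ⊔ e.2 := by
  induction cs with
  | nil => simp at he
  | cons f cs ih =>
    simp only [absorb, List.foldr_cons] at ih ⊢
    obtain rfl | he := List.mem_cons.1 he
    · split_ifs with h
      · exact .inl ⟨by simp, h⟩
      · exact .inr ⟨inf_le_right, h⟩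
    · split_ifs with h
      · exact (ih he).imp (fun h => ⟨List.mem_cons_of_mem _ h.1, h.2⟩) id
      · exact (ih he).imp id fun h => ⟨inf_le_left.trans h.1, h.2⟩

theorem le_of_mem_absorb_snd {e : (Fin d → ℕ) × (Fin d → ℕ)} (he : e ∈ (absorb q m cs).2) :
    q ≤ m ⊔ e.2 := by
  induction cs with
  | nil => simp [absorb] at he
  | cons f cs ih =>
    simp only [absorb, List.foldr_cons] at ih he
    split_ifs at he with h
    · obtain rfl | he := List.mem_cons.1 he
      · exact h
      · exact ih he
    · exact ih he

/-- In a product of chains, each coordinate of a meet is attained by one of the factors. This traces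
the coordinates of the merged meet back to `m` or to an absorbed class. -/
theorem absorb_fst_apply (k : Fin d) : (absorb q m cs).1 k = m k ∨
    ∃ e ∈ cs, ¬ q ≤ m ⊔ e.2 ∧ (absorb q m cs).1 k = e.2 k := by
  induction cs with
  | nil => exact .inl rfl
  | cons f cs ih =>
    have ih' : (absorb q m cs).1 k = m k ∨
        ∃ e ∈ f :: cs, ¬ q ≤ m ⊔ e.2 ∧ (absorb q m cs).1 k = e.2 k :=
      ih.imp id fun ⟨e, he, h⟩ => ⟨e, List.mem_cons_of_mem _ he, h⟩
    simp only [absorb, List.foldr_cons] at ih' ⊢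
    split_ifs with h
    · exact ih'
    · obtain hle | hle := le_total ((absorb q m cs).1 k) (f.2 k)
      · simp only [absorb] at hle
        simpa only [Pi.inf_apply, inf_of_le_left hle] using ih'
      · exact .inr ⟨f, List.mem_cons_self, h, by simpa [absorb] using hle⟩

theorem length_classes_le (q : Fin d → ℕ) (M : List (Fin d → ℕ)) :
    (classes q M).length ≤ M.length := by
  induction M with
  | nil => simp [classes]
  | cons m M ih =>
    simp only [classes, List.foldr_cons] at ih ⊢
    split_ifs
    · exact ih.trans (by simp)
    · simpa using absorb_snd_sublist.length_le.trans ih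
    · exact ih.trans (by simp)

/-- If a meet is below `q` in coordinate `k`, so is some minimum of its class; hence comparing a new
minimum with the meet alone detects links with the class. The final meets serve as the lower bounds
in `Represent.of_lowerBounds`. -/
theorem represent_classes {Q : Set (Fin d → ℕ)} (hQ : Q.OrdConnected) (hq : q ∈ Q)
    {M : List (Fin d → ℕ)} (hM : ∀ m, m ∈ M ↔ m ∈ minima Q) :
    Represent Q q ((classes q M).map Prod.fst) := by
  -- Three clauses are the hypotheses of `Represent.of_lowerBounds` for the minima processed so far.
  -- The last one, a witness for every coordinate in which a meet lies below `q`, is needed only to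
  -- carry the induction.
  suffices H : ∀ W : List (Fin d → ℕ), (∀ m ∈ W, m ∈ minima Q) →
      (∀ e ∈ classes q W, e.1 ∈ minima Q ∧ e.1 < q ∧ e.2 ≤ e.1) ∧
      ((classes q W).Pairwise fun e f => q ≤ e.2 ⊔ f.2) ∧
      (∀ m ∈ W, m < q → ∃ e ∈ classes q W, e.2 ≤ m ∧ Linked (openDownset Q q) m e.1) ∧
      ∀ e ∈ classes q W, ∀ k, e.2 k < q k →
        ∃ m ∈ minima Q, m < q ∧ Linked (openDownset Q q) m e.1 ∧ m k < q k by
    obtain ⟨h₁, h₂, h₃, -⟩ := H M fun m => (hM m).1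
    exact .of_lowerBounds (fun x => exists_minima_le Q) h₁ h₂ fun m hm => h₃ m ((hM m).2 hm)
  intro W
  induction W with
  | nil => simp [classes]
  | cons m W ih =>
    intro hW
    obtain ⟨h₁, h₂, h₃, h₄⟩ := ih fun m hm => hW m (List.mem_cons_of_mem _ hm)
    have hm := hW m (by simp)
    by_cases hmq : m < q
    swap
    · have he : classes q (m :: W) = classes q W := by
        simp only [classes, List.foldr_cons]
        split_ifs with h h'
        · rfl
        · exact absurd (lt_of_le_not_ge h h') hmq
        · rfl
      rw [he]
      refine ⟨h₁, h₂, fun n hn hnq => h₃ n ?_ hnq, h₄⟩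
      obtain rfl | hn := List.mem_cons.1 hn
      · exact absurd hnq hmq
      · exact hn
    have he : classes q (m :: W) =
        (m, (absorb q m (classes q W)).1) :: (absorb q m (classes q W)).2 := by
      simp [classes, hmq.le, hmq.not_ge]
    rw [he]
    generalize classes q W = cs at *
    have hsub := absorb_snd_sublist (q := q) (m := m) (cs := cs)
    -- A coordinate `k` that refutes `q ≤ m ⊔ e.2` has, by the last clause, a minimum `n` of the
    -- class with `n k < q k`, and then `m ⊔ n` is still below `q` at `k`.
    have hlink : ∀ e ∈ cs, ¬ q ≤ m ⊔ e.2 → Linked (openDownset Q q) m e.1 := by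
      intro e he hme
      obtain ⟨k, hk⟩ : ∃ k, ¬ q k ≤ (m ⊔ e.2) k := by simpa [Pi.le_def] using hme
      have hk' : m k < q k ∧ e.2 k < q k := by simpa using hk
      obtain ⟨n, hn, hnq, hne, hnk⟩ := h₄ e he k hk'.2
      refine (linked_of_not_le_sup hQ hq hm.prop hn.prop hmq hnq fun h => ?_).trans hne
      exact (sup_lt_iff.2 ⟨hk'.1, hnk⟩).not_ge (h k)
    have hsymm : Std.Symm fun e f : (Fin d → ℕ) × (Fin d → ℕ) => q ≤ e.2 ⊔ f.2 :=
      ⟨fun e f (h : q ≤ e.2 ⊔ f.2) => show q ≤ f.2 ⊔ e.2 by rwa [sup_comm]⟩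
    refine ⟨?_, ?_, ?_, ?_⟩
    · intro e he
      obtain rfl | he := List.mem_cons.1 he
      · exact ⟨hm, hmq, absorb_fst_le⟩
      · exact h₁ e (hsub.subset he)
    -- Coordinate `k` of the new meet is that of `m` or of an absorbed class; each of the two
    -- already covers `q` together with any class that was left over.
    · refine List.pairwise_cons.2 ⟨fun e he k => ?_, h₂.sublist hsub⟩
      obtain h | ⟨f, hf, hfm, h⟩ := absorb_fst_apply (q := q) (m := m) (cs := cs) k
      · have := le_of_mem_absorb_snd he k
        simpa [h] using this
      · have hne : f ≠ e := fun h => hfm (h ▸ le_of_mem_absorb_snd he)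
        have : q ≤ f.2 ⊔ e.2 := h₂.forall hf (hsub.subset he) hne
        simpa [h] using this k
    · intro n hn hnq
      obtain rfl | hn := List.mem_cons.1 hn
      · exact ⟨_, List.mem_cons_self, absorb_fst_le, .refl⟩
      · obtain ⟨e, he, hen, hl⟩ := h₃ n hn hnq
        obtain h | h := mem_absorb_snd (q := q) (m := m) he
        · exact ⟨e, List.mem_cons_of_mem _ h.1, hen, hl⟩
        · exact ⟨_, List.mem_cons_self, h.1.trans hen, hl.trans (hlink e he h.2).symm⟩
    · intro e he k hk
      obtain rfl | he := List.mem_cons.1 he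
      · obtain h | ⟨f, hf, hfm, h⟩ := absorb_fst_apply (q := q) (m := m) (cs := cs) k
        · exact ⟨m, hm, hmq, .refl, by simpa [h] using hk⟩
        · obtain ⟨n, hn, hnq, hnf, hnk⟩ := h₄ f hf k (by simpa [h] using hk)
          exact ⟨n, hn, hnq, hnf.trans (hlink f hf hfm).symm, hnk⟩
      · exact h₄ e (hsub.subset he) k hk

/-- The outcome of the membership test given by a list `D`. -/
def Passes (up : Bool) (D : List (Fin d → ℕ)) (x : Fin d → ℕ) : Prop :=
  if up then ∀ y ∈ D, ¬ y ≤ x else ∃ y ∈ D, x ≤ y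

open Classical in
/-- Add `q` and representatives of the components of its open downset to the list `G`, unless `q`
does not pass the membership test, the open downset is connected or `q` has been found before. -/
noncomputable def addJoin (up : Bool) (D M : List (Fin d → ℕ)) (q : Fin d → ℕ)
    (G : List ((Fin d → ℕ) × List (Fin d → ℕ))) : List ((Fin d → ℕ) × List (Fin d → ℕ)) :=
  if Passes up D q ∧ 2 ≤ (classes q M).length ∧ q ∉ G.map Prod.fst then
    (q, (classes q M).map Prod.fst) :: G
  else G

/-- The points of the initial hull that are joins of two minima, with representatives of the
components of their open downsets. -/
noncomputable def joins (up : Bool) (D M : List (Fin d → ℕ)) :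
    List ((Fin d → ℕ) × List (Fin d → ℕ)) :=
  M.foldr (fun a G => M.foldr (fun b G => addJoin up D M (a ⊔ b) G) G) []

variable {up : Bool} {D M : List (Fin d → ℕ)}

theorem length_foldr_addJoin (l : List (Fin d → ℕ)) (a : Fin d → ℕ)
    (G : List ((Fin d → ℕ) × List (Fin d → ℕ))) :
    (l.foldr (fun b G => addJoin up D M (a ⊔ b) G) G).length ≤ l.length + G.length := by
  induction l with
  | nil => simp
  | cons b l ih =>
    simp only [List.foldr_cons, List.length_cons]
    rw [addJoin]
    split_ifs
    · simp only [List.length_cons]; omega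
    · omega

theorem length_foldr_joins (l : List (Fin d → ℕ)) :
    (l.foldr (fun a G => M.foldr (fun b G => addJoin up D M (a ⊔ b) G) G) []).length ≤
      l.length * M.length := by
  induction l with
  | nil => simp
  | cons a l ih =>
    simp only [List.foldr_cons, List.length_cons]
    refine (length_foldr_addJoin _ _ _).trans ?_
    linarith

theorem joins_eq : joins up D M =
    (M.flatMap fun a => M.map fun b => a ⊔ b).foldr (addJoin up D M) [] := by
  rw [joins, List.foldr_flatMap]
  simp only [List.foldr_map]

theorem foldr_addJoin_spec (l : List (Fin d → ℕ)) :
    ((l.foldr (addJoin up D M) []).map Prod.fst).Nodup ∧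
    (∀ g ∈ l.foldr (addJoin up D M) [], g.1 ∈ l ∧ Passes up D g.1 ∧ 2 ≤ g.2.length ∧
      g.2 = (classes g.1 M).map Prod.fst) ∧
    ∀ q ∈ l, Passes up D q → 2 ≤ (classes q M).length →
      q ∈ (l.foldr (addJoin up D M) []).map Prod.fst := by
  induction l with
  | nil => simp
  | cons a l ih =>
    obtain ⟨h₁, h₂, h₃⟩ := ih
    simp only [List.foldr_cons]
    generalize l.foldr (addJoin up D M) [] = G at *
    rw [addJoin]
    split_ifs with h
    · refine ⟨List.nodup_cons.2 ⟨h.2.2, h₁⟩, fun g hg => ?_, fun q hq hq₁ hq₂ => ?_⟩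
      · obtain rfl | hg := List.mem_cons.1 hg
        · exact ⟨List.mem_cons_self, h.1, by simpa using h.2.1, rfl⟩
        · exact ⟨List.mem_cons_of_mem _ (h₂ g hg).1, (h₂ g hg).2⟩
      · obtain rfl | hq := List.mem_cons.1 hq
        · exact List.mem_cons_self
        · exact List.mem_cons_of_mem _ (h₃ q hq hq₁ hq₂)
    · refine ⟨h₁, fun g hg => ⟨List.mem_cons_of_mem _ (h₂ g hg).1, (h₂ g hg).2⟩,
        fun q hq hq₁ hq₂ => ?_⟩
      obtain rfl | hq := List.mem_cons.1 hq
      · by_contra hn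
        exact h ⟨hq₁, hq₂, hn⟩
      · exact h₃ q hq hq₁ hq₂

/-- A point of the hull that is not minimal has two unlinked minima below it and is therefore their
join, so the search over pairs misses nothing. -/
theorem joins_spec {Q : Set (Fin d → ℕ)} (hQ : Q.OrdConnected)
    (hM : ∀ m, m ∈ M ↔ m ∈ minima Q) (hD : Delimits up D Q) :
    ((joins up D M).map Prod.fst).Nodup ∧
    (∀ g ∈ joins up D M, g.1 ∈ Q ∧ 2 ≤ g.2.length ∧ Represent Q g.1 g.2) ∧
    ∀ q ∈ initialHull Q, q ∉ minima Q → q ∈ (joins up D M).map Prod.fst := by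
  rw [joins_eq]
  obtain ⟨h₁, h₂, h₃⟩ := foldr_addJoin_spec (up := up) (D := D) (M := M)
    (M.flatMap fun a => M.map fun b => a ⊔ b)
  refine ⟨h₁, fun g hg => ?_, fun q hq hqm => ?_⟩
  · obtain ⟨hg₁, hg₂, hg₃, hg₄⟩ := h₂ g hg
    simp only [List.mem_flatMap, List.mem_map] at hg₁
    obtain ⟨a, ha, b, hb, hab⟩ := hg₁
    have hgQ : g.1 ∈ Q :=
      (hD a ((hM a).1 ha).prop g.1 (hab ▸ le_sup_left)).2 hg₂
    exact ⟨hgQ, hg₃, hg₄ ▸ represent_classes hQ hgQ hM⟩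
  · have hR := represent_classes hQ hq.1 hM
    obtain ⟨a, ha, b, hb, haq, hbq, hn⟩ := exists_not_linked (fun x => exists_minima_le Q) hq hqm
    -- A single class would link both `a` and `b` to the same representative.
    have hlen : 2 ≤ (classes q M).length := by
      obtain ⟨r, hr, har⟩ := hR.cover a ha haq
      obtain ⟨s, hs, hbs⟩ := hR.cover b hb hbq
      by_contra hlt
      have : ((classes q M).map Prod.fst).length ≤ 1 := by simp; omega
      match h : (classes q M).map Prod.fst, this with
      | [], _ => simp [h] at hr
      | [t], _ =>
        rw [h, List.mem_singleton] at hr hs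
        exact hn (har.trans (hr.trans hs.symm ▸ hbs.symm))
    have hpass : Passes up D q := (hD a ha.prop q haq.le).1 hq.1
    have hqab : q = a ⊔ b := by
      refine le_antisymm ?_ (sup_le haq.le hbq.le)
      by_contra h
      exact hn (linked_of_not_le_sup hQ hq.1 ha.prop hb.prop haq hbq h)
    refine h₃ q ?_ hpass hlen
    simp only [List.mem_flatMap, List.mem_map]
    exact ⟨a, (hM a).2 ha, b, (hM b).2 hb, hqab.symm⟩

end JoinAlgorithm

/-- The program that examines the joins of all pairs of minima. -/
def joinProgram (up : Bool) : Program :=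
  [.letIn (.call 10 (.cons (.fst (.var 0)) (.var 0)))
      (.cons (.call 11 (.cons (.var 0) (.fst (.var 1)))) (.call 13 (.cons (.var 0) (.const 0)))),
    leExp 1, joinExp 2, meetExp 3,
    foldExp 4 (.cons (.snd (.snd (.var 0))) (.const 0))
      (.ifLe (.call 1 (.cons (.fst (.snd (.var 1)))
          (.call 2 (.cons (.snd (.snd (.var 1))) (.snd (.fst (.fst (.var 1)))))))) (.const 0)
        (.cons (.fst (.var 0)) (.cons (.fst (.fst (.var 1))) (.snd (.var 0))))
        (.cons (.call 3 (.cons (.fst (.var 0)) (.snd (.fst (.fst (.var 1)))))) (.snd (.var 0)))),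
    foldExp 5 (.const 0)
      (.letIn (.fst (.fst (.var 1))) (.letIn (.snd (.var 2))
        (.ifLe (.call 1 (.cons (.var 1) (.var 0))) (.const 0)
          (.ifLe (.call 1 (.cons (.var 0) (.var 1))) (.const 0) (.var 2)
            (.letIn (.call 4 (.cons (.var 2) (.cons (.var 0) (.var 1))))
              (.cons (.cons (.var 2) (.fst (.var 0))) (.snd (.var 0)))))
          (.var 2)))),
    foldExp 6 (.const (if up then 0 else 1))
      (if up then .ifLe (.call 1 (.cons (.fst (.fst (.var 1))) (.snd (.var 1)))) (.const 0)
        (.const 1) (.var 0)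
      else .ifLe (.call 1 (.cons (.snd (.var 1)) (.fst (.fst (.var 1))))) (.const 0)
        (.const 0) (.var 0)),
    foldExp 7 (.const 1)
      (.ifLe (.call 1 (.cons (.fst (.fst (.fst (.var 1)))) (.snd (.var 1)))) (.const 0)
        (.ifLe (.call 1 (.cons (.snd (.var 1)) (.fst (.fst (.fst (.var 1)))))) (.const 0)
          (.const 0) (.var 0)) (.var 0)),
    foldExp 8 (.const 0) (.cons (.fst (.fst (.fst (.var 1)))) (.var 0)),
    foldExp 9 (.fst (.snd (.var 0)))
      (.letIn (.call 2 (.cons (.fst (.snd (.snd (.var 1)))) (.fst (.fst (.var 1)))))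
        (.letIn (.snd (.snd (.snd (.var 2))))
          (.ifLe (.call 6 (.cons (.snd (.var 0)) (.var 1))) (.const 0)
            (.letIn (.call 5 (.cons (.fst (.var 0)) (.var 1)))
              (.ifAtom (.var 0) (.var 3) (.ifAtom (.snd (.var 0)) (.var 3)
                (.ifLe (.call 7 (.cons (.var 3) (.var 2))) (.const 0) (.var 3)
                  (.cons (.cons (.var 2) (.call 8 (.cons (.var 0) (.const 0)))) (.var 3))))))
            (.var 2)))),
    foldExp 10 (.const 0)
      (.call 9 (.cons (.fst (.snd (.var 1))) (.cons (.var 0)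
        (.cons (.fst (.fst (.var 1))) (.snd (.var 1))))))] ++ outputExps 11

/-! ### Correctness and running time of the join program -/

section
variable {d : ℕ} {up : Bool}

/-- A pair of points. -/
def encPair (e : (Fin d → ℕ) × (Fin d → ℕ)) : Val := .cons (encPoint e.1) (encPoint e.2)

theorem encProp_of {p : Prop} (h : p) : encProp p = .atom 0 := by simp [encProp, h]

theorem encProp_of_not {p : Prop} (h : ¬ p) : encProp p = .atom 1 := by simp [encProp, h]

theorem computes_absorb (q m : Fin d → ℕ) (cs : List ((Fin d → ℕ) × (Fin d → ℕ))) :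
    Computes (joinProgram up) 4
      (.cons (encList (cs.map encPair)) (.cons (encPoint q) (encPoint m)))
      (.cons (encPoint (absorb q m cs).1) (encList ((absorb q m cs).2.map encPair)))
      (200 * (d + 1) * (cs.length + 1)) := by
  classical
  have := computes_fold (P := joinProgram up) (f := 4) rfl encPair
    (fun s : (Fin d → ℕ) × List ((Fin d → ℕ) × (Fin d → ℕ)) =>
      .cons (encPoint s.1) (encList (s.2.map encPair)))
    (.cons (encPoint q) (encPoint m))
    (fun e s => if q ≤ m ⊔ e.2 then (s.1, e :: s.2) else (s.1 ⊓ e.2, s.2)) (m, [])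
    (B := 10) (C := 120 * (d + 1) + 40) (by simp [Yields, encList]) cs (fun e l' _ => by
      generalize List.foldr _ _ _ = s
      obtain ⟨t, ht, h⟩ := computes_join (P := joinProgram up) (f := 2) rfl m e.2
      obtain ⟨u, hu, h'⟩ := computes_le (P := joinProgram up) (f := 1) rfl q (m ⊔ e.2)
      obtain ⟨w, hw, h''⟩ := computes_meet (P := joinProgram up) (f := 3) rfl s.1 e.2
      by_cases hq : q ≤ m ⊔ e.2
      · rw [encProp_of hq] at h'
        simp [Yields, encPair, encList, h, h', hq]
        omega
      · rw [encProp_of_not hq] at h'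
        simp [Yields, encPair, h, h', h'', hq]
        omega)
  refine this.mono ?_
  nlinarith

theorem computes_classes (q : Fin d → ℕ) (M : List (Fin d → ℕ)) :
    Computes (joinProgram up) 5 (.cons (encPoints M) (encPoint q))
      (encList ((classes q M).map encPair)) (400 * (d + 1) * (M.length + 1) ^ 2) := by
  classical
  have := computes_fold (P := joinProgram up) (f := 5) rfl encPoint
    (fun cs : List ((Fin d → ℕ) × (Fin d → ℕ)) => encList (cs.map encPair)) (encPoint q)
    (fun m cs => if m ≤ q then if q ≤ m then cs else
      (m, (absorb q m cs).1) :: (absorb q m cs).2 else cs) []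
    (B := 10) (C := 80 * (d + 1) + 200 * (d + 1) * (M.length + 1) + 60)
    (by simp [Yields, encList]) M (fun m l' hl => by
      have hlen : (classes q l').length ≤ M.length :=
        (length_classes_le q l').trans (by simpa using Nat.le_of_succ_le hl.length_le)
      -- The accumulated fold is recognised as `classes q l'`, whose length is known to be at most
      -- that of `M`.
      change Yields _ [encList ((classes q l').map _), _] _ (encList (List.map _
        (if m ≤ q then if q ≤ m then classes q l' else (m, (absorb q m (classes q l')).1) ::
          (absorb q m (classes q l')).2 else classes q l'))) _
      generalize classes q l' = cs at *
      obtain ⟨t, ht, h⟩ := computes_le (P := joinProgram up) (f := 1) rfl m q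
      obtain ⟨u, hu, h'⟩ := computes_le (P := joinProgram up) (f := 1) rfl q m
      obtain ⟨w, hw, h''⟩ := computes_absorb (up := up) q m cs
      replace hw : w ≤ 200 * (d + 1) * (M.length + 1) := hw.trans (by gcongr)
      generalize 200 * (d + 1) * (M.length + 1) = W at *
      by_cases h₁ : m ≤ q
      · rw [encProp_of h₁] at h
        by_cases h₂ : q ≤ m
        · rw [encProp_of h₂] at h'
          simp [Yields, h, h', h₁, h₂]
          omega
        · rw [encProp_of_not h₂] at h'
          simp [Yields, h, h', h'', h₁, h₂, encPair, encList]
          omega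
      · rw [encProp_of_not h₁] at h
        simp [Yields, h, h₁]
        omega)
  refine this.mono ?_
  nlinarith [Nat.zero_le (d * M.length), Nat.zero_le (d * M.length ^ 2)]

theorem computes_passes (D : List (Fin d → ℕ)) (x : Fin d → ℕ) :
    Computes (joinProgram up) 6 (.cons (encPoints D) (encPoint x)) (encProp (Passes up D x))
      (100 * (d + 1) * (D.length + 1)) := by
  cases up
  · have := computes_fold (P := joinProgram false) (f := 6) rfl encPoint encProp (encPoint x)
      (fun y r => x ≤ y ∨ r) False (B := 10) (C := 40 * (d + 1) + 40)
      (by simp [Yields, encProp]) D (fun y l' _ => by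
        generalize List.foldr _ _ _ = r
        obtain ⟨t, ht, h⟩ := computes_le (P := joinProgram false) (f := 1) rfl x y
        by_cases h₁ : x ≤ y
        · rw [encProp_of h₁] at h
          rw [encProp_of (p := x ≤ y ∨ r) (.inl h₁)]
          simp [Yields, h]
          omega
        · rw [encProp_of_not h₁] at h
          simp [Yields, h, h₁]
          omega)
    have he : Passes false D x = D.foldr (fun y r => x ≤ y ∨ r) False := by
      clear this
      induction D with
      | nil => simp [Passes]
      | cons y D ih => simp_all [Passes]
    rw [he]
    exact this.mono (by nlinarith)
  · have := computes_fold (P := joinProgram true) (f := 6) rfl encPoint encProp (encPoint x)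
      (fun y r => ¬ y ≤ x ∧ r) True (B := 10) (C := 40 * (d + 1) + 40)
      (by simp [Yields, encProp]) D (fun y l' _ => by
        generalize List.foldr _ _ _ = r
        obtain ⟨t, ht, h⟩ := computes_le (P := joinProgram true) (f := 1) rfl y x
        by_cases h₁ : y ≤ x
        · rw [encProp_of h₁] at h
          rw [encProp_of_not (p := ¬ y ≤ x ∧ r) (fun h => h.1 h₁)]
          simp [Yields, h]
          omega
        · rw [encProp_of_not h₁] at h
          simp [Yields, h, h₁]
          omega)
    have he : Passes true D x = D.foldr (fun y r => ¬ y ≤ x ∧ r) True := by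
      clear this
      induction D with
      | nil => simp [Passes]
      | cons y D ih => simp_all [Passes]
    rw [he]
    exact this.mono (by nlinarith)

theorem computes_seen (G : List ((Fin d → ℕ) × List (Fin d → ℕ))) (x : Fin d → ℕ) :
    Computes (joinProgram up) 7 (.cons (encList (G.map encGroup)) (encPoint x))
      (encProp (x ∈ G.map Prod.fst)) (200 * (d + 1) * (G.length + 1)) := by
  have := computes_fold (P := joinProgram up) (f := 7) rfl encGroup encProp (encPoint x)
    (fun g r => g.1 = x ∨ r) False (B := 10) (C := 80 * (d + 1) + 60)
    (by simp [Yields, encProp]) G (fun g l' _ => by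
      generalize List.foldr _ _ _ = r
      obtain ⟨t, ht, h⟩ := computes_le (P := joinProgram up) (f := 1) rfl g.1 x
      obtain ⟨u, hu, h'⟩ := computes_le (P := joinProgram up) (f := 1) rfl x g.1
      by_cases h₁ : g.1 ≤ x
      · rw [encProp_of h₁] at h
        by_cases h₂ : x ≤ g.1
        · rw [encProp_of h₂] at h'
          rw [encProp_of (p := g.1 = x ∨ r) (.inl (le_antisymm h₁ h₂))]
          simp [Yields, encGroup, h, h']
          omega
        · rw [encProp_of_not h₂] at h'
          have hne : g.1 ≠ x := fun h => h₂ h.ge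
          simp [Yields, encGroup, h, h', hne]
          omega
      · rw [encProp_of_not h₁] at h
        have hne : g.1 ≠ x := fun h => h₁ h.le
        simp [Yields, encGroup, h, hne]
        omega)
  have he : (x ∈ G.map Prod.fst) = G.foldr (fun g r => g.1 = x ∨ r) False := by
    clear this
    induction G with
    | nil => simp
    | cons g G ih => rw [List.foldr_cons, ← ih]; simp [eq_comm]
  rw [he]
  exact this.mono (by nlinarith)

theorem computes_representatives (cs : List ((Fin d → ℕ) × (Fin d → ℕ))) :
    Computes (joinProgram up) 8 (.cons (encList (cs.map encPair)) (.atom 0))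
      (encPoints (cs.map Prod.fst)) (40 * (cs.length + 1)) := by
  have := computes_fold (P := joinProgram up) (f := 8) rfl encPair
    (encPoints (d := d)) (.atom 0) (fun e l => e.1 :: l) [] (B := 10) (C := 20)
    (by simp [Yields, encPoints, encList]) cs (fun e l' _ => by
      simp [Yields, encPair, encPoints, encList])
  have he : cs.foldr (fun e l => e.1 :: l) [] = cs.map Prod.fst := by
    clear this
    induction cs <;> simp_all
  rw [he] at this
  exact this.mono (by omega)

/-- Up to the factor `d + 1`, each of at most `N` joins costs `O(N ^ 2)`: this pays both for the
classes and for the comparison with at most quadratically many points found earlier. -/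
theorem computes_addJoins (D M l : List (Fin d → ℕ)) (a : Fin d → ℕ)
    (G : List ((Fin d → ℕ) × List (Fin d → ℕ))) {N : ℕ} (hD : D.length ≤ N) (hM : M.length ≤ N)
    (hl : l.length ≤ N) (hG : G.length ≤ N ^ 2) :
    Computes (joinProgram up) 9
      (.cons (encPoints l) (.cons (encList (G.map encGroup))
        (.cons (encPoint a) (.cons (encPoints M) (encPoints D)))))
      (encList ((l.foldr (fun b G => addJoin up D M (a ⊔ b) G) G).map encGroup))
      (3000 * (d + 1) * (N + 1) ^ 3) := by
  have := computes_fold (P := joinProgram up) (f := 9) rfl encPoint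
    (fun G : List ((Fin d → ℕ) × List (Fin d → ℕ)) => encList (G.map encGroup))
    (.cons (encList (G.map encGroup)) (.cons (encPoint a) (.cons (encPoints M) (encPoints D))))
    (fun b G => addJoin up D M (a ⊔ b) G) G
    (B := 10) (C := 2000 * (d + 1) * (N + 1) ^ 2)
    (by simp [Yields]) l (fun b l' hl' => by
      have hlen := length_foldr_addJoin (up := up) (D := D) (M := M) l' a G
      have hll := hl'.length_le
      rw [List.length_cons] at hll
      generalize List.foldr _ G l' = H at *
      obtain ⟨t₁, ht₁, h₁⟩ := computes_join (P := joinProgram up) (f := 2) rfl a b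
      generalize a ⊔ b = q at *
      obtain ⟨t₂, ht₂, h₂⟩ := computes_passes (up := up) D q
      obtain ⟨t₃, ht₃, h₃⟩ := computes_classes (up := up) q M
      obtain ⟨t₄, ht₄, h₄⟩ := computes_seen (up := up) H q
      obtain ⟨t₅, ht₅, h₅⟩ := computes_representatives (up := up) (classes q M)
      have hc := (length_classes_le q M).trans hM
      -- All costs become multiples of the single number `K`, which reduces the bookkeeping to
      -- linear arithmetic.
      obtain ⟨K, hK, hKl⟩ : ∃ K, K = (d + 1) * (N + 1) ^ 2 ∧ 1 ≤ K :=
        ⟨_, rfl, Nat.mul_pos (by omega) (by positivity)⟩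
      replace ht₁ : t₁ ≤ 40 * K := ht₁.trans (by rw [hK]; nlinarith [Nat.zero_le (d * N)])
      replace ht₂ : t₂ ≤ 100 * K := by
        refine ht₂.trans ?_
        rw [hK, mul_assoc]
        gcongr
        nlinarith
      replace ht₃ : t₃ ≤ 400 * K := by
        refine ht₃.trans ?_
        rw [hK, mul_assoc]
        gcongr
      replace ht₄ : t₄ ≤ 200 * K := by
        refine ht₄.trans ?_
        rw [hK, mul_assoc]
        gcongr
        nlinarith
      replace ht₅ : t₅ ≤ 40 * K := by
        refine ht₅.trans ?_
        rw [hK]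
        gcongr
        nlinarith [Nat.zero_le (d * N)]
      rw [mul_assoc, ← hK]
      clear hK
      by_cases hp : Passes up D q
      · rw [encProp_of hp] at h₂
        by_cases hlen2 : 2 ≤ (classes q M).length
        -- The program never counts classes; it only inspects whether the list has a second cell.
        · obtain ⟨u, v, w, hC⟩ : ∃ u v w, encList ((classes q M).map encPair) =
              .cons u (.cons v w) := by
            match classes q M, hlen2 with
            | e :: f :: cs, _ => exact ⟨_, _, _, rfl⟩
          rw [hC] at h₃ h₅
          by_cases hs : q ∈ H.map Prod.fst
          · rw [encProp_of hs] at h₄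
            rw [addJoin, if_neg (by tauto)]
            simp [Yields, h₁, h₂, h₃, h₄]
            omega
          · rw [encProp_of_not hs] at h₄
            rw [addJoin, if_pos ⟨hp, hlen2, hs⟩]
            change Yields _ _ _ (.cons (.cons (encPoint q) (encPoints _)) (encList _)) _
            generalize encPoints ((classes q M).map Prod.fst) = R at *
            simp [Yields, h₁, h₂, h₃, h₄, h₅]
            omega
        · rw [addJoin, if_neg (by tauto)]
          obtain hC | ⟨u, n, hC⟩ : encList ((classes q M).map encPair) = .atom 0 ∨
              ∃ u n, encList ((classes q M).map encPair) = .cons u (.atom n) := by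
            match classes q M, hlen2 with
            | [], _ => exact .inl rfl
            | [e], _ => exact .inr ⟨_, _, rfl⟩
            | e :: f :: cs, h => simp at h
          · rw [hC] at h₃
            simp [Yields, h₁, h₂, h₃]
            omega
          · rw [hC] at h₃
            simp [Yields, h₁, h₂, h₃]
            omega
      · rw [encProp_of_not hp] at h₂
        rw [addJoin, if_neg (by tauto)]
        simp [Yields, h₁, h₂]
        omega)
  refine this.mono ?_
  have h₁ : 1 ≤ (d + 1) * (N + 1) ^ 2 := Nat.mul_pos (by omega) (by positivity)
  calc l.length * (2000 * (d + 1) * (N + 1) ^ 2 + 20) + 10 + 5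
      ≤ N * (2000 * ((d + 1) * (N + 1) ^ 2) + 20) + 15 := by
        rw [mul_assoc 2000]
        have := Nat.mul_le_mul_right (2000 * ((d + 1) * (N + 1) ^ 2) + 20) hl
        omega
    _ ≤ 3000 * ((d + 1) * (N + 1) ^ 2) * (N + 1) := by nlinarith
    _ = _ := by ring

theorem computes_joins (D M : List (Fin d → ℕ)) {N : ℕ} (hD : D.length ≤ N)
    (hM : M.length ≤ N) :
    Computes (joinProgram up) 10
      (.cons (encPoints M) (.cons (encPoints M) (encPoints D)))
      (encList ((joins up D M).map encGroup)) (4000 * (d + 1) * (N + 1) ^ 4) := by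
  have := computes_fold (P := joinProgram up) (f := 10) rfl encPoint
    (fun G : List ((Fin d → ℕ) × List (Fin d → ℕ)) => encList (G.map encGroup))
    (.cons (encPoints M) (encPoints D))
    (fun a G => M.foldr (fun b G => addJoin up D M (a ⊔ b) G) G) []
    (B := 10) (C := 3000 * (d + 1) * (N + 1) ^ 3 + 30)
    (by simp [Yields, encList]) M (fun a l' hl' => by
      have hlen := length_foldr_joins (up := up) (D := D) (M := M) l'
      have hll := hl'.length_le
      rw [List.length_cons] at hll
      obtain ⟨t, ht, h⟩ := computes_addJoins (up := up) D M M a _ hD hM hM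
        (hlen.trans (by rw [sq]; exact Nat.mul_le_mul (by omega) hM))
      simp [Yields, h]
      omega)
  refine this.mono ?_
  have h₁ : 1 ≤ (d + 1) * (N + 1) ^ 3 := Nat.mul_pos (by omega) (by positivity)
  calc M.length * (3000 * (d + 1) * (N + 1) ^ 3 + 30 + 20) + 10 + 5
      ≤ N * (3000 * ((d + 1) * (N + 1) ^ 3) + 30 + 20) + 15 := by
        rw [mul_assoc 3000]
        have := Nat.mul_le_mul_right (3000 * ((d + 1) * (N + 1) ^ 3) + 30 + 20) hM
        omega
    _ ≤ 4000 * ((d + 1) * (N + 1) ^ 3) * (N + 1) := by nlinarith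
    _ = _ := by ring

theorem length_joins_le (D M : List (Fin d → ℕ)) :
    (joins up D M).length ≤ M.length ^ 2 := by
  rw [sq]
  exact length_foldr_joins M

theorem joinProgram_runs {Q : Set (Fin d → ℕ)} (hQ : Q.OrdConnected) {D M : List (Fin d → ℕ)}
    (hM : Enumerates M (minima Q)) (hD : Delimits up D Q) :
    ∃ (out : Val) (t : ℕ),
      (joinProgram up).Runs (.cons (encPoints M) (encPoints D)) out t ∧
      t ≤ 5000 * (d + 1) * (M.length + D.length + 1) ^ 4 ∧
      ∃ P : Subposet Q, IsInitialScaffold P ∧ Represents out P := by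
  set N := M.length + D.length with hN
  obtain ⟨h₁, h₂, h₃⟩ := joins_spec (up := up) hQ hM.2 hD
  obtain ⟨P, hP, he, hr⟩ := exists_isInitialScaffold (fun x => exists_minima_le Q) hM h₁ h₂ h₃
  have hlen : (joins up D M).length ≤ (N + 1) ^ 2 :=
    (length_joins_le D M).trans (Nat.pow_le_pow_left (by omega) 2)
  -- Representatives are distinct minima of `Q`, so their number is at most that of the minima.
  have hk : ∀ g ∈ joins up D M, g.2.length ≤ N := by
    intro g hg
    have := (h₂ g hg).2.2
    refine (List.Nodup.length_le_of_subset this.nodup fun r hr => ?_).trans (by omega : M.length ≤ N)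
    exact (hM.2 r).2 (this.mem r hr).1
  obtain ⟨t₁, ht₁, hc₁⟩ := computes_joins (up := up) D M (N := N) (by omega) (by omega)
  obtain ⟨t₂, ht₂, hc₂⟩ := computes_elements (P := joinProgram up) (f := 11) rfl (joins up D M) M
  obtain ⟨t₃, ht₃, hc₃⟩ := computes_relations (P := joinProgram up) (f := 11) rfl rfl
    (joins up D M) hk
  have : Computes (joinProgram up) 0 (.cons (encPoints M) (encPoints D))
      (.cons (encPoints ((joins up D M).map Prod.fst ++ M))
        (encRelations ((joins up D M).flatMap fun g => g.2.map fun r => (r, g.1))))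
      (t₁ + t₂ + t₃ + 30) := by
    rw [Computes, app_of_getElem? rfl]
    simp [hc₁, hc₂, hc₃]
    omega
  obtain ⟨t, ht, hrun⟩ := this.runs
  refine ⟨_, t, hrun, ht.trans ?_, P, hP, _, _, he, hr, rfl⟩
  have hpow : (N + 1) ^ 3 ≤ (d + 1) * (N + 1) ^ 4 := by
    rw [pow_succ _ 3]
    nlinarith [Nat.zero_le (d * ((N + 1) ^ 3 * (N + 1))), Nat.zero_le ((N + 1) ^ 3 * N)]
  have h₁ : ((joins up D M).length + 1) * (N + 1) ≤ 2 * (N + 1) ^ 3 := by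
    have : (joins up D M).length + 1 ≤ 2 * (N + 1) ^ 2 := by nlinarith
    calc _ ≤ 2 * (N + 1) ^ 2 * (N + 1) := Nat.mul_le_mul_right _ this
      _ = _ := by ring
  have h₂ : (joins up D M).length + 1 ≤ ((joins up D M).length + 1) * (N + 1) :=
    Nat.le_mul_of_pos_right _ (by omega)
  have h₃ : 1 ≤ (N + 1) ^ 3 := Nat.pos_of_ne_zero (by positivity)
  rw [mul_assoc] at ht₁ ht₃ ⊢
  omega

end

/-! ### Sweeping by merge sort -/

/-- An item of a list to be sorted by `key`.  Sorting also looks for the items with the least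
`val` among certain items with smaller key and records it in `ans`. -/
structure Item (β γ : Type*) where
  key : List ℤ
  val : Option (ℤ × γ)
  ans : Option (ℤ × γ)
  pay : β

/-! ### Merge sort that answers dominance queries -/

section Model
variable {β γ : Type*}

/-- The part of an item that sorting leaves unchanged. -/
def Item.core (r : Item β γ) : List ℤ × Option (ℤ × γ) × β := (r.key, r.val, r.pay)

/-- The better of two optional values is the smaller one. -/
def better : Option (ℤ × γ) → Option (ℤ × γ) → Option (ℤ × γ)
  | none, o => o
  | some p, none => some p
  | some p, some q => if p.1 ≤ q.1 then some p else some q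

/-- Improve the answer of an item. -/
def Item.update (r : Item β γ) (o : Option (ℤ × γ)) : Item β γ :=
  { r with ans := better r.ans o }

open Classical in
/-- Merge two sorted lists, improving the answers of the items of the second list by the values of
the items of the first list with at most the same key. -/
noncomputable def mergeItems :
    Option (ℤ × γ) → List (Item β γ) → List (Item β γ) → List (Item β γ)
  | _, L, [] => L
  | o, [], r :: R => r.update o :: mergeItems o [] R
  | o, l :: L, r :: R =>
    if l.key ≤ r.key then l :: mergeItems (better o l.val) L (r :: R)
    else r.update o :: mergeItems o (l :: L) R
termination_by _ L R => L.length + R.length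

/-- Merge the lists of a list in pairs. -/
noncomputable def mergePairs : List (List (Item β γ)) → List (List (Item β γ))
  | [] => []
  | [x] => [x]
  | x :: y :: r => mergeItems none x y :: mergePairs r

theorem length_mergePairs (ls : List (List (Item β γ))) :
    (mergePairs ls).length = (ls.length + 1) / 2 := by
  induction ls using mergePairs.induct with
  | case1 => simp [mergePairs]
  | case2 => simp [mergePairs]
  | case3 x y r ih =>
    simp only [mergePairs, List.length_cons, ih]
    omega

/-- Merge all lists of a list. -/
noncomputable def mergeAll : List (List (Item β γ)) → List (Item β γ)
  | [] => []
  | [x] => x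
  | x :: y :: r => mergeAll (mergePairs (x :: y :: r))
termination_by ls => ls.length
decreasing_by simp only [length_mergePairs, List.length_cons]; omega

/-- Sort a list of items. -/
noncomputable def sortItems (s : List (Item β γ)) : List (Item β γ) :=
  mergeAll (s.map fun r => [r])

/-- `o` is the least of the values in `A`, if there are any. -/
def IsBest (o : Option (ℤ × γ)) (A : Set (ℤ × γ)) : Prop :=
  (∀ p, o = some p → p ∈ A) ∧ ∀ p ∈ A, ∃ q, o = some q ∧ q.1 ≤ p.1

theorem isBest_none : IsBest (none : Option (ℤ × γ)) ∅ := by simp [IsBest]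

theorem isBest_option (o : Option (ℤ × γ)) : IsBest o {p | o = some p} :=
  ⟨fun _ h => h, fun p h => ⟨p, h, le_rfl⟩⟩

theorem IsBest.union {o o' : Option (ℤ × γ)} {A B : Set (ℤ × γ)} (h : IsBest o A)
    (h' : IsBest o' B) : IsBest (better o o') (A ∪ B) := by
  match o, o' with
  | none, o' =>
    refine ⟨fun p hp => .inr (h'.1 p hp), ?_⟩
    rintro p (hp | hp)
    · obtain ⟨q, hq, -⟩ := h.2 p hp
      simp at hq
    · exact h'.2 p hp
  | some p₀, none =>
    refine ⟨fun p hp => .inl (h.1 p hp), ?_⟩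
    rintro p (hp | hp)
    · exact h.2 p hp
    · obtain ⟨q, hq, -⟩ := h'.2 p hp
      simp at hq
  | some p₀, some p₁ =>
    have h₁ : ∀ p ∈ A, p₀.1 ≤ p.1 := fun p hp => by
      obtain ⟨q, hq, hqp⟩ := h.2 p hp
      cases hq
      exact hqp
    have h₂ : ∀ p ∈ B, p₁.1 ≤ p.1 := fun p hp => by
      obtain ⟨q, hq, hqp⟩ := h'.2 p hp
      cases hq
      exact hqp
    change IsBest (if p₀.1 ≤ p₁.1 then some p₀ else some p₁) _
    split_ifs with hle
    · refine ⟨fun p hp => .inl (h.1 p hp), fun p hp => ⟨p₀, rfl, ?_⟩⟩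
      exact hp.elim (h₁ p) fun hp => hle.trans (h₂ p hp)
    · refine ⟨fun p hp => .inr (h'.1 p hp), fun p hp => ⟨p₁, rfl, ?_⟩⟩
      exact hp.elim (fun hp => (le_of_not_ge hle).trans (h₁ p hp)) (h₂ p)

theorem core_mergeItems (o : Option (ℤ × γ)) (L R : List (Item β γ)) :
    ((mergeItems o L R).map Item.core).Perm ((L ++ R).map Item.core) := by
  induction o, L, R using mergeItems.induct with
  | case1 => simp [mergeItems]
  | case2 o r R ih =>
    rw [mergeItems]
    simpa [Item.core, Item.update] using ih
  | case3 o l L r R h ih =>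
    rw [mergeItems, if_pos h]
    simpa using ih
  | case4 o l L r R h ih =>
    rw [mergeItems, if_neg h]
    refine (ih.cons _).trans ?_
    simp only [List.cons_append, List.map_cons, List.map_append]
    refine (List.Perm.swap _ _ _).trans (.cons _ ?_)
    exact (List.perm_middle (l₁ := L.map Item.core)).symm

/-- `A` stands for the values of the items of the first list that have already been output, and `o`
is the best of them. When an item of the second list is output, exactly the items with at most its
key have been passed. -/
theorem mergeItems_spec {o : Option (ℤ × γ)} {A : Set (ℤ × γ)} {L R : List (Item β γ)}
    (ho : IsBest o A) (hL : L.Pairwise fun r s => r.key ≤ s.key)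
    (hR : R.Pairwise fun r s => r.key ≤ s.key) :
    ((mergeItems o L R).Pairwise fun r s => r.key ≤ s.key) ∧
    ∀ r ∈ mergeItems o L R, r ∈ L ∨ ∃ s ∈ R, ∃ x, r = s.update x ∧
      IsBest x (A ∪ {p | ∃ l ∈ L, l.val = some p ∧ l.key ≤ s.key}) := by
  have hkey : ∀ (o : Option (ℤ × γ)) (L R : List (Item β γ)), ∀ r ∈ mergeItems o L R,
      ∃ s ∈ L ++ R, r.key = s.key := by
    intro o L R r hr
    have := (core_mergeItems o L R).subset (List.mem_map_of_mem hr)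
    obtain ⟨s, hs, h⟩ := List.mem_map.1 this
    exact ⟨s, hs, (congrArg Prod.fst h).symm⟩
  induction o, L, R using mergeItems.induct generalizing A with
  | case1 o L =>
    rw [mergeItems]
    exact ⟨hL, fun r hr => .inl hr⟩
  | case2 o r R ih =>
    rw [mergeItems]
    obtain ⟨h₁, h₂⟩ := ih ho hL hR.of_cons
    refine ⟨List.pairwise_cons.2 ⟨fun s hs => ?_, h₁⟩, fun s hs => .inr ?_⟩
    · obtain ⟨t, ht, h⟩ := hkey _ _ _ s hs
      rw [h]
      exact List.rel_of_pairwise_cons hR (by simpa using ht)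
    · obtain rfl | hs := List.mem_cons.1 hs
      · exact ⟨r, by simp, o, rfl, by simpa using ho⟩
      · obtain h | ⟨t, ht, x, h⟩ := h₂ s hs
        · simp at h
        · exact ⟨t, List.mem_cons_of_mem _ ht, x, h⟩
  | case3 o l L r R h ih =>
    rw [mergeItems, if_pos h]
    obtain ⟨h₁, h₂⟩ := ih (ho.union (isBest_option l.val)) hL.of_cons hR
    refine ⟨List.pairwise_cons.2 ⟨fun s hs => ?_, h₁⟩, fun s hs => ?_⟩
    · obtain ⟨t, ht, h'⟩ := hkey _ _ _ s hs
      rw [h']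
      obtain ht | ht := List.mem_append.1 ht
      · exact List.rel_of_pairwise_cons hL ht
      · obtain rfl | ht := List.mem_cons.1 ht
        · exact h
        · exact h.trans (List.rel_of_pairwise_cons hR ht)
    · obtain rfl | hs := List.mem_cons.1 hs
      · exact .inl (by simp)
      · refine (h₂ s hs).imp (List.mem_cons_of_mem _) ?_
        rintro ⟨t, ht, x, hx, hb⟩
        refine ⟨t, ht, x, hx, ?_⟩
        -- Passing `l` moves its value from the list into `A`. It counts for every remaining item of
        -- the second list, because their keys are at least `l.key`.
        convert hb using 1
        have hlt : l.key ≤ t.key := by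
          obtain rfl | ht := List.mem_cons.1 ht
          · exact h
          · exact h.trans (List.rel_of_pairwise_cons hR ht)
        ext p
        simp [hlt, or_assoc]
  | case4 o l L r R h ih =>
    rw [mergeItems, if_neg h]
    obtain ⟨h₁, h₂⟩ := ih ho hL hR.of_cons
    -- What is left of the first list has larger keys than `r`, so `o` is already the complete
    -- contribution to the answer of `r`.
    have hlt : ∀ s ∈ l :: L, r.key < s.key := by
      intro s hs
      obtain rfl | hs := List.mem_cons.1 hs
      · exact lt_of_not_ge h
      · exact (lt_of_not_ge h).trans_le (List.rel_of_pairwise_cons hL hs)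
    refine ⟨List.pairwise_cons.2 ⟨fun s hs => ?_, h₁⟩, fun s hs => ?_⟩
    · obtain ⟨t, ht, h'⟩ := hkey _ _ _ s hs
      rw [h']
      obtain ht | ht := List.mem_append.1 ht
      · exact (hlt t ht).le
      · exact List.rel_of_pairwise_cons hR ht
    · obtain rfl | hs := List.mem_cons.1 hs
      · refine .inr ⟨r, by simp, o, rfl, ?_⟩
        convert ho using 1
        ext p
        simp only [Set.mem_union, Set.mem_ofPred_eq, or_iff_left_iff_imp]
        rintro ⟨s, hs, -, hle⟩
        exact absurd hle (hlt s hs).not_ge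
      · refine (h₂ s hs).imp id ?_
        rintro ⟨t, ht, h⟩
        exact ⟨t, List.mem_cons_of_mem _ ht, h⟩

/-- `o` results from sorting `s`, and the answers of those items of `o` with payload in `W` are
the least values of items with at most the same key and with a payload that precedes theirs. -/
structure Swept (W : β → Prop) (Pre : β → β → Prop) (s o : List (Item β γ)) : Prop where
  core : (o.map Item.core).Perm (s.map Item.core)
  sorted : o.Pairwise fun r s => r.key ≤ s.key
  ans : ∀ r ∈ o, W r.pay →
    IsBest r.ans {p | ∃ l ∈ s, l.val = some p ∧ Pre l.pay r.pay ∧ l.key ≤ r.key}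

/-- The condition on an item `l` before an item `r` for sweeping. -/
def SweepOrder (W : β → Prop) (Pre : β → β → Prop) (l r : Item β γ) : Prop :=
  (W r.pay → l.val ≠ none → Pre l.pay r.pay) ∧ (W l.pay → r.val ≠ none → ¬ Pre r.pay l.pay)

variable {W : β → Prop} {Pre : β → β → Prop}

theorem Swept.exists_core {s o : List (Item β γ)} (h : Swept W Pre s o) {r : Item β γ}
    (hr : r ∈ o) : ∃ r' ∈ s, r'.key = r.key ∧ r'.val = r.val ∧ r'.pay = r.pay := by
  obtain ⟨r', hr', he⟩ := List.mem_map.1 (h.core.subset (List.mem_map_of_mem hr))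
  simp only [Item.core, Prod.mk.injEq] at he
  exact ⟨r', hr', he⟩

theorem Swept.exists_core' {s o : List (Item β γ)} (h : Swept W Pre s o) {r : Item β γ}
    (hr : r ∈ s) : ∃ r' ∈ o, r'.key = r.key ∧ r'.val = r.val ∧ r'.pay = r.pay := by
  obtain ⟨r', hr', he⟩ := List.mem_map.1 (h.core.symm.subset (List.mem_map_of_mem hr))
  simp only [Item.core, Prod.mk.injEq] at he
  exact ⟨r', hr', he⟩

/-- Divide and conquer. By `SweepOrder`, no item of the second half with a value precedes a query in
the first, so the answers there stand; every item of the first half with a value precedes the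
queries in the second, so across the halves only keys matter, and these are what merging compares.
-/
theorem Swept.merge {s₁ s₂ o₁ o₂ : List (Item β γ)} (h₁ : Swept W Pre s₁ o₁)
    (h₂ : Swept W Pre s₂ o₂) (h : ∀ l ∈ s₁, ∀ r ∈ s₂, SweepOrder W Pre l r) :
    Swept W Pre (s₁ ++ s₂) (mergeItems none o₁ o₂) := by
  obtain ⟨hs, ha⟩ := mergeItems_spec isBest_none h₁.sorted h₂.sorted
  refine ⟨?_, hs, fun r hr hW => ?_⟩
  · refine (core_mergeItems _ _ _).trans ?_
    simp only [List.map_append]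
    exact h₁.core.append h₂.core
  · obtain hr | ⟨r₀, hr₀, x, rfl, hx⟩ := ha r hr
    · convert h₁.ans r hr hW using 1
      obtain ⟨r', hr', -, -, hp⟩ := h₁.exists_core hr
      ext p
      simp only [List.mem_append, Set.mem_ofPred_eq]
      constructor
      · rintro ⟨l, hl | hl, hv, hl'⟩
        · exact ⟨l, hl, hv, hl'⟩
        · exact absurd (hp ▸ hl'.1) ((h r' hr' l hl).2 (hp ▸ hW) (by simp [hv]))
      · rintro ⟨l, hl, hl'⟩
        exact ⟨l, .inl hl, hl'⟩
    · obtain ⟨r', hr', -, -, hp⟩ := h₂.exists_core hr₀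
      change IsBest (better r₀.ans x) _
      convert (h₂.ans r₀ hr₀ hW).union hx using 1
      change {p | ∃ l ∈ s₁ ++ s₂, l.val = some p ∧ Pre l.pay r₀.pay ∧ l.key ≤ r₀.key} = _
      ext p
      simp only [List.mem_append, Set.mem_ofPred_eq, Set.mem_union, Set.mem_empty_iff_false,
        false_or]
      constructor
      · rintro ⟨l, hl | hl, hv, hl'⟩
        · obtain ⟨l', hl'', hk, hv', -⟩ := h₁.exists_core' hl
          exact .inr ⟨l', hl'', hv'.trans hv, hk ▸ hl'.2⟩
        · exact .inl ⟨l, hl, hv, hl'⟩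
      · rintro (⟨l, hl, hv, hl'⟩ | ⟨l, hl, hv, hl'⟩)
        · exact ⟨l, .inr hl, hv, hl'⟩
        · obtain ⟨l', hl'', hk, hv', -⟩ := h₁.exists_core hl
          refine ⟨l', .inl hl'', hv'.trans hv, ?_, hk.trans_le hl'⟩
          exact hp ▸ (h l' hl'' r' hr').1 (hp ▸ hW) (by simp [hv', hv])

theorem Swept.mergePairs {ss ls : List (List (Item β γ))}
    (h : List.Forall₂ (Swept W Pre) ss ls) (hs : ss.flatten.Pairwise (SweepOrder W Pre)) :
    ∃ ss', ss'.flatten = ss.flatten ∧ List.Forall₂ (Swept W Pre) ss' (mergePairs ls) := by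
  induction ls using mergePairs.induct generalizing ss with
  | case1 => exact ⟨ss, rfl, by simpa [InitScaffold.mergePairs] using h⟩
  | case2 => exact ⟨ss, rfl, by simpa [InitScaffold.mergePairs] using h⟩
  | case3 x y r ih =>
    obtain _ | ⟨hx, h⟩ := h
    obtain _ | ⟨hy, h⟩ := h
    rename_i sx sy ss
    simp only [List.flatten_cons, ← List.append_assoc] at hs
    rw [List.pairwise_append] at hs
    obtain ⟨ss', hss', h'⟩ := ih h hs.2.1
    refine ⟨(sx ++ sy) :: ss', by simp [hss'], ?_⟩
    rw [InitScaffold.mergePairs]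
    exact .cons (hx.merge hy (List.pairwise_append.1 hs.1).2.2) h'

theorem Swept.mergeAll {ss ls : List (List (Item β γ))}
    (h : List.Forall₂ (Swept W Pre) ss ls) (hs : ss.flatten.Pairwise (SweepOrder W Pre)) :
    Swept W Pre ss.flatten (mergeAll ls) := by
  induction ls using mergeAll.induct generalizing ss with
  | case1 =>
    cases h
    exact ⟨by simp [InitScaffold.mergeAll], by simp [InitScaffold.mergeAll],
      by simp [InitScaffold.mergeAll]⟩
  | case2 x =>
    obtain _ | ⟨hx, h⟩ := h
    cases h
    simpa [InitScaffold.mergeAll] using hx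
  | case3 x y r ih =>
    obtain ⟨ss', hss', h'⟩ := Swept.mergePairs h hs
    rw [InitScaffold.mergeAll, ← hss']
    exact ih h' (hss' ▸ hs)

/-- Only contiguous blocks are ever merged, so the order of the input encodes `Pre`. A block of one
item has nothing to answer if its answer starts empty and it does not precede itself. -/
theorem swept_sortItems {s : List (Item β γ)} (hs : s.Pairwise (SweepOrder W Pre))
    (hans : ∀ r ∈ s, W r.pay → r.ans = none ∧ (r.val ≠ none → ¬ Pre r.pay r.pay)) :
    Swept W Pre s (sortItems s) := by
  have hf : (s.map fun r => [r]).flatten = s := by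
    clear hs hans
    induction s <;> simp_all
  have := Swept.mergeAll (W := W) (Pre := Pre) (ss := s.map fun r => [r])
    (ls := s.map fun r => [r]) ?_ (hf.symm ▸ hs)
  · rwa [hf] at this
  · rw [List.forall₂_same]
    intro x hx
    obtain ⟨r, hr, rfl⟩ := List.mem_map.1 hx
    refine ⟨.refl _, by simp, fun r' hr' hW => ?_⟩
    obtain rfl := List.mem_singleton.1 hr'
    obtain ⟨h₁, h₂⟩ := hans r' hr hW
    rw [h₁]
    convert isBest_none using 1
    ext p
    simp only [List.mem_singleton, Set.mem_ofPred_eq, Set.mem_empty_iff_false, iff_false]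
    rintro ⟨l, rfl, hv, hl, -⟩
    exact h₂ (by simp [hv]) hl

/-- With no queries and no precedence, the conditions for sweeping are void and plain correctness of
sorting remains. -/
theorem sortItems_perm_sorted (s : List (Item β γ)) :
    ((sortItems s).map Item.core).Perm (s.map Item.core) ∧
      (sortItems s).Pairwise fun r s => r.key ≤ s.key := by
  have := swept_sortItems (W := fun _ => False) (Pre := fun _ _ => False) (s := s)
    (List.pairwise_of_forall fun _ _ => ⟨False.elim, False.elim⟩) fun _ _ => False.elim
  exact ⟨this.core, this.sorted⟩

end Model

/-- Integers are represented by numbers with a sign. -/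
def encInt : ℤ → Val
  | .ofNat n => .atom n
  | .negSucc n => .cons (.atom 0) (.atom n)

/-- Sorting keys. -/
def encKey (k : List ℤ) : Val := encList (k.map encInt)

/-- Optional values. -/
def encOption {γ : Type*} (ec : γ → Val) : Option (ℤ × γ) → Val
  | none => .atom 0
  | some p => .cons (encInt p.1) (ec p.2)

/-- Items. -/
def encItem {β γ : Type*} (eb : β → Val) (ec : γ → Val) (r : Item β γ) : Val :=
  .cons (encKey r.key) (.cons (encOption ec r.val) (.cons (encOption ec r.ans) (eb r.pay)))

/-- The functions for sorting: comparison of integers and of keys, the better of two optional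
values, merging of two lists, of pairs of lists, of all lists, lists of one element, sorting. -/
def sortExps : List Exp :=
  [.letIn (.fst (.var 0)) (.letIn (.snd (.var 1))
      (.ifAtom (.var 1)
        (.ifAtom (.var 0) (.ifLe (.var 1) (.var 0) (.const 0) (.const 1)) (.const 1))
        (.ifAtom (.var 0) (.const 0)
          (.ifLe (.snd (.var 0)) (.snd (.var 1)) (.const 0) (.const 1))))),
    .ifAtom (.fst (.var 0)) (.const 0) (.ifAtom (.snd (.var 0)) (.const 1)
      (.ifLe (.call 1 (.cons (.fst (.fst (.var 0))) (.fst (.snd (.var 0))))) (.const 0)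
        (.ifLe (.call 1 (.cons (.fst (.snd (.var 0))) (.fst (.fst (.var 0))))) (.const 0)
          (.call 2 (.cons (.snd (.fst (.var 0))) (.snd (.snd (.var 0))))) (.const 0))
        (.const 1))),
    .ifAtom (.fst (.var 0)) (.snd (.var 0)) (.ifAtom (.snd (.var 0)) (.fst (.var 0))
      (.ifLe (.call 1 (.cons (.fst (.fst (.var 0))) (.fst (.snd (.var 0))))) (.const 0)
        (.fst (.var 0)) (.snd (.var 0)))),
    .letIn (.fst (.var 0)) (.letIn (.fst (.snd (.var 1))) (.letIn (.snd (.snd (.var 2)))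
      (.ifAtom (.var 0) (.var 1)
        (.letIn (.fst (.var 0))
          (.ifAtom (.var 2)
            (.cons (.cons (.fst (.var 0)) (.cons (.fst (.snd (.var 0)))
                (.cons (.call 3 (.cons (.fst (.snd (.snd (.var 0)))) (.var 3)))
                  (.snd (.snd (.snd (.var 0)))))))
              (.call 4 (.cons (.var 3) (.cons (.const 0) (.snd (.var 1))))))
            (.ifLe (.call 2 (.cons (.fst (.fst (.var 2))) (.fst (.var 0)))) (.const 0)
              (.cons (.fst (.var 2)) (.call 4
                (.cons (.call 3 (.cons (.var 3) (.fst (.snd (.fst (.var 2))))))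
                  (.cons (.snd (.var 2)) (.var 1)))))
              (.cons (.cons (.fst (.var 0)) (.cons (.fst (.snd (.var 0)))
                  (.cons (.call 3 (.cons (.fst (.snd (.snd (.var 0)))) (.var 3)))
                    (.snd (.snd (.snd (.var 0)))))))
                (.call 4 (.cons (.var 3) (.cons (.var 2) (.snd (.var 1))))))))))))
      ,
    .ifAtom (.var 0) (.const 0) (.ifAtom (.snd (.var 0)) (.var 0)
      (.cons (.call 4 (.cons (.const 0) (.cons (.fst (.var 0)) (.fst (.snd (.var 0))))))
        (.call 5 (.snd (.snd (.var 0)))))),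
    .ifAtom (.var 0) (.const 0) (.ifAtom (.snd (.var 0)) (.fst (.var 0))
      (.call 6 (.call 5 (.var 0)))),
    foldExp 7 (.const 0) (.cons (.cons (.fst (.fst (.var 1))) (.const 0)) (.var 0)),
    .call 6 (.call 7 (.cons (.var 0) (.const 0)))]

/-- The program `P` contains the functions for sorting as functions `1`, ..., `8`. -/
def HasSort (P : Program) : Prop := ∀ k < 8, P[k + 1]? = sortExps[k]?

/-! ### Running time of sorting -/

section
variable {P : Program} {β γ : Type*} {eb : β → Val} {ec : γ → Val}

theorem computes_intLe (hP : HasSort P) (x y : ℤ) :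
    Computes P 1 (.cons (encInt x) (encInt y)) (encProp (x ≤ y)) 20 := by
  rw [Computes, app_of_getElem? (hP 0 (by omega))]
  rcases x with m | m <;> rcases y with n | n
  · by_cases h : m ≤ n <;> simp [encInt, encProp, h]
  · have h : ¬ (Int.ofNat m ≤ Int.negSucc n) := by
      have := Int.negSucc_lt_zero n
      simp only [Int.ofNat_eq_natCast]
      omega
    rw [encProp_of_not h]
    simp [encInt]
  · have h : Int.negSucc m ≤ Int.ofNat n := by
      have := Int.negSucc_lt_zero m
      simp only [Int.ofNat_eq_natCast]
      omega
    rw [encProp_of h]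
    simp [encInt]
  · have h : Int.negSucc m ≤ Int.negSucc n ↔ n ≤ m := by
      rw [Int.negSucc_eq, Int.negSucc_eq]
      omega
    by_cases h' : n ≤ m <;> simp only [encProp, h, h'] <;> simp [encInt, h']

theorem key_nil_le (l : List ℤ) : [] ≤ l := not_lt.1 (by simp)

theorem not_key_cons_le_nil (x : ℤ) (l : List ℤ) : ¬ x :: l ≤ [] := not_le.2 (by simp)

theorem key_cons_le_cons {x y : ℤ} {k l : List ℤ} :
    x :: k ≤ y :: l ↔ x < y ∨ x = y ∧ k ≤ l := by
  rw [← not_lt, ← not_lt (a := l), List.cons_lt_cons_iff]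
  obtain h | rfl | h := lt_trichotomy x y
  · simp [h, h.not_gt, h.ne']
  · simp
  · simp [h, h.not_gt, h.ne']

theorem computes_keyLe (hP : HasSort P) (k l : List ℤ) :
    Computes P 2 (.cons (encKey k) (encKey l)) (encProp (k ≤ l)) (100 * (k.length + 1)) := by
  induction k generalizing l with
  | nil =>
    rw [Computes, app_of_getElem? (hP 1 (by omega))]
    rw [encProp_of (key_nil_le l)]
    simp [encKey, encList]
  | cons x k ih =>
    cases l with
    | nil =>
      rw [Computes, app_of_getElem? (hP 1 (by omega)), encProp_of_not (not_key_cons_le_nil x k)]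
      simp [encKey, encList]
      omega
    | cons y l =>
      obtain ⟨t, ht, h⟩ := ih l
      obtain ⟨t₁, ht₁, h₁⟩ := computes_intLe hP x y
      obtain ⟨t₂, ht₂, h₂⟩ := computes_intLe hP y x
      rw [Computes, app_of_getElem? (hP 1 (by omega))]
      simp only [encKey] at h
      obtain hxy | rfl | hxy := lt_trichotomy x y
      · rw [encProp_of hxy.le] at h₁
        rw [encProp_of_not hxy.not_ge] at h₂
        rw [encProp_of (key_cons_le_cons.2 (.inl hxy))]
        simp [encKey, encList, h₁, h₂]
        omega
      · rw [encProp_of le_rfl] at h₁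
        have : (x :: k ≤ x :: l) = (k ≤ l) := by simp [key_cons_le_cons]
        rw [this]
        simp [encKey, encList, h₁, h]
        omega
      · rw [encProp_of_not hxy.not_ge] at h₁
        rw [encProp_of_not (by simp [key_cons_le_cons, hxy.le, hxy.ne'])]
        simp [encKey, encList, h₁]
        omega

theorem computes_better (hP : HasSort P) (o o' : Option (ℤ × γ)) :
    Computes P 3 (.cons (encOption ec o) (encOption ec o')) (encOption ec (better o o')) 60 := by
  rw [Computes, app_of_getElem? (hP 2 (by omega))]
  match o, o' with
  | none, o' => simp [encOption, better]
  | some p, none => simp [encOption, better]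
  | some p, some q =>
    obtain ⟨t₁, ht₁, h₁⟩ := computes_intLe hP p.1 q.1
    by_cases h : p.1 ≤ q.1
    · rw [encProp_of h] at h₁
      simp [encOption, better, h₁, h]
      omega
    · rw [encProp_of_not h] at h₁
      simp [encOption, better, h₁, h]
      omega

/-- Each call outputs one item. The cost of a key comparison is bounded by the length of its left
argument, which comes from `L`; so only the keys in `L` need a bound. -/
theorem computes_merge (hP : HasSort P) {κ : ℕ} (o : Option (ℤ × γ)) (L R : List (Item β γ))
    (hL : ∀ l ∈ L, l.key.length ≤ κ) :
    Computes P 4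
      (.cons (encOption ec o) (.cons (encList (L.map (encItem eb ec)))
        (encList (R.map (encItem eb ec)))))
      (encList ((mergeItems o L R).map (encItem eb ec)))
      (300 * (κ + 1) * (L.length + R.length + 1)) := by
  have hb : P[3 + 1]? = _ := hP 3 (by omega)
  induction o, L, R using mergeItems.induct with
  | case1 o L =>
    rw [Computes, app_of_getElem? hb, mergeItems]
    simp [encList]
    nlinarith
  | case2 o r R ih =>
    obtain ⟨t, ht, h⟩ := ih hL
    obtain ⟨t₁, ht₁, h₁⟩ := computes_better (ec := ec) hP r.ans o
    simp only [List.length_nil, List.length_cons, Nat.zero_add] at ht ⊢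
    have hc : 300 * (κ + 1) * (R.length + 1) + 300 ≤ 300 * (κ + 1) * (R.length + 1 + 1) := by
      nlinarith
    refine Computes.mono (B := t + t₁ + 100) ?_ (by omega)
    rw [Computes, app_of_getElem? hb, mergeItems]
    simp only [List.map_nil, encList] at h
    simp [encList, encItem, Item.update, h, h₁]
    omega
  | case3 o l L r R hle ih =>
    obtain ⟨t, ht, h⟩ := ih fun l hl => hL l (List.mem_cons_of_mem _ hl)
    obtain ⟨t₁, ht₁, h₁⟩ := computes_better (ec := ec) hP o l.val
    obtain ⟨t₂, ht₂, h₂⟩ := computes_keyLe hP l.key r.key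
    rw [encProp_of hle] at h₂
    simp only [List.length_cons] at ht ⊢
    have hc : 300 * (κ + 1) * (L.length + (R.length + 1) + 1) + 300 * (κ + 1) ≤
        300 * (κ + 1) * (L.length + 1 + (R.length + 1) + 1) := by
      nlinarith
    have := hL l (by simp)
    refine Computes.mono (B := t + t₁ + t₂ + 140) ?_ (by omega)
    rw [Computes, app_of_getElem? hb, mergeItems, if_pos hle]
    simp only [List.map_cons, encList, encItem] at h
    simp [encList, encItem, h, h₁, h₂]
    omega
  | case4 o l L r R hle ih =>
    obtain ⟨t, ht, h⟩ := ih hL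
    obtain ⟨t₁, ht₁, h₁⟩ := computes_better (ec := ec) hP r.ans o
    obtain ⟨t₂, ht₂, h₂⟩ := computes_keyLe hP l.key r.key
    rw [encProp_of_not hle] at h₂
    simp only [List.length_cons] at ht ⊢
    have hc : 300 * (κ + 1) * (L.length + 1 + R.length + 1) + 300 * (κ + 1) ≤
        300 * (κ + 1) * (L.length + 1 + (R.length + 1) + 1) := by
      nlinarith
    have := hL l (by simp)
    refine Computes.mono (B := t + t₁ + t₂ + 140) ?_ (by omega)
    rw [Computes, app_of_getElem? hb, mergeItems, if_neg hle]
    simp only [List.map_cons, encList, encItem] at h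
    simp [encList, encItem, Item.update, h, h₁, h₂]
    omega

/-- A list of lists of items. -/
def encItemss (eb : β → Val) (ec : γ → Val) (ls : List (List (Item β γ))) : Val :=
  encList (ls.map fun l => encList (l.map (encItem eb ec)))

theorem computes_mergePairs (hP : HasSort P) {κ : ℕ} (ls : List (List (Item β γ)))
    (hls : ∀ l ∈ ls, ∀ r ∈ l, r.key.length ≤ κ) :
    Computes P 5 (encItemss eb ec ls) (encItemss eb ec (mergePairs ls))
      (400 * (κ + 1) * (ls.flatten.length + ls.length + 1)) := by
  have hb : P[4 + 1]? = _ := hP 4 (by omega)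
  induction ls using mergePairs.induct with
  | case1 =>
    rw [Computes, app_of_getElem? hb, mergePairs]
    simp [encItemss, encList]
    omega
  | case2 x =>
    rw [Computes, app_of_getElem? hb, mergePairs]
    simp [encItemss, encList]
    nlinarith
  | case3 x y r ih =>
    obtain ⟨t, ht, h⟩ := ih fun l hl => hls l (by simp [hl])
    obtain ⟨t₁, ht₁, h₁⟩ := computes_merge (eb := eb) (ec := ec) hP none x y (hls x (by simp))
    simp only [List.length_cons, List.flatten_cons, List.length_append] at ht ⊢
    have hc : 400 * (κ + 1) * (r.flatten.length + r.length + 1) +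
        300 * (κ + 1) * (x.length + y.length + 1) + 100 ≤
        400 * (κ + 1) * (x.length + (y.length + r.flatten.length) + (r.length + 1 + 1) + 1) := by
      nlinarith [Nat.zero_le (κ * x.length), Nat.zero_le (κ * y.length)]
    refine Computes.mono (B := t + t₁ + 50) ?_ (by omega)
    rw [Computes, app_of_getElem? hb, mergePairs]
    simp only [encItemss, encOption] at h h₁
    simp [encItemss, encList, h, h₁]
    omega

theorem flatten_mergePairs_core (ls : List (List (Item β γ))) :
    ((mergePairs ls).flatten.map Item.core).Perm (ls.flatten.map Item.core) := by
  induction ls using mergePairs.induct with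
  | case1 => simp [mergePairs]
  | case2 => simp [mergePairs]
  | case3 x y r ih =>
    rw [mergePairs]
    simp only [List.flatten_cons, List.map_append, ← List.append_assoc]
    refine List.Perm.append ?_ ih
    simpa using core_mergeItems none x y

/-- A round costs linear time and halves the number of lists, rounding up, which gives the factor
`Nat.clog 2 ls.length + 1`. -/
theorem computes_mergeAll (hP : HasSort P) {κ N : ℕ} (ls : List (List (Item β γ)))
    (hls : ∀ r ∈ ls.flatten, r.key.length ≤ κ) (hN : ls.flatten.length ≤ N) :
    Computes P 6 (encItemss eb ec ls) (encList ((mergeAll ls).map (encItem eb ec)))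
      ((Nat.clog 2 ls.length + 1) * (500 * (κ + 1) * (N + ls.length + 1))) := by
  have hb : P[5 + 1]? = _ := hP 5 (by omega)
  induction ls using mergeAll.induct with
  | case1 =>
    rw [Computes, app_of_getElem? hb, mergeAll]
    simp [encItemss, encList]
    nlinarith [Nat.zero_le (κ * N)]
  | case2 x =>
    rw [Computes, app_of_getElem? hb, mergeAll]
    simp [encItemss, encList]
    nlinarith [Nat.zero_le (κ * N)]
  | case3 x y r ih =>
    have hcore := flatten_mergePairs_core (x :: y :: r)
    -- A round permutes the items without changing their keys, so the bounds on keys and on the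
    -- total length persist.
    obtain ⟨t, ht, h⟩ := ih (fun s hs => by
      obtain ⟨s', hs', he⟩ := List.mem_map.1 (hcore.subset (List.mem_map_of_mem hs))
      have : s'.key = s.key := congrArg Prod.fst he
      exact this ▸ hls s' hs') (by
        have := hcore.length_eq
        simp only [List.length_map] at this
        omega)
    obtain ⟨t₁, ht₁, h₁⟩ := computes_mergePairs (eb := eb) (ec := ec) hP (κ := κ) (x :: y :: r)
      fun l hl s hs => hls s (List.mem_flatten.2 ⟨l, hl, hs⟩)
    rw [length_mergePairs] at ht
    generalize hk : (x :: y :: r).length = k at *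
    have hk2 : 2 ≤ k := by simp at hk; omega
    -- The number of lists after a round is the ceiling of half of `k`, exactly as in the recursion
    -- for the ceiling logarithm.
    have hclog : Nat.clog 2 k = Nat.clog 2 ((k + 1) / 2) + 1 := Nat.clog_of_two_le (by omega) hk2
    have ht' : t ≤ Nat.clog 2 k * (500 * (κ + 1) * (N + k + 1)) := by
      refine ht.trans ?_
      rw [hclog]
      gcongr
      omega
    have ht₁' : t₁ ≤ 400 * (κ + 1) * (N + k + 1) := ht₁.trans (by gcongr)
    have : t + t₁ + 50 ≤ (Nat.clog 2 k + 1) * (500 * (κ + 1) * (N + k + 1)) := by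
      rw [add_mul]
      have : 1 ≤ (κ + 1) * (N + k + 1) := Nat.mul_pos (by omega) (by omega)
      rw [mul_assoc] at ht₁' ⊢
      rw [mul_assoc] at ht'
      omega
    refine Computes.mono ?_ this
    rw [Computes, app_of_getElem? hb, mergeAll]
    simp only [encItemss, encList, List.map_cons] at h₁ ⊢
    simp only [encItemss] at h
    simp [h, h₁]
    omega

/-- A bound for the time needed for sorting. -/
def sortTime (κ N : ℕ) : ℕ := 2000 * (κ + 1) * ((N + 1) * (Nat.clog 2 N + 1))

theorem computes_sort (hP : HasSort P) {κ N : ℕ} (s : List (Item β γ))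
    (hs : ∀ r ∈ s, r.key.length ≤ κ) (hN : s.length ≤ N) :
    Computes P 8 (encList (s.map (encItem eb ec)))
      (encList ((sortItems s).map (encItem eb ec))) (sortTime κ N) := by
  have hb : P[7 + 1]? = _ := hP 7 (by omega)
  have hf : (s.map fun r => [r]).flatten = s := by
    clear hs hN
    induction s <;> simp_all
  obtain ⟨t, ht, h⟩ := computes_mergeAll (eb := eb) (ec := ec) hP (κ := κ) (N := N)
    (s.map fun r => [r]) (by rwa [hf]) (by rwa [hf])
  have := computes_fold (P := P) (f := 7) (hP 6 (by omega)) (encItem eb ec)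
    (encItemss eb ec) (.atom 0) (fun r ls => [r] :: ls) [] (B := 10) (C := 20)
    (by simp [Yields, encItemss, encList]) s (fun r l' _ => by
      simp [Yields, encItemss, encList])
  have he : s.foldr (fun r ls => [r] :: ls) [] = s.map fun r => [r] := by
    clear this h hf hs hN hb ht
    induction s <;> simp_all
  rw [he] at this
  obtain ⟨t₁, ht₁, h₁⟩ := this
  rw [List.length_map] at ht
  have hfin : t + t₁ + 30 ≤ sortTime κ N := by
    have hc : Nat.clog 2 s.length ≤ Nat.clog 2 N := Nat.clog_mono_right 2 hN
    have ht' : t ≤ (Nat.clog 2 N + 1) * (500 * (κ + 1) * (2 * (N + 1))) := by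
      refine ht.trans ?_
      gcongr
      omega
    have h₂ : (N + 1) ≤ (κ + 1) * ((N + 1) * (Nat.clog 2 N + 1)) := by
      calc N + 1 = 1 * ((N + 1) * 1) := by ring
        _ ≤ _ := by gcongr <;> omega
    have h₃ : (Nat.clog 2 N + 1) * (500 * (κ + 1) * (2 * (N + 1))) =
      1000 * ((κ + 1) * ((N + 1) * (Nat.clog 2 N + 1))) := by ring
    rw [sortTime, mul_assoc]
    omega
  refine Computes.mono ?_ hfin
  rw [Computes, app_of_getElem? hb]
  rw [sortItems]
  simp [h, h₁]
  omega

end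

/-! ### Components with support in a single coordinate -/

section Spike
variable {d : ℕ} {Q : Set (Fin d → ℕ)} {q : Fin d → ℕ}

/-- The point `q` lies above a minimum `a`, from which it differs in coordinate `i` only, and
above other minima, none of which differs from it in coordinate `i`. -/
structure IsSpike (Q : Set (Fin d → ℕ)) (i : Fin d) (a q : Fin d → ℕ) : Prop where
  mem : a ∈ minima Q
  lt : a i < q i
  eq : ∀ l, l ≠ i → a l = q l
  exists_ne : ∃ b ∈ minima Q, b ≤ q ∧ b ≠ a
  eq_of_ne : ∀ b ∈ minima Q, b ≤ q → b ≠ a → b i = q i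

theorem minima_eq_of_le {a b : Fin d → ℕ} (ha : a ∈ minima Q) (hb : b ∈ minima Q) (h : a ≤ b) :
    a = b :=
  hb.eq_of_le ha.prop h

theorem IsSpike.le {i : Fin d} {a : Fin d → ℕ} (h : IsSpike Q i a q) : a ≤ q := by
  intro l
  by_cases hl : l = i
  · exact hl ▸ h.lt.le
  · exact (h.eq l hl).le

theorem IsSpike.lt' {i : Fin d} {a : Fin d → ℕ} (h : IsSpike Q i a q) : a < q :=
  lt_of_le_of_ne h.le fun he => h.lt.ne (congrFun he i)

theorem IsSpike.le_sup {i : Fin d} {a b : Fin d → ℕ} (h : IsSpike Q i a q) (hb : b ∈ minima Q)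
    (hbq : b ≤ q) (hne : b ≠ a) : q ≤ b ⊔ a := by
  intro l
  by_cases hl : l = i
  · rw [hl]
    exact (h.eq_of_ne b hb hbq hne).ge.trans le_sup_left
  · exact (h.eq l hl).ge.trans le_sup_right

/-- This makes `q` a function of `a` and `i`: the value `v` is the least `b i` over the competing
minima `b`. It bounds the number of spikes and turns finding them into a dominance query. -/
theorem isSpike_iff {i : Fin d} {a : Fin d → ℕ} : IsSpike Q i a q ↔
    a ∈ minima Q ∧ ∃ v, q = Function.update a i v ∧
      (∃ b ∈ minima Q, b ≠ a ∧ (∀ l, l ≠ i → b l ≤ a l) ∧ b i = v) ∧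
      ∀ b ∈ minima Q, b ≠ a → (∀ l, l ≠ i → b l ≤ a l) → v ≤ b i := by
  constructor
  · intro h
    refine ⟨h.mem, q i, ?_, ?_, ?_⟩
    · ext l
      by_cases hl : l = i
      · simp [hl]
      · simp [hl, h.eq l hl]
    · obtain ⟨b, hb, hbq, hba⟩ := h.exists_ne
      exact ⟨b, hb, hba, fun l hl => (hbq l).trans (h.eq l hl).ge, h.eq_of_ne b hb hbq hba⟩
    · intro b hb hba hl
      by_contra! hlt
      refine hlt.ne (h.eq_of_ne b hb (fun l => ?_) hba)
      by_cases hli : l = i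
      · exact hli ▸ hlt.le
      · exact (hl l hli).trans (h.eq l hli).le
  · rintro ⟨ha, v, rfl, ⟨b, hb, hba, hl, rfl⟩, hv⟩
    have hle : ∀ c : Fin d → ℕ, c ≤ Function.update a i (b i) ↔
        (∀ l, l ≠ i → c l ≤ a l) ∧ c i ≤ b i := by
      intro c
      rw [le_update_iff]
      exact and_comm
    refine ⟨ha, ?_, fun l hl => by simp [hl], ⟨b, hb, (hle b).2 ⟨hl, le_rfl⟩, hba⟩, ?_⟩
    -- Otherwise `b ≤ a` in every coordinate, and distinct minima are incomparable.
    · simp only [Function.update_self]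
      by_contra! h
      refine hba (minima_eq_of_le hb ha fun l => ?_)
      by_cases hli : l = i
      · exact hli ▸ h
      · exact hl l hli
    · intro c hc hcq hca
      rw [hle] at hcq
      simpa using le_antisymm hcq.2 (hv c hc hca hcq.1)

/-- Here the combinatorics uses small dimension: three distinct coordinates are all of them. -/
theorem fin_eq_or (hd : d ≤ 3) {i j k : Fin d} (hij : i ≠ j) (hik : i ≠ k) (hjk : j ≠ k)
    (l : Fin d) : l = i ∨ l = j ∨ l = k := by
  simp only [Fin.ext_iff, ne_eq] at *
  omega

/-- The join of `m` and `n` remains below `q` in coordinate `k`. So different components have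
disjoint supports. -/
theorem linked_of_apply_lt (hQ : Q.OrdConnected) (hq : q ∈ Q) {m n : Fin d → ℕ}
    (hm : m ∈ minima Q) (hn : n ∈ minima Q) (hmq : m ≤ q) (hnq : n ≤ q) {k : Fin d}
    (hmk : m k < q k) (hnk : n k < q k) : Linked (openDownset Q q) m n := by
  refine linked_of_not_le_sup hQ hq hm.prop hn.prop
    (lt_of_le_of_ne hmq fun h => hmk.ne (congrFun h k))
    (lt_of_le_of_ne hnq fun h => hnk.ne (congrFun h k)) fun h => ?_
  exact (sup_lt_iff.2 ⟨hmk, hnk⟩).not_ge (h k)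

theorem exists_apply_lt {m : Fin d → ℕ} (h : m < q) : ∃ k, m k < q k := by
  by_contra! h'
  exact h.not_ge h'

/-- Either `m` or `n` turns out to be a spike. If `m` is not, its component contains a minimum `b`
with at least two coordinates in its support, which confines `n` to the third one; if `n` is not a
spike either, its component in turn contains a minimum with two support coordinates, one of them
shared with `b`. -/
theorem exists_isSpike_of_singleton (hd : d ≤ 3) (hQ : Q.OrdConnected) (hq : q ∈ Q)
    {m n : Fin d → ℕ} (hm : m ∈ minima Q) (hn : n ∈ minima Q) (hmq : m < q) (hnq : n < q)
    (hmn : ¬ Linked (openDownset Q q) m n) {i : Fin d} (hmi : ∀ l, l ≠ i → m l = q l) :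
    ∃ i a, IsSpike Q i a q := by
  have hlt : m i < q i := by
    obtain ⟨k, hk⟩ := exists_apply_lt hmq
    by_cases hki : k = i
    · exact hki ▸ hk
    · exact absurd (hmi k hki) hk.ne
  -- When `a` differs from `q` only in coordinate `k` and is no spike, another minimum `b` is
  -- smaller than `q` there. If `b` agreed with `q` elsewhere, `a` and `b` would be comparable.
  have key : ∀ k : Fin d, ∀ a ∈ minima Q, a k < q k → (∀ l, l ≠ k → a l = q l) →
      (∃ b ∈ minima Q, b ≤ q ∧ b ≠ a) → (¬ ∃ i a, IsSpike Q i a q) →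
      ∃ b ∈ minima Q, b ≤ q ∧ b ≠ a ∧ b k < q k ∧ ∃ l, l ≠ k ∧ b l < q l := by
    intro k a ha hlt hk hex hno
    by_contra! hcon
    refine hno ⟨k, a, ha, hlt, hk, hex, fun b hb hbq hba => ?_⟩
    by_contra hne
    have hge := hcon b hb hbq hba (lt_of_le_of_ne (hbq k) hne)
    obtain hle | hle := le_total (a k) (b k)
    · refine hba (minima_eq_of_le ha hb fun l => ?_).symm
      by_cases hl : l = k
      · exact hl ▸ hle
      · exact (hk l hl).trans_le (hge l hl)
    · refine hba (minima_eq_of_le hb ha fun l => ?_)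
      by_cases hl : l = k
      · exact hl ▸ hle
      · exact (hbq l).trans (hk l hl).ge
  by_contra hno
  have hnm : n ≠ m := fun h => hmn (h ▸ Linked.refl)
  obtain ⟨b, hb, hbq, hbm, hbi, l, hli, hbl⟩ := key i m hm hlt hmi ⟨n, hn, hnq.le, hnm⟩ hno
  have hmb : Linked (openDownset Q q) m b := linked_of_apply_lt hQ hq hm hb hmq.le hbq hlt hbi
  -- As `b` is linked to `m` and `n` is not, `n` agrees with `q` on the support of `b`.
  have hne : ∀ k, b k < q k → n k = q k := fun k hk => by
    by_contra h
    exact hmn (hmb.trans (linked_of_apply_lt hQ hq hb hn hbq hnq.le hk (lt_of_le_of_ne (hnq.le k) h)))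
  obtain ⟨k, hk⟩ := exists_apply_lt hnq
  have hki : k ≠ i := fun h => hk.ne (h ▸ hne i hbi)
  have hkl : k ≠ l := fun h => hk.ne (h ▸ hne l hbl)
  have hall := fin_eq_or hd hki.symm hli.symm hkl
  obtain ⟨c, hc, hcq, hcn, hck, l', hl', hcl⟩ := key k n hn hk (fun l' hl' => by
    obtain rfl | rfl | rfl := hall l'
    · exact hne _ hbi
    · exact absurd rfl hl'
    · exact hne _ hbl) ⟨m, hm, hmq.le, hnm.symm⟩ hno
  have hcb : Linked (openDownset Q q) b c := by
    obtain rfl | rfl | rfl := hall l'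
    · exact linked_of_apply_lt hQ hq hb hc hbq hcq hbi hcl
    · exact absurd rfl hl'
    · exact linked_of_apply_lt hQ hq hb hc hbq hcq hbl hcl
  exact hmn (hmb.trans (hcb.trans (linked_of_apply_lt hQ hq hc hn hcq hnq.le hck hk)))

/-- Two unlinked minima have disjoint nonempty supports; in at most three coordinates one of these
is a singleton. -/
theorem exists_isSpike (hd : d ≤ 3) (hQ : Q.OrdConnected) (hq : q ∈ initialHull Q)
    (hqm : q ∉ minima Q) : ∃ i a, IsSpike Q i a q := by
  obtain ⟨m, hm, n, hn, hmq, hnq, hmn⟩ := exists_not_linked (fun x => exists_minima_le Q) hq hqm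
  obtain ⟨i, hi⟩ := exists_apply_lt hmq
  obtain ⟨j, hj⟩ := exists_apply_lt hnq
  have hor : ∀ k, m k = q k ∨ n k = q k := fun k => by
    by_contra! h
    exact hmn (linked_of_apply_lt hQ hq.1 hm hn hmq.le hnq.le
      (lt_of_le_of_ne (hmq.le k) h.1) (lt_of_le_of_ne (hnq.le k) h.2))
  by_cases h : ∀ l, l ≠ i → m l = q l
  · exact exists_isSpike_of_singleton hd hQ hq.1 hm hn hmq hnq hmn h
  · push Not at h
    obtain ⟨l, hli, hl⟩ := h
    have hij : i ≠ j := fun h => (hor i).elim hi.ne (h ▸ hj.ne)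
    have hlj : l ≠ j := fun h => (hor l).elim hl (h ▸ hj.ne)
    refine exists_isSpike_of_singleton hd hQ hq.1 hn hm hnq hmq (fun h => hmn h.symm) (i := j) ?_
    intro l' hl'
    obtain rfl | rfl | rfl := fin_eq_or hd hij hli.symm hlj.symm l'
    · exact (hor _).resolve_left hi.ne
    · exact absurd rfl hl'
    · exact (hor _).resolve_left hl

/-- The representatives of the components that are given by the minima `as` of the components with
support in a single coordinate and by some other minimum `b`. -/
def complete (b : Fin d → ℕ) : List (Fin d → ℕ) → List (Fin d → ℕ)
  | [a] => [b, a]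
  | as => as

/-- With a single spike `a` in direction `i`, the remaining minima below `q` live in the other two
coordinates, and splitting them into two components would create another spike. With two spikes,
only one coordinate remains for any other minimum, which must then be a spike too. -/
theorem represent_complete (hd : d ≤ 3) (hQ : Q.OrdConnected) (hq : q ∈ Q) {b : Fin d → ℕ}
    {as : List (Fin d → ℕ)} (has : ∀ a, a ∈ as ↔ ∃ i, IsSpike Q i a q) (hnd : as.Nodup)
    (hne : as ≠ []) (hb : b ∈ minima Q) (hbq : b ≤ q) (hba : ∀ a, as = [a] → b ≠ a) :
    2 ≤ (complete b as).length ∧ Represent Q q (complete b as) := by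
  match as, hne with
  | [a], _ =>
    refine ⟨le_rfl, ?_⟩
    obtain ⟨i, hi⟩ := (has a).1 (by simp)
    have hbne := hba a rfl
    have hbi := hi.eq_of_ne b hb hbq hbne
    have hblt : b < q := lt_of_le_of_ne hbq fun h => by
      have := minima_eq_of_le hi.mem hb (h ▸ hi.le)
      exact hbne this.symm
    -- The minima other than `a` share the `i`-th coordinate of `q`, so the point with this
    -- coordinate and zeros elsewhere bounds them from below. Its join with `a` is `q`.
    have : Represent Q q ([(b, Function.update (0 : Fin d → ℕ) i (q i)), (a, a)].map Prod.fst) := by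
      refine .of_lowerBounds (fun x => exists_minima_le Q) ?_ ?_ ?_
      · simp only [List.mem_cons, List.not_mem_nil, or_false, forall_eq_or_imp, forall_eq]
        refine ⟨⟨hb, hblt, ?_⟩, hi.mem, hi.lt', le_rfl⟩
        rw [update_le_iff]
        exact ⟨hbi.ge, fun _ _ => Nat.zero_le _⟩
      · simp only [List.pairwise_cons, List.mem_cons, List.not_mem_nil, or_false, forall_eq,
          false_imp_iff, implies_true, List.Pairwise.nil, and_true]
        intro l
        by_cases hl : l = i
        · subst hl
          simp
        · simp [hl, hi.eq l hl]
      · intro m hm hmq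
        by_cases hma : m = a
        · exact ⟨(a, a), by simp, hma.ge, hma ▸ Linked.refl⟩
        · have hmi := hi.eq_of_ne m hm hmq.le hma
          refine ⟨(b, Function.update (0 : Fin d → ℕ) i (q i)), by simp, ?_, ?_⟩
          · rw [update_le_iff]
            exact ⟨hmi.ge, fun _ _ => Nat.zero_le _⟩
          -- In different components, `m` and `b` have disjoint supports avoiding `i`, hence one
          -- coordinate each; this would make `m` a second spike.
          by_contra hmb
          obtain ⟨j, hj⟩ := exists_apply_lt hmq
          obtain ⟨k, hk⟩ := exists_apply_lt hblt
          have hor : ∀ k, m k = q k ∨ b k = q k := fun k => by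
            by_contra! h
            exact hmb (linked_of_apply_lt hQ hq hm hb hmq.le hbq
              (lt_of_le_of_ne (hmq.le k) h.1) (lt_of_le_of_ne (hbq k) h.2))
          have hji : j ≠ i := fun h => hj.ne (h ▸ hmi)
          have hki : k ≠ i := fun h => hk.ne (h ▸ hbi)
          have hjk : j ≠ k := fun h => (hor j).elim hj.ne (h ▸ hk.ne)
          have hall := fin_eq_or hd hji.symm hki.symm hjk
          refine hma (List.mem_singleton.1 ((has m).2 ⟨j, hm, hj, ?_, ⟨b, hb, hbq, ?_⟩, ?_⟩))
          · intro l hl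
            obtain rfl | rfl | rfl := hall l
            · exact hmi
            · exact absurd rfl hl
            · exact (hor _).resolve_right hk.ne
          · exact fun h => hmb (h ▸ Linked.refl)
          · intro c hc hcq hcm
            by_contra hcj
            replace hcj : c j < q j := lt_of_le_of_ne (hcq j) hcj
            have hca : c ≠ a := fun h => hcj.ne (h ▸ hi.eq j hji)
            have hmc := linked_of_apply_lt hQ hq hm hc hmq.le hcq hj hcj
            by_cases hck : c k = q k
            · obtain hle | hle := le_total (m j) (c j)
              · refine hcm (minima_eq_of_le hm hc fun l => ?_).symm
                obtain rfl | rfl | rfl := hall l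
                · rw [hi.eq_of_ne c hc hcq hca, hmi]
                · exact hle
                · exact hck ▸ hmq.le _
              · refine hcm (minima_eq_of_le hc hm fun l => ?_)
                obtain rfl | rfl | rfl := hall l
                · rw [hi.eq_of_ne c hc hcq hca, hmi]
                · exact hle
                · rw [(hor _).resolve_right hk.ne]
                  exact hcq _
            · exact hmb (hmc.trans (linked_of_apply_lt hQ hq hc hb hcq hbq
                (lt_of_le_of_ne (hcq k) hck) hk))
    exact this
  | a :: a' :: as, _ =>
    refine ⟨by simp [complete], ?_⟩
    obtain ⟨i, hi⟩ := (has a).1 (by simp)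
    obtain ⟨i', hi'⟩ := (has a').1 (by simp)
    have haa : a' ≠ a := by
      rintro rfl
      simp at hnd
    have hii : i ≠ i' := by
      rintro rfl
      exact hi'.lt.ne (hi.eq_of_ne a' hi'.mem hi'.le haa)
    -- The catch-all equation carries the side condition that the list is not a singleton.
    rw [complete]
    swap
    · simp
    set as' := a :: a' :: as
    have : Represent Q q ((as'.map fun a => (a, a)).map Prod.fst) := by
      refine .of_lowerBounds (fun x => exists_minima_le Q) ?_ ?_ ?_
      · intro e he
        obtain ⟨c, hc, rfl⟩ := List.mem_map.1 he
        obtain ⟨k, hk⟩ := (has c).1 hc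
        exact ⟨hk.mem, hk.lt', le_rfl⟩
      · rw [List.pairwise_map]
        refine hnd.imp_of_mem fun {c c'} hc hc' hne => ?_
        obtain ⟨k, hk⟩ := (has c).1 hc
        obtain ⟨k', hk'⟩ := (has c').1 hc'
        exact hk'.le_sup hk.mem hk.le hne
      · intro m hm hmq
        -- A minimum other than `a` and `a'` agrees with `q` in the directions of both, so its
        -- support is the third coordinate.
        suffices h : m ∈ as' from ⟨(m, m), List.mem_map_of_mem h, le_rfl, .refl⟩
        by_contra hmas
        have hma : m ≠ a := fun h => hmas (by simp [as', h])
        have hma' : m ≠ a' := fun h => hmas (by simp [as', h])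
        obtain ⟨k, hk⟩ := exists_apply_lt hmq
        have hmi := hi.eq_of_ne m hm hmq.le hma
        have hmi' := hi'.eq_of_ne m hm hmq.le hma'
        have hki : k ≠ i := fun h => hk.ne (h ▸ hmi)
        have hki' : k ≠ i' := fun h => hk.ne (h ▸ hmi')
        have hall := fin_eq_or hd hii hki.symm hki'.symm
        refine hmas ((has m).2 ⟨k, hm, hk, ?_, ⟨a, hi.mem, hi.le, hma.symm⟩, ?_⟩)
        · intro l hl
          obtain rfl | rfl | rfl := hall l
          · exact hmi
          · exact hmi'
          · exact absurd rfl hl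
        · intro c hc hcq hcm
          by_cases hca : c = a
          · exact hca ▸ hi.eq k hki
          by_cases hca' : c = a'
          · exact hca' ▸ hi'.eq k hki'
          have hci := hi.eq_of_ne c hc hcq hca
          have hci' := hi'.eq_of_ne c hc hcq hca'
          by_contra hck
          obtain hle | hle := le_total (m k) (c k)
          · refine hcm (minima_eq_of_le hm hc fun l => ?_).symm
            obtain rfl | rfl | rfl := hall l
            · rw [hci, hmi]
            · rw [hci', hmi']
            · exact hle
          · refine hcm (minima_eq_of_le hc hm fun l => ?_)
            obtain rfl | rfl | rfl := hall l
            · rw [hci, hmi]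
            · rw [hci', hmi']
            · exact hle
    simpa [Function.comp_def] using this

/-- Distinct spikes at `q` have distinct directions, since each agrees with `q` in the direction of
the other. -/
theorem length_le_of_pairwise {as : List (Fin d → ℕ)} (has : ∀ a ∈ as, ∃ i, IsSpike Q i a q)
    (hnd : as.Nodup) : as.length ≤ d := by
  by_cases hne : as = []
  · simp [hne]
  obtain ⟨a, ha⟩ := List.exists_mem_of_ne_nil as hne
  have : Nonempty (Fin d) := ⟨(has a ha).choose⟩
  choose! f hf using has
  have : (as.map f).Nodup := by
    refine (List.nodup_map_iff_inj_on hnd).2 fun a ha b hb h => ?_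
    by_contra hab
    have := (hf a ha).eq_of_ne b (hf b hb).mem (hf b hb).le (Ne.symm hab)
    rw [h] at this
    exact (hf b hb).lt.ne this
  simpa using this.length_le_card

end Spike

/-! ### Finding the spikes -/

/-- Sort by the outer keys, and then sweep by the inner keys. -/
noncomputable def sweepItems {β γ γ' : Type*} (s : List (Item (Item β γ) γ')) :
    List (Item β γ) :=
  sortItems ((sortItems s).map Item.pay)

theorem key_singleton_le {x y : ℤ} : [x] ≤ [y] ↔ x ≤ y := by
  rw [key_cons_le_cons, le_iff_lt_or_eq (a := x)]
  simp

/-- A choice of a coordinate `i` and of the other coordinates `j` and `k`. -/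
structure Frame (d : ℕ) where
  i : Fin d
  j : Fin d
  k : Fin d

/-- The coordinates different from `i` are `j` and `k`. -/
def Frame.Valid {d : ℕ} (t : Frame d) : Prop := ∀ l, l ≠ t.i ↔ l = t.j ∨ l = t.k

section
variable {d : ℕ} {Q : Set (Fin d → ℕ)} {M : List (Fin d → ℕ)} {t : Frame d}

theorem Frame.Valid.forall_ne (ht : t.Valid) {p : Fin d → Prop} :
    (∀ l, l ≠ t.i → p l) ↔ p t.j ∧ p t.k := by
  simp only [ht _, forall_eq_or_imp, forall_eq]

theorem Frame.Valid.le_iff {α : Type*} [Preorder α] (ht : t.Valid) {x y : Fin d → α} :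
    x ≤ y ↔ x t.i ≤ y t.i ∧ x t.j ≤ y t.j ∧ x t.k ≤ y t.k := by
  rw [← ht.forall_ne (p := fun l => x l ≤ y l)]
  refine ⟨fun h => ⟨h _, fun l _ => h l⟩, fun h l => ?_⟩
  by_cases hl : l = t.i
  · exact hl ▸ h.1
  · exact h.2 l hl

/-- The key for the first sorting. -/
def Frame.key (t : Frame d) (a : Fin d → ℕ) : List ℤ := [(a t.j : ℤ), (a t.k : ℤ)]

/-- The item that represents a minimum. -/
def minItem (t : Frame d) (a : Fin d → ℕ) :
    Item (Item (Fin d → ℕ) (Fin d → ℕ)) (Fin d → ℕ) where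
  key := t.key a
  val := none
  ans := none
  pay := { key := [(a t.k : ℤ)], val := some ((a t.i : ℤ), a), ans := none, pay := a }

theorem Frame.key_lt_iff {a b : Fin d → ℕ} :
    t.key b < t.key a ↔ b t.j < a t.j ∨ b t.j = a t.j ∧ b t.k < a t.k := by
  simp [Frame.key, List.cons_lt_cons_iff]

/-- Being strictly earlier in lexicographic order, together with the comparison at `k`, expresses
weak dominance in `j` and `k`. Ties are harmless because minima that agree in both coordinates are
comparable, hence equal. -/
theorem Frame.Valid.key_lt_and_iff (ht : t.Valid) {a b : Fin d → ℕ} (ha : a ∈ minima Q)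
    (hb : b ∈ minima Q) : t.key b < t.key a ∧ [(b t.k : ℤ)] ≤ [(a t.k : ℤ)] ↔
      b ≠ a ∧ ∀ l, l ≠ t.i → b l ≤ a l := by
  rw [ht.forall_ne, Frame.key_lt_iff, key_singleton_le, Nat.cast_le]
  constructor
  · rintro ⟨h | h, h'⟩
    · exact ⟨fun he => h.ne (he ▸ rfl), h.le, h'⟩
    · exact ⟨fun he => h.2.ne (he ▸ rfl), h.1.le, h'⟩
  · rintro ⟨hne, hj, hk⟩
    refine ⟨?_, hk⟩
    by_contra! h
    have hj' : b t.j = a t.j := le_antisymm hj h.1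
    have hk' : b t.k = a t.k := le_antisymm hk (h.2 hj')
    obtain hi | hi := le_total (b t.i) (a t.i)
    · exact hne (minima_eq_of_le hb ha (ht.le_iff.2 ⟨hi, hj, hk⟩))
    · exact hne (minima_eq_of_le ha hb (ht.le_iff.2 ⟨hi, hj'.ge, hk'.ge⟩)).symm

/-- Distinct minima have distinct keys, so after the first sort position encodes the strict order of
`t.key`; the second sort, by coordinate `t.k`, finds for each minimum the least `t.i`-coordinate
among its competitors. -/
theorem sweepItems_minItem (ht : t.Valid) (hM : Enumerates M (minima Q)) :
    ((sweepItems (M.map (minItem t))).map Item.pay).Perm M ∧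
    ∀ r ∈ sweepItems (M.map (minItem t)), r.pay ∈ minima Q ∧
      IsBest r.ans {p | ∃ b ∈ minima Q, p = ((b t.i : ℤ), b) ∧ b ≠ r.pay ∧
        ∀ l, l ≠ t.i → b l ≤ r.pay l} := by
  obtain ⟨hc, hs⟩ := sortItems_perm_sorted (M.map (minItem t))
  set s := sortItems (M.map (minItem t)) with hsdef
  have hmem : ∀ x ∈ s, ∃ a ∈ minima Q, x.key = t.key a ∧ x.pay = (minItem t a).pay := by
    intro x hx
    obtain ⟨y, hy, he⟩ := List.mem_map.1 (hc.subset (List.mem_map_of_mem hx))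
    obtain ⟨a, ha, rfl⟩ := List.mem_map.1 hy
    simp only [Item.core, Prod.mk.injEq] at he
    exact ⟨a, (hM.2 a).1 ha, he.1.symm, he.2.2.symm⟩
  have hpay : (s.map Item.pay).Perm (M.map fun a => (minItem t a).pay) := by
    have := hc.map fun c => c.2.2
    simpa [Function.comp_def, Item.core] using this
  have hpay' : ((s.map Item.pay).map Item.pay).Perm M := by
    simpa [Function.comp_def, minItem] using hpay.map Item.pay
  have hnd : (s.map fun x => x.pay.pay).Nodup := by
    rw [List.map_map] at hpay'
    exact hpay'.nodup_iff.2 hM.1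
  have hsw := swept_sortItems (W := fun _ => True) (Pre := fun b a => t.key b < t.key a)
    (s := s.map Item.pay) (by
      rw [List.pairwise_map]
      refine (hs.and (List.pairwise_map.1 hnd)).imp_of_mem fun {x y} hx hy h => ?_
      obtain ⟨a, ha, hxk, hxp⟩ := hmem x hx
      obtain ⟨b, hb, hyk, hyp⟩ := hmem y hy
      rw [hxk, hyk, hxp, hyp] at h
      rw [hxp, hyp]
      refine ⟨fun _ _ => lt_of_le_of_ne h.1 fun he => h.2 ?_, fun _ _ => h.1.not_gt⟩
      simp only [Frame.key, List.cons.injEq, Nat.cast_inj, and_true] at he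
      obtain hi | hi := le_total (a t.i) (b t.i)
      · exact minima_eq_of_le ha hb (ht.le_iff.2 ⟨hi, he.1.le, he.2.le⟩)
      · exact (minima_eq_of_le hb ha (ht.le_iff.2 ⟨hi, he.1.ge, he.2.ge⟩)).symm)
    (by
      intro r hr _
      obtain ⟨x, hx, rfl⟩ := List.mem_map.1 hr
      obtain ⟨a, ha, hxk, hxp⟩ := hmem x hx
      rw [hxp]
      exact ⟨rfl, fun _ => lt_irrefl _⟩)
  have hperm : ((sweepItems (M.map (minItem t))).map Item.pay).Perm M := by
    have := hsw.core.map fun c => c.2.2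
    simp only [List.map_map] at this hpay'
    exact this.trans hpay'
  refine ⟨hperm, fun r hr => ?_⟩
  have hra : r.pay ∈ minima Q :=
    (hM.2 _).1 (hperm.subset (List.mem_map_of_mem hr))
  refine ⟨hra, ?_⟩
  convert hsw.ans r hr trivial using 1
  obtain ⟨r', hr', hk, -, hp⟩ := hsw.exists_core hr
  obtain ⟨x', hx', rfl⟩ := List.mem_map.1 hr'
  obtain ⟨a', ha', -, hxp'⟩ := hmem x' hx'
  have hrk : r.key = [((r.pay t.k : ℕ) : ℤ)] := by
    rw [← hk, ← hp, hxp']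
    rfl
  ext p
  constructor
  · rintro ⟨b, hb, rfl, hbr⟩
    obtain ⟨l, hl, hlb⟩ := List.mem_map.1 (hpay.symm.subset
      (List.mem_map_of_mem (f := fun a => (minItem t a).pay) ((hM.2 b).2 hb)))
    refine ⟨_, List.mem_map_of_mem hl, ?_⟩
    rw [hlb, hrk]
    exact ⟨rfl, (ht.key_lt_and_iff hra hb).2 hbr⟩
  · rintro ⟨l, hl, hlv, hlt⟩
    obtain ⟨x, hx, rfl⟩ := List.mem_map.1 hl
    obtain ⟨b, hb, -, hxp⟩ := hmem x hx
    rw [hxp, hrk] at hlt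
    rw [hxp] at hlv
    refine ⟨b, hb, (Option.some_injective _ hlv).symm, (ht.key_lt_and_iff hra hb).1 hlt⟩

/-- A point above two minima `a` and `b`, given as a triple. -/
abbrev Cand (d : ℕ) := (Fin d → ℕ) × (Fin d → ℕ) × (Fin d → ℕ)

/-- Add the candidate that is given by an item with its answer. -/
def candStep (r : Item (Fin d → ℕ) (Fin d → ℕ)) (acc : List (Cand d)) : List (Cand d) :=
  match r.ans with
  | none => acc
  | some p => (r.pay ⊔ p.2, r.pay, p.2) :: acc

/-- All candidates. -/
noncomputable def cands (M : List (Fin d → ℕ)) (F : List (Frame d)) : List (Cand d) :=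
  F.foldr (fun t acc => (sweepItems (M.map (minItem t))).foldr candStep acc) []

/-- A candidate that is a spike. -/
def IsCand (Q : Set (Fin d → ℕ)) (i : Fin d) (c : Cand d) : Prop :=
  IsSpike Q i c.2.1 c.1 ∧ c.2.2 ∈ minima Q ∧ c.2.2 ≠ c.2.1 ∧ c.2.2 ≤ c.1

theorem foldr_candStep (s : List (Item (Fin d → ℕ) (Fin d → ℕ))) (acc : List (Cand d)) :
    s.foldr candStep acc = s.foldr candStep [] ++ acc := by
  induction s with
  | nil => rfl
  | cons r s ih =>
    rw [List.foldr_cons, List.foldr_cons, ih]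
    unfold candStep
    cases r.ans <;> rfl

theorem mem_foldr_candStep {s : List (Item (Fin d → ℕ) (Fin d → ℕ))} {c : Cand d} :
    c ∈ s.foldr candStep [] ↔ ∃ r ∈ s, ∃ p, r.ans = some p ∧ c = (r.pay ⊔ p.2, r.pay, p.2) := by
  induction s with
  | nil => simp
  | cons r s ih =>
    simp only [List.foldr_cons, List.mem_cons, exists_eq_or_imp, ← ih]
    generalize s.foldr candStep [] = acc
    unfold candStep
    cases h : r.ans <;> simp

theorem foldr_candStep_sublist (s : List (Item (Fin d → ℕ) (Fin d → ℕ))) :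
    ((s.foldr candStep []).map fun c => c.2.1).Sublist (s.map Item.pay) := by
  induction s with
  | nil => exact .slnil
  | cons r s ih =>
    simp only [List.foldr_cons, List.map_cons]
    generalize s.foldr candStep [] = acc at *
    unfold candStep
    cases h : r.ans
    · exact ih.cons _
    · exact ih.cons_cons _

/-- The best value is the `v` of `isSpike_iff`. It exceeds `a t.i`, as otherwise `b ≤ a`, so joining
`a` with `b` amounts to raising that one coordinate. -/
theorem isCand_of_isBest {a : Fin d → ℕ} (ha : a ∈ minima Q)
    {p : ℤ × (Fin d → ℕ)}
    (hp : IsBest (some p) {p | ∃ b ∈ minima Q, p = ((b t.i : ℤ), b) ∧ b ≠ a ∧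
        ∀ l, l ≠ t.i → b l ≤ a l}) : IsCand Q t.i (a ⊔ p.2, a, p.2) := by
  obtain ⟨b, hb, rfl, hba, hl⟩ := hp.1 p rfl
  have hai : a t.i ≤ b t.i := by
    by_contra! h
    refine hba (minima_eq_of_le hb ha fun l => ?_)
    by_cases hli : l = t.i
    · exact hli ▸ h.le
    · exact hl l hli
  refine ⟨isSpike_iff.2 ⟨ha, b t.i, ?_, ⟨b, hb, hba, hl, rfl⟩, fun c hc hca hcl => ?_⟩, hb, hba,
    le_sup_right⟩
  · ext l
    by_cases hli : l = t.i
    · subst hli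
      simp [hai]
    · simp [hli, hl l hli]
  · obtain ⟨q, hq, hle⟩ := hp.2 _ ⟨c, hc, rfl, hca, hcl⟩
    obtain rfl := Option.some_injective _ hq
    exact Nat.cast_le.1 hle

theorem IsSpike.unique {i : Fin d} {a q q' : Fin d → ℕ} (h : IsSpike Q i a q)
    (h' : IsSpike Q i a q') : q = q' := by
  obtain ⟨-, v, rfl, ⟨b, hb, hba, hbl, rfl⟩, hv⟩ := isSpike_iff.1 h
  obtain ⟨-, v', rfl, ⟨b', hb', hba', hbl', rfl⟩, hv'⟩ := isSpike_iff.1 h'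
  rw [le_antisymm (hv b' hb' hba' hbl') (hv' b hb hba hbl)]

/-- No pair of a point and a spike below it is repeated: within a frame each minimum yields at most
one candidate, and the unique coordinate in which `a` and `q` differ determines the frame. -/
theorem cands_spec (hM : Enumerates M (minima Q)) {F : List (Frame d)}
    (hF : ∀ t ∈ F, t.Valid) (hnd : (F.map Frame.i).Nodup) :
    (∀ c ∈ cands M F, ∃ t ∈ F, IsCand Q t.i c) ∧
    (∀ t ∈ F, ∀ a q, IsSpike Q t.i a q → ∃ b, (q, a, b) ∈ cands M F) ∧
    (cands M F).Pairwise fun c c' => c.1 = c'.1 → c.2.1 ≠ c'.2.1 := by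
  induction F with
  | nil => simp [cands]
  | cons t F ih =>
    obtain ⟨h₁, h₂, h₃⟩ := ih (fun t ht => hF t (List.mem_cons_of_mem _ ht)) hnd.of_cons
    have ht := hF t (by simp)
    obtain ⟨hp, hb⟩ := sweepItems_minItem ht hM
    have he : cands M (t :: F) =
      (sweepItems (M.map (minItem t))).foldr candStep [] ++ cands M F := foldr_candStep _ _
    rw [he]
    generalize sweepItems (M.map (minItem t)) = s at *
    have hnew : ∀ c ∈ s.foldr candStep [], IsCand Q t.i c := by
      intro c hc
      obtain ⟨r, hr, p, hrp, rfl⟩ := mem_foldr_candStep.1 hc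
      obtain ⟨hra, hbest⟩ := hb r hr
      exact isCand_of_isBest hra (hrp ▸ hbest)
    refine ⟨?_, ?_, ?_⟩
    · intro c hc
      obtain hc | hc := List.mem_append.1 hc
      · exact ⟨t, by simp, hnew c hc⟩
      · obtain ⟨t', ht', h⟩ := h₁ c hc
        exact ⟨t', List.mem_cons_of_mem _ ht', h⟩
    · intro t' ht' a q hq
      obtain rfl | ht' := List.mem_cons.1 ht'
      · obtain ⟨r, hr, rfl⟩ := List.mem_map.1 (hp.symm.subset ((hM.2 a).2 hq.mem))
        obtain ⟨hra, hbest⟩ := hb r hr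
        obtain ⟨b, hbm, hbq, hba⟩ := hq.exists_ne
        obtain ⟨p, hrp, -⟩ := hbest.2 _ ⟨b, hbm, rfl, hba, fun l hl =>
          (hbq l).trans (hq.eq l hl).ge⟩
        have hc := isCand_of_isBest hra (hrp ▸ hbest)
        refine ⟨p.2, List.mem_append_left _ (mem_foldr_candStep.2 ⟨r, hr, p, hrp, ?_⟩)⟩
        rw [hq.unique hc.1]
      · obtain ⟨b, h⟩ := h₂ t' ht' a q hq
        exact ⟨b, List.mem_append_right _ h⟩
    · refine List.pairwise_append.2 ⟨?_, h₃, ?_⟩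
      · have : ((s.foldr candStep []).map fun c => c.2.1).Nodup :=
          (foldr_candStep_sublist s).nodup (hp.nodup_iff.2 hM.1)
        exact (List.pairwise_map.1 this).imp fun {c c'} h (_ : c.1 = c'.1) => h
      · rintro ⟨q, a, b⟩ hc ⟨q', a', b'⟩ hc' (rfl : q = q') (rfl : a = a')
        obtain ⟨t', ht', h⟩ := h₁ _ hc'
        have h' := hnew _ hc
        have hne : t'.i ≠ t.i := fun he =>
          (List.nodup_cons.1 hnd).1 (he ▸ List.mem_map_of_mem ht')
        exact h.1.lt.ne (h'.1.eq _ hne)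

theorem length_sweepItems {β γ γ' : Type*} (s : List (Item (Item β γ) γ')) :
    (sweepItems s).length = s.length := by
  have h₁ := (sortItems_perm_sorted s).1.length_eq
  have h₂ := (sortItems_perm_sorted ((sortItems s).map Item.pay)).1.length_eq
  simp only [List.length_map] at h₁ h₂
  rw [sweepItems, h₂, h₁]

theorem length_cands_le (M : List (Fin d → ℕ)) (F : List (Frame d)) :
    (cands M F).length ≤ F.length * M.length := by
  induction F with
  | nil => simp [cands]
  | cons t F ih =>
    have he : cands M (t :: F) =
      (sweepItems (M.map (minItem t))).foldr candStep [] ++ cands M F := foldr_candStep _ _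
    have := (foldr_candStep_sublist (sweepItems (M.map (minItem t)))).length_le
    simp only [List.length_map, length_sweepItems] at this
    rw [he, List.length_append, List.length_cons]
    linarith

end

/-! ### Grouping the spikes -/

section
variable {d : ℕ} {Q : Set (Fin d → ℕ)} {M D : List (Fin d → ℕ)} {t : Frame d} {up : Bool}

/-- A point as a sorting key. -/
def pointKey (x : Fin d → ℕ) : List ℤ := List.ofFn fun l => (x l : ℤ)

theorem pointKey_injective : Function.Injective (pointKey (d := d)) := by
  intro x y h
  ext l
  exact_mod_cast congrFun (List.ofFn_injective h) l

/-- The item that represents a candidate. -/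
def candItem (c : Cand d) : Item (Cand d) Unit where
  key := pointKey c.1
  val := none
  ans := none
  pay := c

/-- A point `q`, a point `b` and a list of points `as`: several candidates with the same `q`. -/
abbrev Group (d : ℕ) := (Fin d → ℕ) × (Fin d → ℕ) × List (Fin d → ℕ)

open Classical in
/-- Add a candidate to a list of groups. -/
noncomputable def groupStep (r : Item (Cand d) Unit) : List (Group d) → List (Group d)
  | [] => [(r.pay.1, r.pay.2.2, [r.pay.2.1])]
  | g :: G => if g.1 = r.pay.1 then (g.1, g.2.1, r.pay.2.1 :: g.2.2) :: G
    else (r.pay.1, r.pay.2.2, [r.pay.2.1]) :: g :: G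

/-- Group a sorted list of candidates. -/
noncomputable def groups (s : List (Item (Cand d) Unit)) : List (Group d) :=
  s.foldr groupStep []

-- Equal points are consecutive in a sorted list, so comparing with the first group suffices and
-- each group collects all candidates at its point.
open Classical in
theorem groups_spec {s : List (Item (Cand d) Unit)}
    (hs : s.Pairwise fun r r' => pointKey r.pay.1 ≤ pointKey r'.pay.1) :
    ((groups s).Pairwise fun g g' => pointKey g.1 < pointKey g'.1) ∧
    (∀ g ∈ groups s, g.2.2 = ((s.map Item.pay).filter fun c => c.1 = g.1).map (fun c => c.2.1) ∧
      ∃ r ∈ s, r.pay.1 = g.1 ∧ r.pay.2.2 = g.2.1) ∧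
    ∀ r ∈ s, r.pay.1 ∈ (groups s).map Prod.fst := by
  induction s with
  | nil => simp [groups]
  | cons r s ih =>
    obtain ⟨h₁, h₂, h₃⟩ := ih hs.of_cons
    have hle : ∀ g ∈ groups s, pointKey r.pay.1 ≤ pointKey g.1 := by
      intro g hg
      obtain ⟨-, r', hr', he, -⟩ := h₂ g hg
      exact he ▸ List.rel_of_pairwise_cons hs hr'
    have he : groups (r :: s) = groupStep r (groups s) := rfl
    rw [he]
    match hG : groups s with
    | [] =>
      have hs0 : s = [] := by
        rw [hG] at h₃
        exact List.eq_nil_iff_forall_not_mem.2 fun r hr => by simpa using h₃ r hr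
      simp [groupStep, hs0]
    | g :: G =>
      rw [hG] at h₁ h₂ h₃ hle
      rw [groupStep]
      split_ifs with hg
      · refine ⟨?_, ?_, ?_⟩
        · rw [List.pairwise_cons] at h₁ ⊢
          exact h₁
        · intro g' hg'
          obtain rfl | hg' := List.mem_cons.1 hg'
          · obtain ⟨h, r', hr', hr''⟩ := h₂ g (by simp)
            exact ⟨by simp [hg, h], r', by simp [hr'], hr''⟩
          · obtain ⟨h, r', hr', hr''⟩ := h₂ g' (by simp [hg'])
            have hne : r.pay.1 ≠ g'.1 := fun h => by
              have := List.rel_of_pairwise_cons h₁ hg'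
              rw [hg, h] at this
              exact this.false
            exact ⟨by simp [hne, h], r', by simp [hr'], hr''⟩
        · intro r' hr'
          obtain rfl | hr' := List.mem_cons.1 hr'
          · simp [hg]
          · simpa using h₃ r' hr'
      · have hlt : ∀ g' ∈ g :: G, pointKey r.pay.1 < pointKey g'.1 := by
          have h0 : pointKey r.pay.1 < pointKey g.1 :=
            lt_of_le_of_ne (hle g (by simp)) fun h => hg (pointKey_injective h).symm
          intro g' hg'
          obtain rfl | hg' := List.mem_cons.1 hg'
          · exact h0
          · exact h0.trans (List.rel_of_pairwise_cons h₁ hg')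
        refine ⟨List.pairwise_cons.2 ⟨hlt, h₁⟩, ?_, ?_⟩
        · intro g' hg'
          obtain rfl | hg' := List.mem_cons.1 hg'
          · have : (s.map Item.pay).filter (fun c => c.1 = r.pay.1) = [] := by
              rw [List.filter_eq_nil_iff]
              intro c hc
              obtain ⟨r', hr', rfl⟩ := List.mem_map.1 hc
              obtain ⟨g', hg', h⟩ := List.mem_map.1 (h₃ r' hr')
              rw [← h]
              simp only [decide_eq_true_eq]
              exact fun h : g'.1 = r.pay.1 => (hlt g' hg').ne (by rw [h])
            exact ⟨by simp [this], r, by simp⟩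
          · obtain ⟨h, r', hr', hr''⟩ := h₂ g' hg'
            have hne : r.pay.1 ≠ g'.1 := fun h => (hlt g' hg').ne (h ▸ rfl)
            exact ⟨by simp [hne, h], r', by simp [hr'], hr''⟩
        · intro r' hr'
          obtain rfl | hr' := List.mem_cons.1 hr'
          · simp
          · exact List.mem_cons_of_mem _ (h₃ r' hr')

/-- The groups of all candidates. -/
noncomputable def spikeGroups (M : List (Fin d → ℕ)) (F : List (Frame d)) : List (Group d) :=
  groups (sortItems ((cands M F).map candItem))

theorem length_groups_le (s : List (Item (Cand d) Unit)) : (groups s).length ≤ s.length := by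
  induction s with
  | nil => simp [groups]
  | cons r s ih =>
    have he : groups (r :: s) = groupStep r (groups s) := rfl
    rw [he, List.length_cons]
    generalize groups s = G at *
    cases G with
    | nil => simp [groupStep]
    | cons g G =>
      rw [groupStep]
      split_ifs <;> simp at ih ⊢ <;> omega

theorem length_sortItems {β γ : Type*} (s : List (Item β γ)) :
    (sortItems s).length = s.length := by
  simpa using (sortItems_perm_sorted s).1.length_eq

theorem length_spikeGroups_le (M : List (Fin d → ℕ)) (F : List (Frame d)) :
    (spikeGroups M F).length ≤ F.length * M.length := by
  refine (length_groups_le _).trans ?_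
  rw [length_sortItems, List.length_map]
  exact length_cands_le M F

/-- These are the hypotheses of `represent_complete`, apart from membership in `Q`, which is tested
later. -/
theorem spikeGroups_spec (hM : Enumerates M (minima Q)) {F : List (Frame d)}
    (hF : ∀ t ∈ F, t.Valid) (hnd : (F.map Frame.i).Nodup) (hi : ∀ i, ∃ t ∈ F, t.i = i) :
    ((spikeGroups M F).map Prod.fst).Nodup ∧
    (∀ g ∈ spikeGroups M F, (∀ a, a ∈ g.2.2 ↔ ∃ i, IsSpike Q i a g.1) ∧ g.2.2.Nodup ∧
      g.2.2 ≠ [] ∧ g.2.1 ∈ minima Q ∧ g.2.1 ≤ g.1 ∧ ∀ a, g.2.2 = [a] → g.2.1 ≠ a) ∧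
    ∀ i a q, IsSpike Q i a q → q ∈ (spikeGroups M F).map Prod.fst := by
  classical
  obtain ⟨hc, hs⟩ := sortItems_perm_sorted ((cands M F).map candItem)
  obtain ⟨hc₁, hc₂, hc₃⟩ := cands_spec hM hF hnd
  rw [spikeGroups]
  set s := sortItems ((cands M F).map candItem) with hsdef
  have hpay : (s.map Item.pay).Perm (cands M F) := by
    have := hc.map fun c => c.2.2
    simpa [Function.comp_def, Item.core, candItem] using this
  have hkey : ∀ r ∈ s, r.key = pointKey r.pay.1 := by
    intro r hr
    obtain ⟨r', hr', he⟩ := List.mem_map.1 (hc.subset (List.mem_map_of_mem hr))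
    obtain ⟨c, -, rfl⟩ := List.mem_map.1 hr'
    simp only [Item.core, Prod.mk.injEq] at he
    rw [← he.1, ← he.2.2]
    rfl
  have hc₃' : (s.map Item.pay).Pairwise fun c c' => c.1 = c'.1 → c.2.1 ≠ c'.2.1 := by
    refine (hpay.pairwise_iff ?_).2 hc₃
    intro c c' h he
    exact (h he.symm).symm
  obtain ⟨h₁, h₂, h₃⟩ := groups_spec (hs.imp_of_mem fun {r r'} hr hr' h => by
    rwa [hkey r hr, hkey r' hr'] at h)
  refine ⟨?_, ?_, ?_⟩
  · exact List.pairwise_map.2 (h₁.imp fun {g g'} h (he : g.1 = g'.1) => h.ne (he ▸ rfl))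
  · intro g hg
    obtain ⟨has, r, hr, hrq, hrb⟩ := h₂ g hg
    have hmem : ∀ a, a ∈ g.2.2 ↔ ∃ b, (g.1, a, b) ∈ cands M F := by
      intro a
      rw [has]
      simp only [List.mem_map, List.mem_filter, decide_eq_true_eq]
      constructor
      · rintro ⟨c, ⟨⟨r, hr, rfl⟩, hc⟩, rfl⟩
        exact ⟨r.pay.2.2, hc ▸ hpay.subset (List.mem_map_of_mem hr)⟩
      · rintro ⟨b, hb⟩
        obtain ⟨r, hr, he⟩ := List.mem_map.1 (hpay.symm.subset hb)
        exact ⟨_, ⟨⟨r, hr, he⟩, rfl⟩, rfl⟩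
    have hrc : r.pay ∈ cands M F := hpay.subset (List.mem_map_of_mem hr)
    obtain ⟨t, ht, hrt⟩ := hc₁ _ hrc
    have hra : r.pay.2.1 ∈ g.2.2 := (hmem _).2 ⟨r.pay.2.2, hrq ▸ hrc⟩
    refine ⟨fun a => ?_, ?_, List.ne_nil_of_mem hra, hrb ▸ hrt.2.1, ?_, ?_⟩
    · rw [hmem]
      constructor
      · rintro ⟨b, hb⟩
        obtain ⟨t, ht, h⟩ := hc₁ _ hb
        exact ⟨_, h.1⟩
      · rintro ⟨i, h⟩
        obtain ⟨t, ht, rfl⟩ := hi i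
        exact hc₂ t ht a _ h
    · rw [has]
      refine List.pairwise_map.2 (List.Pairwise.imp_of_mem ?_ (hc₃'.filter _))
      intro c c' hc hc' h
      simp only [List.mem_filter, decide_eq_true_eq] at hc hc'
      exact h (hc.2.trans hc'.2.symm)
    · rw [← hrb, ← hrq]
      exact hrt.2.2.2
    -- The stored point is the companion of some candidate in the group; when there is just one
    -- spike, it belongs to that spike and differs from it.
    · intro a ha
      rw [ha, List.mem_singleton] at hra
      rw [← hrb, ← hra]
      exact hrt.2.2.1
  · intro i a q h
    obtain ⟨t, ht, rfl⟩ := hi i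
    obtain ⟨b, hb⟩ := hc₂ t ht a q h
    obtain ⟨r, hr, he⟩ := List.mem_map.1 (hpay.symm.subset hb)
    have := h₃ r hr
    rwa [he] at this

/-! ### The membership test -/

/-- The coordinates are negated if `up` is false. -/
def signed (up : Bool) (n : ℕ) : ℤ := if up then .ofNat n else .negSucc n

theorem signed_le_signed {m n : ℕ} : signed up m ≤ signed up n ↔ if up then m ≤ n else n ≤ m := by
  cases up
  · simp only [signed, Bool.false_eq_true, if_false, Int.negSucc_eq]
    omega
  · simp [signed]

/-- The key for the first sorting; `n` distinguishes between data and queries. -/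
def Frame.signedKey (t : Frame d) (up : Bool) (n : ℕ) (x : Fin d → ℕ) : List ℤ :=
  [signed up (x t.j), signed up (x t.k), (n : ℤ)]

/-- A point, or a point with a list of representatives. -/
abbrev Query (d : ℕ) := (Fin d → ℕ) ⊕ (Fin d → ℕ) × List (Fin d → ℕ)

/-- The item that represents a point of the list for the membership test. -/
def dataItem (up : Bool) (t : Frame d) (y : Fin d → ℕ) : Item (Item (Query d) Unit) Unit where
  key := t.signedKey up 0 y
  val := none
  ans := none
  pay := { key := [signed up (y t.k)], val := some (signed up (y t.i), ()), ans := none,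
           pay := .inl y }

/-- The item that represents a group. -/
def queryItem (up : Bool) (t : Frame d) (g : Group d) : Item (Item (Query d) Unit) Unit where
  key := t.signedKey up 1 g.1
  val := none
  ans := none
  pay := { key := [signed up (g.1 t.k)], val := none, ans := none,
           pay := .inr (g.1, complete g.2.1 g.2.2) }

/-- The last entry of the key, 0 for data and 1 for queries, breaks ties in favour of the data, so
that the strict lexicographic order captures weak inequalities. -/
theorem Frame.signedKey_lt_iff {x y : Fin d → ℕ} :
    t.signedKey up 0 y < t.signedKey up 1 x ∧ [signed up (y t.k)] ≤ [signed up (x t.k)] ↔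
      signed up (y t.j) ≤ signed up (x t.j) ∧ signed up (y t.k) ≤ signed up (x t.k) := by
  rw [key_singleton_le]
  simp only [Frame.signedKey, List.cons_lt_cons_iff, and_congr_left_iff]
  intro hk
  rw [le_iff_lt_or_eq] at hk ⊢
  simp [hk]

/-- Whether a query precedes another one for sweeping. -/
def precedes (up : Bool) (t : Frame d) : Query d → Query d → Prop
  | .inl y, .inr g => t.signedKey up 0 y < t.signedKey up 1 g.1
  | _, _ => False

/-- The answers to the queries. -/
noncomputable def testSweep (up : Bool) (t : Frame d) (D : List (Fin d → ℕ)) (G : List (Group d)) :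
    List (Item (Query d) Unit) :=
  sweepItems (G.foldr (fun g l => queryItem up t g :: l) (D.map (dataItem up t)))

/-- Only queries need answers and only data carry values, so no order among the queries or among the
data is required. -/
theorem testSweep_spec (D : List (Fin d → ℕ)) (G : List (Group d)) :
    ((testSweep up t D G).map Item.pay).Perm
      (G.map (fun g => .inr (g.1, complete g.2.1 g.2.2)) ++ D.map .inl) ∧
    ∀ r ∈ testSweep up t D G, ∀ g, r.pay = .inr g →
      IsBest r.ans {p | ∃ y ∈ D, p = (signed up (y t.i), ()) ∧
        signed up (y t.j) ≤ signed up (g.1 t.j) ∧ signed up (y t.k) ≤ signed up (g.1 t.k)} := by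
  have he : G.foldr (fun g l => queryItem up t g :: l) (D.map (dataItem up t)) =
      G.map (queryItem up t) ++ D.map (dataItem up t) := by
    induction G <;> simp_all
  rw [testSweep, he]
  obtain ⟨hc, hs⟩ := sortItems_perm_sorted (G.map (queryItem up t) ++ D.map (dataItem up t))
  rw [sweepItems]
  set s := sortItems (G.map (queryItem up t) ++ D.map (dataItem up t)) with hsdef
  have hmem : ∀ x ∈ s, (∃ g ∈ G, x.key = t.signedKey up 1 g.1 ∧ x.pay = (queryItem up t g).pay) ∨
      ∃ y ∈ D, x.key = t.signedKey up 0 y ∧ x.pay = (dataItem up t y).pay := by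
    intro x hx
    obtain ⟨y, hy, he⟩ := List.mem_map.1 (hc.subset (List.mem_map_of_mem hx))
    simp only [Item.core, Prod.mk.injEq] at he
    obtain hy | hy := List.mem_append.1 hy
    · obtain ⟨g, hg, rfl⟩ := List.mem_map.1 hy
      exact .inl ⟨g, hg, he.1.symm, he.2.2.symm⟩
    · obtain ⟨g, hg, rfl⟩ := List.mem_map.1 hy
      exact .inr ⟨g, hg, he.1.symm, he.2.2.symm⟩
  have hne : ∀ x y : Fin d → ℕ, t.signedKey up 0 x ≠ t.signedKey up 1 y := by
    simp [Frame.signedKey]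
  have hpay : (s.map Item.pay).Perm
      (G.map (fun g => (queryItem up t g).pay) ++ D.map fun y => (dataItem up t y).pay) := by
    have := hc.map fun c => c.2.2
    simpa [Function.comp_def, Item.core] using this
  have hsw := swept_sortItems (W := fun q => ∃ g, q = .inr g) (Pre := precedes up t)
    (s := s.map Item.pay) (by
      rw [List.pairwise_map]
      refine hs.imp_of_mem fun {x y} hx hy h => ?_
      obtain ⟨a, ha, hxk, hxp⟩ | ⟨a, ha, hxk, hxp⟩ := hmem x hx <;>
      obtain ⟨b, hb, hyk, hyp⟩ | ⟨b, hb, hyk, hyp⟩ := hmem y hy <;>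
      rw [hxk, hyk] at h <;> rw [hxp, hyp] <;>
      simp only [SweepOrder, queryItem, dataItem, precedes, ne_eq, not_true_eq_false,
        false_imp_iff, implies_true, and_true, true_and, reduceCtorEq, exists_false,
        Sum.inr.injEq, exists_eq', not_false_eq_true, forall_const]
      · exact h.not_gt
      · exact lt_of_le_of_ne h (hne _ _))
    (by
      rintro r hr ⟨g, hg⟩
      obtain ⟨x, hx, rfl⟩ := List.mem_map.1 hr
      obtain ⟨a, ha, hxk, hxp⟩ | ⟨a, ha, hxk, hxp⟩ := hmem x hx
      · rw [hxp]
        exact ⟨rfl, fun h => absurd rfl h⟩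
      · rw [hxp] at hg
        simp [dataItem] at hg)
  refine ⟨?_, ?_⟩
  · have := (hsw.core.map fun c => c.2.2)
    simp only [List.map_map] at this
    refine this.trans ?_
    have := hpay.map Item.pay
    simpa [Function.comp_def, queryItem, dataItem, Item.core] using this
  · intro r hr g hg
    convert hsw.ans r hr ⟨g, hg⟩ using 1
    obtain ⟨r', hr', hk, -, hp⟩ := hsw.exists_core hr
    obtain ⟨x', hx', rfl⟩ := List.mem_map.1 hr'
    have hrk : r.key = [signed up (g.1 t.k)] := by
      rw [← hk]
      rw [hg] at hp
      obtain ⟨a, ha, -, hxp⟩ | ⟨a, ha, -, hxp⟩ := hmem x' hx'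
      · rw [hxp] at hp ⊢
        simp only [queryItem, Sum.inr.injEq] at hp
        rw [← hp]
        rfl
      · rw [hxp] at hp
        simp [dataItem] at hp
    ext p
    constructor
    · rintro ⟨y, hy, rfl, hyg⟩
      obtain ⟨l, hl, hly⟩ := List.mem_map.1 (hpay.symm.subset (List.mem_append_right _
        (List.mem_map_of_mem (f := fun y => (dataItem up t y).pay) hy)))
      refine ⟨_, List.mem_map_of_mem hl, ?_⟩
      rw [hly, hg, hrk]
      exact ⟨rfl, Frame.signedKey_lt_iff.2 hyg⟩
    · rintro ⟨l, hl, hlv, hlt⟩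
      obtain ⟨x, hx, rfl⟩ := List.mem_map.1 hl
      obtain ⟨a, ha, -, hxp⟩ | ⟨y, hy, -, hxp⟩ := hmem x hx
      · rw [hxp] at hlv
        simp [queryItem] at hlv
      · rw [hxp, hrk, hg] at hlt
        rw [hxp] at hlv
        exact ⟨y, hy, (Option.some_injective _ hlv).symm, Frame.signedKey_lt_iff.1 hlt⟩

open Classical in
/-- Select the groups that pass the membership test. -/
noncomputable def selectStep (up : Bool) (t : Frame d) (r : Item (Query d) Unit)
    (acc : List ((Fin d → ℕ) × List (Fin d → ℕ))) : List ((Fin d → ℕ) × List (Fin d → ℕ)) :=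
  match r.pay with
  | .inl _ => acc
  | .inr g =>
    match r.ans with
    | none => if up then g :: acc else acc
    | some p => if p.1 ≤ signed up (g.1 t.i) then if up then acc else g :: acc
      else if up then g :: acc else acc

/-- The points of the initial hull that are not minima, with representatives of the components of
their open downsets. -/
noncomputable def spikes (up : Bool) (t : Frame d) (D M : List (Fin d → ℕ)) (F : List (Frame d)) :
    List ((Fin d → ℕ) × List (Fin d → ℕ)) :=
  (testSweep up t D (spikeGroups M F)).foldr (selectStep up t) []

-- Some point of `D` is comparable with the query in all coordinates exactly when the best `i`-value
-- among those comparable in `j` and `k` is small enough. Negation lets one comparison serve for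
-- deaths and for maxima.
open Classical in
theorem spikes_perm (ht : t.Valid) (D M : List (Fin d → ℕ)) (F : List (Frame d)) :
    (spikes up t D M F).Perm (((spikeGroups M F).map fun g => (g.1, complete g.2.1 g.2.2)).filter
      fun g => Passes up D g.1) := by
  obtain ⟨hp, hb⟩ := testSweep_spec (up := up) (t := t) D (spikeGroups M F)
  rw [spikes]
  generalize testSweep up t D (spikeGroups M F) = s at *
  set f : Query d → Option ((Fin d → ℕ) × List (Fin d → ℕ)) :=
    Sum.elim (fun _ => none) fun g => if Passes up D g.1 then some g else none with hf
  have hs : s.foldr (selectStep up t) [] = (s.map Item.pay).filterMap f := by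
    clear hp
    induction s with
    | nil => rfl
    | cons r s ih =>
      rw [List.foldr_cons, ih fun r hr => hb r (List.mem_cons_of_mem _ hr), List.map_cons,
        selectStep]
      match hr : r.pay with
      | .inl y => rfl
      | .inr g =>
        have hbest := hb r (by simp) g hr
        have key : (∃ p, r.ans = some p ∧ p.1 ≤ signed up (g.1 t.i)) ↔
            ∃ y ∈ D, if up then y ≤ g.1 else g.1 ≤ y := by
          have hle : ∀ y : Fin d → ℕ, (if up then y ≤ g.1 else g.1 ≤ y) ↔
              signed up (y t.i) ≤ signed up (g.1 t.i) ∧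
              signed up (y t.j) ≤ signed up (g.1 t.j) ∧
              signed up (y t.k) ≤ signed up (g.1 t.k) := by
            intro y
            simp only [signed_le_signed]
            cases up
            · simpa using ht.le_iff (x := g.1) (y := y)
            · simpa using ht.le_iff (x := y) (y := g.1)
          simp only [hle]
          constructor
          · rintro ⟨p, hp, hpl⟩
            obtain ⟨y, hy, rfl, hyg⟩ := hbest.1 p hp
            exact ⟨y, hy, hpl, hyg⟩
          · rintro ⟨y, hy, hyi, hyg⟩
            obtain ⟨p, hp, hpl⟩ := hbest.2 _ ⟨y, hy, rfl, hyg⟩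
            exact ⟨p, hp, hpl.trans hyi⟩
        have hpass : Passes up D g.1 ↔
            if up then ¬ ∃ y ∈ D, if up then y ≤ g.1 else g.1 ≤ y
            else ∃ y ∈ D, if up then y ≤ g.1 else g.1 ≤ y := by
          cases up <;> simp [Passes]
        rw [← key] at hpass
        simp only [hf, List.filterMap_cons, Sum.elim_inr, hpass]
        match r.ans with
        | none => cases up <;> simp
        | some p => by_cases h : p.1 ≤ signed up (g.1 t.i) <;> cases up <;> simp [h]
  rw [hs]
  refine (hp.filterMap f).trans (List.Perm.of_eq ?_)
  rw [List.filterMap_append]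
  have h₁ : (D.map Sum.inl).filterMap f = [] := by
    simp [hf]
  rw [h₁, List.append_nil]
  generalize spikeGroups M F = G
  clear hp hb hs h₁
  induction G with
  | nil => simp
  | cons g G ih =>
    rw [List.map_cons, List.filterMap_cons, List.map_cons, List.filter_cons, ih]
    by_cases h : Passes up D g.1 <;> simp [hf, h]

/-- Every grouped point lies above a minimum, so `Delimits` decides its membership in `Q`; inside
`Q`, `exists_isSpike` gives completeness and `represent_complete` the representatives. -/
theorem spikes_spec (hd : d ≤ 3) (hQ : Q.OrdConnected) (hM : Enumerates M (minima Q))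
    (hD : Delimits up D Q) (ht : t.Valid) {F : List (Frame d)} (hF : ∀ t ∈ F, t.Valid)
    (hnd : (F.map Frame.i).Nodup) (hi : ∀ i, ∃ t ∈ F, t.i = i) :
    ((spikes up t D M F).map Prod.fst).Nodup ∧
    (∀ g ∈ spikes up t D M F, g.1 ∈ Q ∧ 2 ≤ g.2.length ∧ Represent Q g.1 g.2) ∧
    (∀ q ∈ initialHull Q, q ∉ minima Q → q ∈ (spikes up t D M F).map Prod.fst) ∧
    (∀ g ∈ spikes up t D M F, g.2.length ≤ d + 1) ∧
    (spikes up t D M F).length ≤ F.length * M.length := by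
  classical
  have hp := spikes_perm (up := up) ht D M F
  obtain ⟨h₁, h₂, h₃⟩ := spikeGroups_spec hM hF hnd hi
  have hmem : ∀ g, g ∈ spikes up t D M F ↔
      ∃ g' ∈ spikeGroups M F, g = (g'.1, complete g'.2.1 g'.2.2) ∧ Passes up D g'.1 := by
    intro g
    rw [hp.mem_iff]
    simp only [List.mem_filter, List.mem_map, decide_eq_true_eq]
    constructor
    · rintro ⟨⟨g', hg', rfl⟩, h⟩
      exact ⟨g', hg', rfl, h⟩
    · rintro ⟨g', hg', rfl, h⟩
      exact ⟨⟨g', hg', rfl⟩, h⟩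
  have hQm : ∀ g ∈ spikeGroups M F, Passes up D g.1 ↔ g.1 ∈ Q := by
    intro g hg
    obtain ⟨-, -, -, hb, hbq, -⟩ := h₂ g hg
    exact (hD _ hb.prop _ hbq).symm
  refine ⟨?_, ?_, ?_, ?_, ?_⟩
  · rw [(hp.map Prod.fst).nodup_iff]
    refine (List.filter_sublist.map Prod.fst).nodup ?_
    simpa [Function.comp_def] using h₁
  · intro g hg
    obtain ⟨g', hg', rfl, h⟩ := (hmem g).1 hg
    have hgQ := (hQm g' hg').1 h
    obtain ⟨a₁, a₂, a₃, a₄, a₅, a₆⟩ := h₂ g' hg'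
    exact ⟨hgQ, represent_complete hd hQ hgQ a₁ a₂ a₃ a₄ a₅ a₆⟩
  · intro q hq hqm
    obtain ⟨i, a, h⟩ := exists_isSpike hd hQ hq hqm
    obtain ⟨g', hg', rfl⟩ := List.mem_map.1 (h₃ i a q h)
    exact List.mem_map.2 ⟨_, (hmem _).2 ⟨g', hg', rfl, (hQm g' hg').2 hq.1⟩, rfl⟩
  · intro g hg
    obtain ⟨g', hg', rfl, h⟩ := (hmem g).1 hg
    obtain ⟨a₁, a₂, -⟩ := h₂ g' hg'
    have hlen := length_le_of_pairwise (fun a ha => (a₁ a).1 ha) a₂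
    generalize g'.2.2 = as at *
    match as with
    | [] => simp [complete]
    | [a] => simp [complete] at hlen ⊢; omega
    | a :: a' :: as => simp only [complete]; omega
  · refine hp.length_eq.trans_le ((List.length_filter_le _ _).trans ?_)
    rw [List.length_map]
    exact length_spikeGroups_le M F

end

/-! ### Access to coordinates -/

/-- The `l`-th element of a linked list. -/
def Val.nth? : ℕ → Val → Option Val
  | 0, v => v.fst?
  | l + 1, v => v.snd?.bind (nth? l)

/-- An expression for the `l`-th element of a linked list. -/
def nthExp : ℕ → Exp → Exp
  | 0, e => .fst e
  | l + 1, e => nthExp l (.snd e)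

@[simp] theorem sem_nthExp {P : Program} {ρ : List Val} {l : ℕ} {e : Exp} :
    sem P ρ (nthExp l e) =
      chain (sem P ρ e) fun v t => (v.nth? l).map fun a => (a, t + l + 1) := by
  induction l generalizing e with
  | zero => rw [nthExp, sem_fst]; rfl
  | succ l ih =>
    rw [nthExp, ih, sem_snd]
    obtain _ | ⟨_ | ⟨a, b⟩, t⟩ := sem P ρ e
    · rfl
    · rfl
    · simp only [chain_some, Val.snd?, Option.map_some, Val.nth?, Option.bind_some]
      congr! 4
      omega

@[simp] theorem nth?_encPoint {d : ℕ} (l : Fin d) (x : Fin d → ℕ) :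
    (encPoint x).nth? l = some (.atom (x l)) := by
  induction d with
  | zero => exact l.elim0
  | succ d ih =>
    rw [encPoint_succ]
    refine Fin.cases ?_ (fun l => ?_) l
    · rfl
    · exact ih l fun i => x i.succ

/-- Negate a number if `up` is false. -/
def signExp (up : Bool) (e : Exp) : Exp := if up then e else .cons (.const 0) e

theorem encInt_natCast (n : ℕ) : encInt n = .atom n := rfl

theorem encInt_signed_true (n : ℕ) : encInt (signed true n) = .atom n := rfl

theorem encInt_signed_false (n : ℕ) :
    encInt (signed false n) = .cons (.atom 0) (.atom n) := rfl

/-- Nonnegative integers are encoded as plain numbers, so a point serves as its own sorting key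
without conversion. -/
theorem encKey_pointKey {d : ℕ} (x : Fin d → ℕ) : encKey (pointKey x) = encPoint x := by
  simp only [encKey, pointKey, encPoint, List.map_ofFn, Function.comp_def, encInt_natCast]

theorem length_pointKey {d : ℕ} (x : Fin d → ℕ) : (pointKey x).length = d := by
  simp [pointKey]

/-! ### The program for small dimensions -/

section
variable {d : ℕ}

/-- The functions, starting at number `f`, that produce the candidates for a frame: the items, the
candidates, and the composition of these. -/
def frameExps (f : ℕ) (t : Frame d) : List Exp :=
  [foldExp f (.const 0) (.letIn (.fst (.fst (.var 1)))
      (.cons (.cons (.cons (nthExp t.j (.var 0)) (.cons (nthExp t.k (.var 0)) (.const 0)))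
        (.cons (.const 0) (.cons (.const 0) (.cons (.cons (nthExp t.k (.var 0)) (.const 0))
          (.cons (.cons (nthExp t.i (.var 0)) (.var 0)) (.cons (.const 0) (.var 0)))))))
        (.var 1))),
    foldExp (f + 1) (.snd (.var 0)) (.letIn (.snd (.snd (.fst (.fst (.var 1)))))
      (.ifAtom (.fst (.var 0)) (.var 1)
        (.letIn (.call 11 (.cons (.snd (.var 0)) (.snd (.fst (.var 0)))))
          (.cons (.cons (.var 0) (.cons (.const 0) (.cons (.const 0)
            (.cons (.var 0) (.cons (.snd (.var 1)) (.snd (.fst (.var 1))))))))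
            (.var 2))))),
    .call (f + 1) (.cons (.call 10 (.call f (.cons (.fst (.var 0)) (.const 0)))) (.snd (.var 0)))]

/-- The functions for several frames. -/
def framesExps (f : ℕ) : List (Frame d) → List Exp
  | [] => []
  | t :: F => frameExps f t ++ framesExps (f + 3) F

/-- The program `P` contains the functions for several frames. -/
def HasFrames (P : Program) : ℕ → List (Frame d) → Prop
  | _, [] => True
  | f, t :: F => P[f]? = (frameExps f t)[0]? ∧ P[f + 1]? = (frameExps f t)[1]? ∧
      P[f + 2]? = (frameExps f t)[2]? ∧ HasFrames P (f + 3) F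

/-- An expression for the candidates of several frames. -/
def candsExp (m : Exp) (f : ℕ) : List (Frame d) → Exp
  | [] => .const 0
  | _ :: F => .call (f + 2) (.cons m (candsExp m (f + 3) F))

/-- The program that finds the spikes by sweeping. -/
def sweepProgram (up : Bool) (t : Frame d) (F : List (Frame d)) : Program :=
  [.letIn (.call 15 (.cons (.call 10 (.call 13 (.cons (.call 12 (.cons (.call 8
      (candsExp (.fst (.var 0)) 19 F)) (.const 0)))
      (.call 14 (.cons (.snd (.var 0)) (.const 0)))))) (.const 0)))
    (.cons (.call 16 (.cons (.var 0) (.fst (.var 1)))) (.call 18 (.cons (.var 0) (.const 0))))] ++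
  sortExps ++
  [foldExp 9 (.const 0) (.cons (.snd (.snd (.snd (.fst (.fst (.var 1)))))) (.var 0)),
    .call 8 (.call 9 (.cons (.call 8 (.var 0)) (.const 0))),
    joinExp 11,
    foldExp 12 (.const 0) (.letIn (.snd (.snd (.snd (.fst (.fst (.var 1))))))
      (.letIn (.cons (.cons (.fst (.var 0)) (.cons (.snd (.snd (.var 0)))
          (.cons (.fst (.snd (.var 0))) (.const 0)))) (.var 1))
        (.ifAtom (.var 2) (.var 0)
          (.ifLe (.call 2 (.cons (.fst (.fst (.var 2))) (.fst (.var 1)))) (.const 0)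
            (.ifLe (.call 2 (.cons (.fst (.var 1)) (.fst (.fst (.var 2))))) (.const 0)
              (.cons (.cons (.fst (.fst (.var 2))) (.cons (.fst (.snd (.fst (.var 2))))
                (.cons (.fst (.snd (.var 1))) (.snd (.snd (.fst (.var 2)))))))
                (.snd (.var 2)))
              (.var 0))
            (.var 0))))),
    foldExp 13 (.snd (.var 0)) (.letIn (.fst (.fst (.var 1)))
      (.letIn (.fst (.var 0)) (.letIn (.snd (.snd (.var 1)))
        (.cons (.cons (.cons (signExp up (nthExp t.j (.var 1)))
            (.cons (signExp up (nthExp t.k (.var 1))) (.cons (.const 1) (.const 0))))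
          (.cons (.const 0) (.cons (.const 0) (.cons
            (.cons (signExp up (nthExp t.k (.var 1))) (.const 0))
            (.cons (.const 0) (.cons (.const 0) (.cons (.var 1)
              (.ifAtom (.var 0) (.var 0) (.ifAtom (.snd (.var 0))
                (.cons (.fst (.snd (.var 2))) (.var 0)) (.var 0))))))))))
          (.var 3))))),
    foldExp 14 (.const 0) (.letIn (.fst (.fst (.var 1)))
      (.cons (.cons (.cons (signExp up (nthExp t.j (.var 0)))
          (.cons (signExp up (nthExp t.k (.var 0))) (.cons (.const 0) (.const 0))))
        (.cons (.const 0) (.cons (.const 0) (.cons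
          (.cons (signExp up (nthExp t.k (.var 0))) (.const 0))
          (.cons (.cons (signExp up (nthExp t.i (.var 0))) (.const 0))
            (.cons (.const 0) (.const 0)))))))
        (.var 1))),
    foldExp 15 (.const 0) (.letIn (.snd (.snd (.fst (.fst (.var 1)))))
      (.ifAtom (.snd (.var 0)) (.var 1)
        (.letIn (.cons (.snd (.var 0)) (.var 1))
          (.ifAtom (.fst (.var 1)) (.var (if up then 0 else 2))
            (.ifLe (.call 1 (.cons (.fst (.fst (.var 1)))
                (signExp up (nthExp t.i (.fst (.snd (.var 1))))))) (.const 0)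
              (.var (if up then 2 else 0)) (.var (if up then 0 else 2)))))))] ++
  outputExps 16 ++ framesExps 19 F

/-- Several candidates with the same point. -/
def encRawGroup (g : Group d) : Val :=
  .cons (encPoint g.1) (.cons (encPoint g.2.1) (encPoints g.2.2))

/-- A candidate. -/
def encCand (c : Cand d) : Val :=
  .cons (encPoint c.1) (.cons (encPoint c.2.1) (encPoint c.2.2))

/-- A query, or a point without a query. -/
def encQuery : Query d → Val
  | .inl _ => .atom 0
  | .inr g => encGroup g

/-- The element of the unit type. -/
def encUnit (_ : Unit) : Val := .atom 0

/-- A bound for the time for sweeping at most `N` items, and for linear computations. -/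
def sweepTime (N : ℕ) : ℕ := sortTime 3 N

/-- Linear costs of the auxiliary passes can thus be absorbed into the time of a sweep. -/
theorem le_sweepTime (N : ℕ) : 8000 * (N + 1) ≤ sweepTime N := by
  have : (N + 1) * 1 ≤ (N + 1) * (Nat.clog 2 N + 1) := Nat.mul_le_mul_left _ (by omega)
  rw [sweepTime, sortTime]
  omega

/-! ### Correctness and running time of the sweep program -/

section
variable {up : Bool} {t : Frame d} {F : List (Frame d)}

theorem hasSort_sweepProgram : HasSort (sweepProgram up t F) := by
  intro k hk
  interval_cases k <;> rfl

theorem computes_unwrap {β γ γ' : Type*} {eb : β → Val} {ec : γ → Val} {ec' : γ' → Val}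
    (s : List (Item (Item β γ) γ')) :
    Computes (sweepProgram up t F) 9 (.cons (encList (s.map (encItem (encItem eb ec) ec'))) (.atom 0))
      (encList ((s.map Item.pay).map (encItem eb ec))) (50 * (s.length + 1)) := by
  have := computes_fold (P := sweepProgram up t F) (f := 9) rfl (encItem (encItem eb ec) ec')
    (fun s => encList (s.map (encItem eb ec))) (.atom 0) (fun r l => r.pay :: l) []
    (B := 10) (C := 20) (by simp [Yields, encList]) s (fun r l' _ => by
      generalize List.foldr _ _ _ = r
      simp [Yields, encItem, encList])
  have he : s.foldr (fun r l => r.pay :: l) [] = s.map Item.pay := by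
    clear this
    induction s <;> simp_all
  rw [he] at this
  exact this.mono (by omega)

theorem computes_sweep {β γ γ' : Type*} {eb : β → Val} {ec : γ → Val} {ec' : γ' → Val}
    (s : List (Item (Item β γ) γ')) (hs : ∀ r ∈ s, r.key.length ≤ 3 ∧ r.pay.key.length ≤ 3)
    {N : ℕ} (hN : s.length ≤ N) :
    Computes (sweepProgram up t F) 10 (encList (s.map (encItem (encItem eb ec) ec')))
      (encList ((sweepItems s).map (encItem eb ec))) (3 * sweepTime N) := by
  have hc := (sortItems_perm_sorted s).1
  obtain ⟨t₁, ht₁, h₁⟩ := computes_sort (P := sweepProgram up t F) (eb := encItem eb ec)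
    (ec := ec') hasSort_sweepProgram s (fun r hr => (hs r hr).1) hN
  obtain ⟨t₂, ht₂, h₂⟩ := computes_unwrap (up := up) (t := t) (F := F) (eb := eb) (ec := ec)
    (ec' := ec') (sortItems s)
  obtain ⟨t₃, ht₃, h₃⟩ := computes_sort (P := sweepProgram up t F) (eb := eb)
    (ec := ec) hasSort_sweepProgram ((sortItems s).map Item.pay) (κ := 3) (N := N)
    (by
      intro r hr
      obtain ⟨x, hx, rfl⟩ := List.mem_map.1 hr
      obtain ⟨y, hy, he⟩ := List.mem_map.1 (hc.subset (List.mem_map_of_mem hx))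
      simp only [Item.core, Prod.mk.injEq] at he
      rw [← he.2.2]
      exact (hs y hy).2) (by rwa [List.length_map, length_sortItems])
  rw [length_sortItems] at ht₂
  have := le_sweepTime N
  rw [← sweepTime] at ht₁ ht₃
  refine Computes.mono (B := t₁ + t₂ + t₃ + 20) ?_ (by omega)
  rw [Computes, app_of_getElem? rfl, sweepItems]
  simp [-List.map_map, h₁, h₂, h₃]
  omega

theorem computes_minItems {P : Program} {f : ℕ} (hd : d ≤ 3) (hf : P[f]? = (frameExps f t)[0]?)
    (M : List (Fin d → ℕ)) :
    Computes P f (.cons (encPoints M) (.atom 0))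
      (encList ((M.map (minItem t)).map (encItem (encItem encPoint encPoint) encPoint)))
      (100 * (M.length + 1)) := by
  have := computes_fold hf (encPoint (d := d))
    (fun s => encList (s.map (encItem (encItem encPoint encPoint) encPoint))) (.atom 0)
    (fun a l => minItem t a :: l) []
    (B := 10) (C := 60) (by simp [Yields, encList]) M (fun a l' _ => by
      generalize List.foldr _ _ _ = r
      have hi := t.i.isLt
      have hj := t.j.isLt
      have hk := t.k.isLt
      simp [Yields, encItem, encList, minItem, Frame.key, encKey, encInt_natCast, encOption]
      omega)
  have he : M.foldr (fun a l => minItem t a :: l) [] = M.map (minItem t) := by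
    clear this
    induction M <;> simp_all
  rw [he] at this
  exact this.mono (by omega)

/-- A list of candidates, prepared for sorting. -/
def encCands (l : List (Cand d)) : Val :=
  encList ((l.map candItem).map (encItem encCand encUnit))

theorem computes_candSteps {P : Program} {f : ℕ} (hd : d ≤ 3)
    (hf : P[f + 1]? = (frameExps f t)[1]?) (hj : P[11]? = some (joinExp 11))
    (s : List (Item (Fin d → ℕ) (Fin d → ℕ))) (acc : List (Cand d)) :
    Computes P (f + 1) (.cons (encList (s.map (encItem encPoint encPoint))) (encCands acc))
      (encCands (s.foldr candStep acc)) (300 * (s.length + 1)) := by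
  have := computes_fold hf (encItem (encPoint (d := d)) (encPoint (d := d)))
    encCands (encCands acc) candStep acc
    (B := 10) (C := 240) (by simp [Yields]) s (fun x l' _ => by
      generalize List.foldr _ _ _ = r
      match hx : x.ans with
      | none =>
        simp [Yields, encItem, candStep, hx, encOption]
      | some p =>
        obtain ⟨t₁, ht₁, h₁⟩ := computes_join hj x.pay p.2
        simp [Yields, encItem, candStep, hx, encOption, h₁, encCands, encList, candItem,
          encKey_pointKey, encCand]
        omega)
  exact this.mono (by omega)

theorem computes_frame (hd : d ≤ 3) {f : ℕ} {t' : Frame d}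
    (h₀ : (sweepProgram up t F)[f]? = (frameExps f t')[0]?)
    (h₁ : (sweepProgram up t F)[f + 1]? = (frameExps f t')[1]?)
    (h₂ : (sweepProgram up t F)[f + 2]? = (frameExps f t')[2]?)
    (M : List (Fin d → ℕ)) (acc : List (Cand d)) {N : ℕ} (hN : M.length ≤ N) :
    Computes (sweepProgram up t F) (f + 2) (.cons (encPoints M) (encCands acc))
      (encCands ((sweepItems (M.map (minItem t'))).foldr candStep acc)) (4 * sweepTime N) := by
  obtain ⟨t₁, ht₁, h₁⟩ := computes_candSteps hd h₁ rfl (sweepItems (M.map (minItem t'))) acc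
  obtain ⟨t₂, ht₂, h₂'⟩ := computes_minItems hd h₀ M
  obtain ⟨t₃, ht₃, h₃⟩ := computes_sweep (up := up) (t := t) (F := F) (eb := encPoint)
    (ec := encPoint) (ec' := encPoint) (M.map (minItem t')) (N := N) (by
      intro r hr
      obtain ⟨a, -, rfl⟩ := List.mem_map.1 hr
      simp [minItem, Frame.key]) (by simpa using hN)
  rw [length_sweepItems, List.length_map] at ht₁
  have := le_sweepTime N
  refine Computes.mono (B := t₁ + t₂ + t₃ + 20) ?_ (by omega)
  rw [Computes, app_of_getElem? h₂]
  simp [-List.map_map, h₁, h₂', h₃]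
  omega

theorem yields_cands (hd : d ≤ 3) {f : ℕ} {F' : List (Frame d)}
    (hF : HasFrames (sweepProgram up t F) f F') (M D : List (Fin d → ℕ)) {N : ℕ}
    (hN : M.length ≤ N) :
    Yields (sweepProgram up t F) [.cons (encPoints M) (encPoints D)]
      (candsExp (.fst (.var 0)) f F') (encCands (cands M F'))
      (F'.length * (5 * sweepTime N) + 1) := by
  induction F' generalizing f with
  | nil => simp [Yields, candsExp, cands, encCands, encList]
  | cons t' F' ih =>
    obtain ⟨h₀, h₁, h₂, hF⟩ := hF
    obtain ⟨t₁, ht₁, h⟩ := ih hF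
    obtain ⟨t₂, ht₂, h'⟩ := computes_frame hd h₀ h₁ h₂ M (cands M F') hN
    have he : cands M (t' :: F') =
      (sweepItems (M.map (minItem t'))).foldr candStep (cands M F') := rfl
    have := le_sweepTime N
    refine Yields.mono (B := t₁ + t₂ + 20) ?_ (by rw [List.length_cons, add_mul]; omega)
    rw [Yields, he]
    simp [candsExp, h, h']
    omega

/-- Equality of points is tested by two lexicographic comparisons of keys, which take bounded time
since `d ≤ 3`. -/
theorem computes_groups (hd : d ≤ 3) (s : List (Item (Cand d) Unit)) :
    Computes (sweepProgram up t F) 12 (.cons (encList (s.map (encItem encCand encUnit))) (.atom 0))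
      (encList ((groups s).map encRawGroup)) (1000 * (s.length + 1)) := by
  have := computes_fold (P := sweepProgram up t F) (f := 12) rfl (encItem (encCand (d := d)) encUnit)
    (fun G => encList (G.map encRawGroup)) (.atom 0) groupStep []
    (B := 10) (C := 900) (by simp [Yields, encList]) s (fun r l' _ => by
      generalize List.foldr _ _ _ = G
      match G with
      | [] =>
        simp [Yields, encItem, groupStep, encList, encCand, encRawGroup, encPoints]
      | g :: G =>
        obtain ⟨t₁, ht₁, h₁⟩ := computes_keyLe (hasSort_sweepProgram (up := up) (t := t) (F := F))
          (pointKey g.1) (pointKey r.pay.1)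
        obtain ⟨t₂, ht₂, h₂⟩ := computes_keyLe (hasSort_sweepProgram (up := up) (t := t) (F := F))
          (pointKey r.pay.1) (pointKey g.1)
        rw [encKey_pointKey, encKey_pointKey] at h₁ h₂
        rw [length_pointKey] at ht₁ ht₂
        rw [groupStep]
        by_cases h : g.1 = r.pay.1
        · rw [if_pos h]
          rw [h, encProp_of le_rfl] at h₁ h₂
          simp [Yields, encItem, encList, encCand, encRawGroup, encPoints, h₁, h]
          omega
        · rw [if_neg h]
          by_cases hle : pointKey g.1 ≤ pointKey r.pay.1
          · have hle' : ¬ pointKey r.pay.1 ≤ pointKey g.1 :=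
              fun h' => h (pointKey_injective (le_antisymm hle h'))
            rw [encProp_of hle] at h₁
            rw [encProp_of_not hle'] at h₂
            simp [Yields, encItem, encList, encCand, encRawGroup, encPoints, h₁, h₂]
            omega
          · rw [encProp_of_not hle] at h₁
            simp [Yields, encItem, encList, encCand, encRawGroup, encPoints, h₁]
            omega)
  exact this.mono (by omega)

/-- A list of items for the membership test. -/
def encTests (l : List (Item (Item (Query d) Unit) Unit)) : Val :=
  encList (l.map (encItem (encItem encQuery encUnit) encUnit))

theorem computes_dataItems (hd : d ≤ 3) (D : List (Fin d → ℕ)) :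
    Computes (sweepProgram up t F) 14 (.cons (encPoints D) (.atom 0))
      (encTests (D.map (dataItem up t))) (150 * (D.length + 1)) := by
  have := computes_fold (P := sweepProgram up t F) (f := 14) rfl (encPoint (d := d))
    encTests (.atom 0) (fun y l => dataItem up t y :: l) []
    (B := 10) (C := 120) (by simp [Yields, encTests, encList]) D (fun a l' _ => by
      generalize List.foldr _ _ _ = r
      have hi := t.i.isLt
      have hj := t.j.isLt
      have hk := t.k.isLt
      cases up <;>
      · simp [Yields, encItem, encTests, encList, dataItem, Frame.signedKey, encKey, encOption,
          signed, signExp, encInt, encQuery, encUnit]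
        omega)
  have he : D.foldr (fun y l => dataItem up t y :: l) [] = D.map (dataItem up t) := by
    clear this
    induction D <;> simp_all
  rw [he] at this
  exact this.mono (by omega)

theorem computes_queryItems (hd : d ≤ 3) (G : List (Group d))
    (l : List (Item (Item (Query d) Unit) Unit)) :
    Computes (sweepProgram up t F) 13 (.cons (encList (G.map encRawGroup)) (encTests l))
      (encTests (G.foldr (fun g l => queryItem up t g :: l) l)) (150 * (G.length + 1)) := by
  have := computes_fold (P := sweepProgram up t F) (f := 13) rfl (encRawGroup (d := d))
    encTests (encTests l) (fun g l => queryItem up t g :: l) l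
    (B := 10) (C := 120) (by simp [Yields]) G (fun g l' _ => by
      generalize List.foldr _ _ _ = r
      have hi := t.i.isLt
      have hj := t.j.isLt
      have hk := t.k.isLt
      obtain ⟨q, b, as⟩ := g
      match as with
      | [] =>
        cases up <;>
        · simp [Yields, encItem, encTests, encList, queryItem, Frame.signedKey, encKey, encOption,
            signed, signExp, encInt, encQuery, encGroup, encRawGroup, encPoints, complete]
          omega
      | [a] =>
        cases up <;>
        · simp [Yields, encItem, encTests, encList, queryItem, Frame.signedKey, encKey, encOption,
            signed, signExp, encInt, encQuery, encGroup, encRawGroup, encPoints, complete]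
          omega
      | a :: a' :: as =>
        cases up <;>
        · simp [Yields, encItem, encTests, encList, queryItem, Frame.signedKey, encKey, encOption,
            signed, signExp, encInt, encQuery, encGroup, encRawGroup, encPoints, complete]
          omega)
  exact this.mono (by omega)

theorem computes_select (hd : d ≤ 3) (s : List (Item (Query d) Unit)) :
    Computes (sweepProgram up t F) 15 (.cons (encList (s.map (encItem encQuery encUnit))) (.atom 0))
      (encList ((s.foldr (selectStep up t) []).map encGroup)) (150 * (s.length + 1)) := by
  have := computes_fold (P := sweepProgram up t F) (f := 15) rfl
    (encItem (encQuery (d := d)) encUnit) (fun G => encList (G.map encGroup)) (.atom 0)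
    (selectStep up t) [] (B := 10) (C := 120) (by simp [Yields, encList]) s (fun r l' _ => by
      generalize List.foldr _ _ _ = acc
      have hi := t.i.isLt
      match hr : r.pay with
      | .inl y => simp [Yields, encItem, selectStep, hr, encQuery]
      | .inr g =>
        match ha : r.ans with
        | none =>
          cases up <;>
          simp [Yields, encItem, selectStep, hr, ha, encQuery, encOption, encGroup, encList]
        | some p =>
          obtain ⟨t₁, ht₁, h₁⟩ := computes_intLe (hasSort_sweepProgram (up := up) (t := t) (F := F))
            p.1 (signed up (g.1 t.i))
          by_cases h : p.1 ≤ signed up (g.1 t.i)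
          · have hsel : selectStep up t r acc = if up then acc else g :: acc := by
              simp [selectStep, hr, ha, h]
            rw [encProp_of h] at h₁
            rw [hsel]
            cases up <;>
            · simp only [encInt_signed_false, encInt_signed_true] at h₁
              simp [Yields, encItem, hr, ha, encQuery, encOption, encGroup, encList, signExp, h₁]
              omega
          · have hsel : selectStep up t r acc = if up then g :: acc else acc := by
              simp [selectStep, hr, ha, h]
            rw [encProp_of_not h] at h₁
            rw [hsel]
            cases up <;>
            · simp only [encInt_signed_false, encInt_signed_true] at h₁
              simp [Yields, encItem, hr, ha, encQuery, encOption, encGroup, encList, signExp, h₁]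
              omega)
  exact this.mono (by omega)

theorem computes_spikes (hd : d ≤ 3) (hF : HasFrames (sweepProgram up t F) 19 F)
    (M D : List (Fin d → ℕ)) {N : ℕ} (hN : F.length * M.length + M.length + D.length ≤ N)
    (hlen : (spikes up t D M F).length ≤ F.length * M.length)
    (hk : ∀ g ∈ spikes up t D M F, g.2.length ≤ d + 1) :
    Computes (sweepProgram up t F) 0 (.cons (encPoints M) (encPoints D))
      (.cons (encPoints ((spikes up t D M F).map Prod.fst ++ M))
        (encRelations ((spikes up t D M F).flatMap fun g => g.2.map fun r => (r, g.1))))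
      ((5 * F.length + 7) * sweepTime N) := by
  have hS := le_sweepTime N
  have hc := length_cands_le M F
  have hG := length_spikeGroups_le M F
  obtain ⟨t₁, ht₁, h₁⟩ := yields_cands (up := up) (t := t) hd hF M D (N := N) (by omega)
  obtain ⟨t₂, ht₂, h₂⟩ := computes_sort (P := sweepProgram up t F) (eb := encCand)
    (ec := encUnit) hasSort_sweepProgram ((cands M F).map candItem) (κ := 3) (N := N) (by
      intro r hr
      obtain ⟨c, -, rfl⟩ := List.mem_map.1 hr
      exact (length_pointKey c.1).trans_le hd) (by rw [List.length_map]; omega)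
  obtain ⟨t₃, ht₃, h₃⟩ := computes_groups (up := up) (t := t) (F := F) hd
    (sortItems ((cands M F).map candItem))
  obtain ⟨t₄, ht₄, h₄⟩ := computes_dataItems (up := up) (t := t) (F := F) hd D
  obtain ⟨t₅, ht₅, h₅⟩ := computes_queryItems (up := up) (t := t) (F := F) hd (spikeGroups M F)
    (D.map (dataItem up t))
  have hs : ∀ r ∈ (spikeGroups M F).foldr (fun g l => queryItem up t g :: l)
      (D.map (dataItem up t)), r.key.length ≤ 3 ∧ r.pay.key.length ≤ 3 := by
    induction spikeGroups M F with
    | nil => simp [dataItem, Frame.signedKey]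
    | cons g G ih => exact List.forall_mem_cons.2 ⟨by simp [queryItem, Frame.signedKey], ih⟩
  have hl : ((spikeGroups M F).foldr (fun g l => queryItem up t g :: l)
      (D.map (dataItem up t))).length = (spikeGroups M F).length + D.length := by
    clear hs h₅ ht₅ hG
    induction spikeGroups M F with
    | nil => simp
    | cons g G ih => simp; omega
  obtain ⟨t₆, ht₆, h₆⟩ := computes_sweep (up := up) (t := t) (F := F) (eb := encQuery)
    (ec := encUnit) (ec' := encUnit) _ hs (N := N) (by omega)
  obtain ⟨t₇, ht₇, h₇⟩ := computes_select (up := up) (t := t) (F := F) hd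
    (testSweep up t D (spikeGroups M F))
  obtain ⟨t₈, ht₈, h₈⟩ := computes_elements (P := sweepProgram up t F) (f := 16) rfl
    (spikes up t D M F) M
  obtain ⟨t₉, ht₉, h₉⟩ := computes_relations (P := sweepProgram up t F) (f := 16) rfl rfl
    (spikes up t D M F) hk
  -- Each point has at most `d + 1 ≤ 4` representatives, so listing the relations takes linear time.
  replace ht₉ : t₉ ≤ 500 * ((spikes up t D M F).length + 1) := by
    refine ht₉.trans ?_
    nlinarith
  rw [length_sortItems, List.length_map] at ht₃
  have hlt : (testSweep up t D (spikeGroups M F)).length = (spikeGroups M F).length + D.length := by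
    rw [testSweep, length_sweepItems, hl]
  rw [hlt] at ht₇
  rw [← sweepTime] at ht₂
  refine Computes.mono (B := t₁ + t₂ + t₃ + t₄ + t₅ + t₆ + t₇ + t₈ + t₉ + 100) ?_ (by
    rw [add_mul, mul_comm 5, mul_assoc]
    omega)
  -- The folds are given the names of the functions they define, so that the output of each stage is
  -- recognised as the input of the next.
  change app _ _ _ = some (encList ((testSweep up t D (spikeGroups M F)).map _), _) at h₆
  change app _ _ _ = some (encList ((spikes up t D M F).map _), _) at h₇
  change app _ _ _ = some (encList ((spikeGroups M F).map _), _) at h₃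
  rw [Computes, app_of_getElem? rfl]
  simp only [encTests, encCands] at *
  simp [-List.map_map, -List.foldr_cons_eq_append, h₁, h₂, h₃, h₄, h₅, h₆, h₇, h₈, h₉]
  omega

end

theorem sweepProgram_runs (hd : d ≤ 3) {up : Bool} {t : Frame d} (ht : t.Valid)
    {F : List (Frame d)} (hF : ∀ t ∈ F, t.Valid) (hnd : (F.map Frame.i).Nodup)
    (hi : ∀ i, ∃ t ∈ F, t.i = i) (hP : HasFrames (sweepProgram up t F) 19 F)
    {Q : Set (Fin d → ℕ)} (hQ : Q.OrdConnected) {D M : List (Fin d → ℕ)}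
    (hM : Enumerates M (minima Q)) (hD : Delimits up D Q) :
    ∃ (out : Val) (s : ℕ),
      (sweepProgram up t F).Runs (.cons (encPoints M) (encPoints D)) out s ∧
      s ≤ (5 * F.length + 8) * sweepTime ((F.length + 1) * (M.length + D.length)) ∧
      ∃ P : Subposet Q, IsInitialScaffold P ∧ Represents out P := by
  obtain ⟨h₁, h₂, h₃, h₄, h₅⟩ := spikes_spec hd hQ hM hD ht hF hnd hi
  obtain ⟨P, h, he, hr⟩ := exists_isInitialScaffold (fun x => exists_minima_le Q) hM h₁ h₂ h₃
  have hS := le_sweepTime ((F.length + 1) * (M.length + D.length))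
  obtain ⟨s, hs, hrun⟩ := (computes_spikes (up := up) (t := t) hd hP M D
    (N := (F.length + 1) * (M.length + D.length)) (by nlinarith) h₅ h₄).runs
  refine ⟨_, s, hrun, ?_, P, h, _, _, he, hr, rfl⟩
  rw [add_mul] at hs ⊢
  omega

end

/-! ### Asymptotic bounds -/

theorem isBigO_sweepTime (c k : ℕ) :
    (fun n : ℕ => ((c * sweepTime (k * n) : ℕ) : ℝ)) =O[atTop]
      fun n : ℕ => (n : ℝ) * Real.log n := by
  refine IsBigO.of_bound (c * (8000 * ((k + 1) * (8 + 2 * Nat.clog 2 k)))) ?_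
  filter_upwards [eventually_ge_atTop 2] with n hn
  have hn0 : (0 : ℝ) < n := by positivity
  have hlog2 : (1 / 2 : ℝ) < Real.log 2 := by linarith [Real.log_two_gt_d9]
  have hlog : Real.log 2 ≤ Real.log n := Real.log_le_log (by norm_num) (by exact_mod_cast hn)
  have hclog : Nat.clog 2 (k * n) ≤ Nat.clog 2 k + (Nat.log 2 n + 1) := by
    refine Nat.clog_le_of_le_pow ?_
    rw [pow_add]
    exact Nat.mul_le_mul (Nat.le_pow_clog (by omega) k) (Nat.lt_pow_succ_log_self (by omega) n).le
  have hpow : (2 : ℝ) ^ Nat.log 2 n ≤ n := by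
    exact_mod_cast Nat.pow_log_le_self 2 (by omega)
  have h₁ : (Nat.log 2 n : ℝ) ≤ 2 * Real.log n := by
    have := Real.log_le_log (by positivity) hpow
    rw [Real.log_pow] at this
    nlinarith [Nat.cast_nonneg (α := ℝ) (Nat.log 2 n)]
  -- Since `Real.log n` exceeds 1/2, additive constants are absorbed at the price of a factor 2.
  have h₂ : ((Nat.clog 2 (k * n) + 1 : ℕ) : ℝ) ≤ (8 + 2 * Nat.clog 2 k) * Real.log n := by
    have : ((Nat.clog 2 (k * n) + 1 : ℕ) : ℝ) ≤ Nat.clog 2 k + (Nat.log 2 n + 1) + 1 := by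
      exact_mod_cast Nat.add_le_add_right hclog 1
    nlinarith [Nat.cast_nonneg (α := ℝ) (Nat.clog 2 k)]
  have h₃ : ((k * n + 1 : ℕ) : ℝ) ≤ (k + 1) * n := by
    push_cast
    have : (2 : ℝ) ≤ n := by exact_mod_cast hn
    linarith
  rw [Real.norm_of_nonneg (by positivity), Real.norm_of_nonneg (by nlinarith)]
  simp only [sweepTime, sortTime, Nat.reduceAdd, Nat.reduceMul]
  push_cast at h₂ h₃ ⊢
  calc (c : ℝ) * (8000 * ((k * n + 1) * (Nat.clog 2 (k * n) + 1)))
      ≤ c * (8000 * (((k + 1) * n) * ((8 + 2 * Nat.clog 2 k) * Real.log n))) := by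
        gcongr
    _ = _ := by ring

theorem isBigO_pow_four (c : ℕ) :
    (fun n : ℕ => ((c * (n + 1) ^ 4 : ℕ) : ℝ)) =O[atTop] fun n : ℕ => (n : ℝ) ^ 4 := by
  refine IsBigO.of_bound (16 * c) ?_
  filter_upwards [eventually_ge_atTop 1] with n hn
  have hn1 : (1 : ℝ) ≤ n := by exact_mod_cast hn
  rw [Real.norm_of_nonneg (by positivity), Real.norm_of_nonneg (by positivity)]
  push_cast
  calc (c : ℝ) * (n + 1) ^ 4 ≤ c * (2 * n) ^ 4 := by gcongr; linarith
    _ = _ := by ring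

/-! ### The algorithms -/

/-- The frames for the plane. -/
def planeFrames : List (Frame 2) := [⟨0, 1, 1⟩, ⟨1, 0, 0⟩]

/-- The frames for the space. -/
def spaceFrames : List (Frame 3) := [⟨0, 1, 2⟩, ⟨1, 0, 2⟩, ⟨2, 0, 1⟩]

theorem exists_sweepProgram {d : ℕ} (hd : d = 2 ∨ d = 3) (up : Bool) :
    ∃ (prog : Program) (c k : ℕ), ∀ Q : Set (Fin d → ℕ), Q.OrdConnected →
      ∀ M D : List (Fin d → ℕ), Enumerates M (minima Q) → Delimits up D Q →
        ∃ (out : Val) (s : ℕ), prog.Runs (.cons (encPoints M) (encPoints D)) out s ∧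
          s ≤ c * sweepTime (k * (M.length + D.length)) ∧
          ∃ P : Subposet Q, IsInitialScaffold P ∧ Represents out P := by
  obtain rfl | rfl := hd
  -- In the plane `j` and `k` both denote the only other coordinate, so the construction for space
  -- applies unchanged.
  · have hF : ∀ t ∈ planeFrames, t.Valid := by
      unfold Frame.Valid
      decide
    exact ⟨_, _, _, fun Q hQ M D hM hD => sweepProgram_runs (t := ⟨0, 1, 1⟩) (F := planeFrames)
      (by omega) (hF _ (by simp [planeFrames])) hF (by decide) (by decide)
      ⟨rfl, rfl, rfl, rfl, rfl, rfl, trivial⟩ hQ hM hD⟩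
  · have hF : ∀ t ∈ spaceFrames, t.Valid := by
      unfold Frame.Valid
      decide
    exact ⟨_, _, _, fun Q hQ M D hM hD => sweepProgram_runs (t := ⟨0, 1, 2⟩) (F := spaceFrames)
      (by omega) (hF _ (by simp [spaceFrames])) hF (by decide) (by decide)
      ⟨rfl, rfl, rfl, rfl, rfl, rfl, rfl, rfl, rfl, trivial⟩ hQ hM hD⟩

end InitScaffold

theorem theorem3p14 :
    (∀ d : ℕ, d = 2 ∨ d = 3 →
      ScaffoldFromUpsetPresentation d (fun n => (n : ℝ) * Real.log n) ∧
      ScaffoldFromExtrema d (fun n => (n : ℝ) * Real.log n)) ∧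
    (∀ d : ℕ, 3 < d →
      ScaffoldFromUpsetPresentation d (fun n => (n : ℝ) ^ 4) ∧
      ScaffoldFromExtrema d (fun n => (n : ℝ) ^ 4)) := by
  refine ⟨fun d hd => ⟨?_, ?_⟩, fun d _ => ⟨?_, ?_⟩⟩
  · obtain ⟨prog, c, k, h⟩ := exists_sweepProgram hd true
    exact ⟨prog, _, isBigO_sweepTime c k, fun Q hQ M D hM hD =>
      h Q hQ.2 M D hM (delimits_deaths hQ.2 hD)⟩
  · obtain ⟨prog, c, k, h⟩ := exists_sweepProgram hd false
    exact ⟨prog, _, isBigO_sweepTime c k, fun Q hQ hfin M D hM hD =>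
      h Q hQ.2 M D hM (delimits_maxima hQ.2 hfin hD)⟩
  · exact ⟨joinProgram true, _, isBigO_pow_four (5000 * (d + 1)), fun Q hQ M D hM hD =>
      joinProgram_runs hQ.2 hM (delimits_deaths hQ.2 hD)⟩
  · exact ⟨joinProgram false, _, isBigO_pow_four (5000 * (d + 1)), fun Q hQ hfin M D hM hD =>
      joinProgram_runs hQ.2 hM (delimits_maxima hQ.2 hfin hD)⟩
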